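/- Let $\Bbbk$ be an algebraically closed field of characteristic zero. Let $B=\bigoplus_{i\in\mathbb Z}B_i$ be a $\mathbb Z$-graded $\Bbbk$-algebra that is left and right noetherian and *commonly graded*, i.e. $B_i=0$ for $i\ll 0$ and $\dim_{\Bbbk}B_i<\infty$ for all $i$. For a graded left $B$-module $M$ let $\Gamma_{\mathfrak m}(M)=\{x\in M: B_{\ge n}x=0 \text{ for some } n\ge 1\}$, and let $R^i\Gamma_{\mathfrak m}$ be the $i$-th right derived functor of $\Gamma_{\mathfrak m}$ on the category of graded left $B$-modules (with degree-preserving homomorphisms). Put $$\operatorname{cd}(B)=\max\{i: R^i\Gamma_{\mathfrak m}(N)\ne 0\text{ for some graded left }B\text{-module }N\},$$ $$\operatorname{cd}(M)=\max\{i: R^i\Gamma_{\mathfrak m}(M)\neq 0\},\qquad \operatorname{depth}(M)=\min\{i: R^i\Gamma_{\mathfrak m}(M)\neq 0\}.$$ A finitely generated graded left module $M\neq 0$ is *Cohen–Macaulay* (CM) if $\operatorname{depth}(M)=\operatorname{cd}(M)<\infty$, and *maximal Cohen–Macaulay* (MCM) if moreover $\operatorname{cd}(M)=\operatorname{cd}(B)<\infty$;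 the notions for right modules are the same notions over the opposite graded algebra. The algebra $B$ is *CM* if it is MCM as a left and as a right module over itself. It is *of finite CM type* if, up to isomorphism and degree shift, it has only finitely many indecomposable MCM graded left modules. If $B$ is CM of depth $d$, let $\omega=R^d\Gamma_{\mathfrak m}(B)^{*}$ be the graded $\Bbbk$-linear dual of the graded $B$-bimodule $R^d\Gamma_{\mathfrak m}(B)$ (whose right structure is induced by right multiplication on $B$), regarded as a graded left $B$-module, and define the *representation dimension* $$\operatorname{repdim}(B)=\inf\{\operatorname{gldim}\operatorname{End}_B(B\oplus\omega\oplus M): M\text{ an MCM graded left }B\text{-module}\}.$$ Here $\operatorname{gldim}$ is the larger of the left and the right global dimension (the two agree for noetherian rings). **Statement.** Let $B$ be as above, and suppose that $B$ is CM, of finite CM type, and finitely generated as a module over a noetherian graded subalgebra contained in the center of $B$. Then $$\operatorname{repdim}(B)\le\max\{2,\operatorname{cd}(B)\}.$$ -/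

import Mathlib

open CategoryTheory CategoryTheory.Limits DirectSum

universe u

noncomputable section

namespace GradedCM

/-! #### Right derived functors of linear functors are linear -/

section Derived

variable {C D : Type*} [Category* C] [Abelian C] [EnoughInjectives C] [Category* D] [Abelian D]

lemma rightDerived_map_add (F : C ⥤ D) [F.Additive] (n : ℕ) {X Y : C} (f g : X ⟶ Y) :
    (F.rightDerived n).map (f + g) = (F.rightDerived n).map f + (F.rightDerived n).map g := by
  let P := InjectiveResolution.of X
  let Q := InjectiveResolution.of Y
  have hf := InjectiveResolution.desc_commutes f Q P
  have hg := InjectiveResolution.desc_commutes g Q P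
  rw [F.rightDerived_map_eq n f _ hf, F.rightDerived_map_eq n g _ hg,
    F.rightDerived_map_eq n (f + g) (InjectiveResolution.desc f Q P + InjectiveResolution.desc g Q P)
      (by rw [Preadditive.comp_add, hf, hg, Functor.map_add, Preadditive.add_comp])]
  rw [Functor.map_add]
  simp only [Preadditive.add_comp, Preadditive.comp_add]

lemma homologyMap_smul {R : Type*} [Semiring R] [Linear R D] {K L : CochainComplex D ℕ}
    (c : R) (φ : K ⟶ L) (n : ℕ) :
    HomologicalComplex.homologyMap (c • φ) n = c • HomologicalComplex.homologyMap φ n :=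
  ShortComplex.homologyMap_smul ((HomologicalComplex.shortComplexFunctor D _ n).map φ) c

lemma rightDerived_map_smul {R : Type*} [Semiring R] [Linear R C] [Linear R D]
    (F : C ⥤ D) [F.Additive] [F.Linear R] (n : ℕ) {X Y : C} (c : R) (f : X ⟶ Y) :
    (F.rightDerived n).map (c • f) = c • (F.rightDerived n).map f := by
  let P := InjectiveResolution.of X
  let Q := InjectiveResolution.of Y
  have hf := InjectiveResolution.desc_commutes f Q P
  have e : (CochainComplex.single₀ C).map (c • f) = c • (CochainComplex.single₀ C).map f := by
    ext
    simp [CochainComplex.single₀]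
    rfl
  have e2 : (F.mapHomologicalComplex (ComplexShape.up ℕ)).map (c • InjectiveResolution.desc f Q P) =
    c • (F.mapHomologicalComplex (ComplexShape.up ℕ)).map (InjectiveResolution.desc f Q P) := by
    ext i
    simp [Functor.map_smul]
  rw [F.rightDerived_map_eq n f _ hf, 
    F.rightDerived_map_eq n (c • f) (c • InjectiveResolution.desc f Q P)
      (by rw [Linear.comp_smul, hf, e, Linear.smul_comp])]
  simp only [Functor.comp_map, e2, HomologicalComplex.homologyFunctor_map, homologyMap_smul]
  erw [Linear.smul_comp, Linear.comp_smul]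
end Derived

/-! #### Graded modules -/

variable {k B : Type u} [Field k] [Ring B] [Algebra k B]

/-- A `ℤ`-graded left module over the graded algebra `B = ⨁ 𝒜 i`. -/
structure GrMod (𝒜 : ℤ → Submodule k B) where
  carrier : Type u
  [addCommGroup : AddCommGroup carrier]
  [moduleB : Module B carrier]
  [modulek : Module k carrier]
  [tower : IsScalarTower k B carrier]
  grading : ℤ → Submodule k carrier
  isInternal : DirectSum.IsInternal grading
  smul_mem : ∀ {i j : ℤ} {b : B} {x : carrier},
    b ∈ 𝒜 i → x ∈ grading j → b • x ∈ grading (i + j)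

namespace GrMod

attribute [instance] addCommGroup moduleB modulek tower

variable {𝒜 : ℤ → Submodule k B}

instance : CoeSort (GrMod 𝒜) (Type u) := ⟨carrier⟩

/-- The projection of a graded module to its component of degree `n`. -/
def comp (M : GrMod 𝒜) (n : ℤ) : M →ₗ[k] M :=
  letI := M.isInternal.chooseDecomposition
  (M.grading n).subtype ∘ₗ DirectSum.component k ℤ _ n ∘ₗ
    (DirectSum.decomposeLinearEquiv M.grading).toLinearMap

lemma comp_mem (M : GrMod 𝒜) (n : ℤ) (x : M) : M.comp n x ∈ M.grading n :=
  Subtype.property _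

lemma comp_same (M : GrMod 𝒜) {n : ℤ} {x : M} (hx : x ∈ M.grading n) : M.comp n x = x := by
  let _ := M.isInternal.chooseDecomposition
  exact DirectSum.decompose_of_mem_same M.grading hx

lemma comp_ne (M : GrMod 𝒜) {n m : ℤ} {x : M} (hx : x ∈ M.grading n) (h : n ≠ m) :
    M.comp m x = 0 := by
  let _ := M.isInternal.chooseDecomposition
  exact DirectSum.decompose_of_mem_ne M.grading hx h

lemma exists_sum (M : GrMod 𝒜) (x : M) : ∃ s : Finset ℤ, ∑ n ∈ s, M.comp n x = x := by
  classical
  let _ := M.isInternal.chooseDecomposition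
  exact ⟨_, DirectSum.sum_support_decompose M.grading x⟩

lemma ext_comp (M : GrMod 𝒜) {x y : M} (h : ∀ n, M.comp n x = M.comp n y) : x = y := by
  obtain ⟨s, hs⟩ := M.exists_sum (x - y)
  rw [← sub_eq_zero, ← hs]
  exact Finset.sum_eq_zero fun n _ => by rw [map_sub, h, sub_self]

lemma iSup_eq_top (M : GrMod 𝒜) : iSup M.grading = ⊤ := M.isInternal.submodule_iSup_eq_top

@[elab_as_elim]
lemma induction_homog (M : GrMod 𝒜) {p : M → Prop} (x : M)
    (h0 : p 0) (ha : ∀ x y, p x → p y → p (x + y))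
    (hh : ∀ n, ∀ x ∈ M.grading n, p x) : p x :=
  Submodule.iSup_induction M.grading (motive := p) (x := x) (by rw [M.iSup_eq_top]; trivial) hh h0 ha

lemma comp_smul (M : GrMod 𝒜) {i : ℤ} {b : B} (hb : b ∈ 𝒜 i) (j : ℤ) (x : M) :
    M.comp (i + j) (b • x) = b • M.comp j x := by
  induction x using M.induction_homog with
  | h0 => simp
  | ha x y hx hy => simp [hx, hy]
  | hh n x hx =>
    by_cases h : n = j
    · subst h
      rw [M.comp_same hx, M.comp_same (M.smul_mem hb hx)]
    · rw [M.comp_ne hx h, smul_zero, M.comp_ne (M.smul_mem hb hx) (by omega)]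

/-- A criterion for an internal direct sum, in terms of projections. -/
lemma isInternal_of_proj {V : Type u} [AddCommGroup V] [Module k V] (G : ℤ → Submodule k V)
    (p : ℤ → V →ₗ[k] V) (hs : ∀ n, ∀ x ∈ G n, p n x = x)
    (hne : ∀ n m, ∀ x ∈ G m, m ≠ n → p n x = 0) (ht : ∀ x, x ∈ iSup G) :
    DirectSum.IsInternal G := by
  rw [DirectSum.isInternal_submodule_iff_iSupIndep_and_iSup_eq_top]
  refine ⟨fun n => ?_, eq_top_iff.2 fun x _ => ht x⟩
  rw [Submodule.disjoint_def]
  intro x hx hx'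
  rw [← hs n x hx]
  have : (⨆ m, ⨆ (_ : m ≠ n), G m) ≤ LinearMap.ker (p n) :=
    iSup_le fun m => iSup_le fun hm y hy => hne n m y hy hm
  exact this hx'

/-- Morphisms of graded modules: `B`-linear maps which preserve degrees. -/
@[ext]
structure Hom (M N : GrMod 𝒜) where
  lin : M →ₗ[B] N
  map_mem : ∀ (n : ℤ) (x : M), x ∈ M.grading n → lin x ∈ N.grading n

instance : Category (GrMod 𝒜) where
  Hom := Hom
  id M := ⟨LinearMap.id, fun _ _ h => h⟩
  comp f g := ⟨g.lin ∘ₗ f.lin, fun n x h => g.map_mem n _ (f.map_mem n x h)⟩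

@[simp] lemma id_lin (M : GrMod 𝒜) : Hom.lin (𝟙 M) = LinearMap.id := rfl

@[simp] lemma comp_lin {M N P : GrMod 𝒜} (f : M ⟶ N) (g : N ⟶ P) :
    (f ≫ g).lin = g.lin ∘ₗ f.lin := rfl

@[ext] lemma hom_ext {M N : GrMod 𝒜} {f g : M ⟶ N} (h : ∀ x, f.lin x = g.lin x) : f = g :=
  Hom.ext (LinearMap.ext h)

lemma hom_comp {M N : GrMod 𝒜} (f : M ⟶ N) (n : ℤ) (x : M) :
    f.lin (M.comp n x) = N.comp n (f.lin x) := by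
  induction x using M.induction_homog with
  | h0 => simp
  | ha x y hx hy => simp [hx, hy]
  | hh m x hx =>
    by_cases h : m = n
    · subst h
      rw [M.comp_same hx, N.comp_same (f.map_mem _ _ hx)]
    · rw [M.comp_ne hx h, map_zero, N.comp_ne (f.map_mem _ _ hx) h]

lemma lin_smul {M N : GrMod 𝒜} (f : M →ₗ[B] N) (c : k) (x : M) :
    f (c • x) = c • f x := by
  rw [← algebraMap_smul B c x, map_smul, algebraMap_smul]

/-! #### The category of graded modules is preadditive and `k`-linear -/

section Preadditive

variable {M N : GrMod 𝒜}

instance : Zero (M ⟶ N) := ⟨⟨0, fun n _ _ => (N.grading n).zero_mem⟩⟩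
instance : Add (M ⟶ N) :=
  ⟨fun f g => ⟨f.lin + g.lin, fun n x h => add_mem (f.map_mem n x h) (g.map_mem n x h)⟩⟩
instance : Neg (M ⟶ N) := ⟨fun f => ⟨-f.lin, fun n x h => neg_mem (f.map_mem n x h)⟩⟩
instance : Sub (M ⟶ N) :=
  ⟨fun f g => ⟨f.lin - g.lin, fun n x h => sub_mem (f.map_mem n x h) (g.map_mem n x h)⟩⟩

/-- Scalar multiplication by elements of the base field on linear maps. -/
def smulLin (c : k) (f : M →ₗ[B] N) : M →ₗ[B] N where
  toFun x := c • f x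
  map_add' x y := by simp
  map_smul' b x := by
    simp only [map_smul, RingHom.id_apply]
    rw [← algebraMap_smul B c, ← algebraMap_smul B c, ← mul_smul, ← mul_smul, Algebra.commutes]

instance : SMul k (M ⟶ N) :=
  ⟨fun c f => ⟨smulLin c f.lin,
    fun n x h => (N.grading n).smul_mem _ (f.map_mem n x h)⟩⟩

@[simp] lemma zero_lin : Hom.lin (0 : M ⟶ N) = 0 := rfl
@[simp] lemma add_lin (f g : M ⟶ N) : (f + g).lin = f.lin + g.lin := rfl
@[simp] lemma neg_lin (f : M ⟶ N) : (-f).lin = -f.lin := rfl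
@[simp] lemma sub_lin (f g : M ⟶ N) : (f - g).lin = f.lin - g.lin := rfl
@[simp] lemma smul_lin_apply (c : k) (f : M ⟶ N) (x : M) : (c • f).lin x = c • f.lin x := rfl

instance : AddCommGroup (M ⟶ N) where
  add_assoc f g h := by ext; simp [add_assoc]
  zero_add f := by ext; simp
  add_zero f := by ext; simp
  add_comm f g := by ext; simp [add_comm]
  neg_add_cancel f := by ext; simp
  sub_eq_add_neg f g := by ext; simp [sub_eq_add_neg]
  nsmul := nsmulRec
  zsmul := zsmulRec

instance : Module k (M ⟶ N) where
  one_smul f := by ext; simp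
  mul_smul c d f := by ext; simp [mul_smul]
  smul_zero c := by ext; simp
  smul_add c f g := by ext; simp
  add_smul c d f := by ext; simp [add_smul]
  zero_smul f := by ext; simp

end Preadditive

instance : Preadditive (GrMod 𝒜) where
  add_comp _ _ _ f g h := by ext; simp
  comp_add _ _ _ f g h := by ext; simp

instance : Linear k (GrMod 𝒜) where
  smul_comp _ _ _ c f g := by ext; exact lin_smul g.lin c _
  comp_smul _ _ _ f c g := by ext; simp


/-! #### Subobjects, quotients, products -/

lemma mem_iSup_of_comp {V : Type u} [AddCommGroup V] [Module k V] (G : ℤ → Submodule k V)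
    {x : V} (s : Finset ℤ) (f : ℤ → V) (hf : ∀ n, f n ∈ G n) (h : ∑ n ∈ s, f n = x) :
    x ∈ iSup G := by
  rw [← h]
  exact Submodule.sum_mem _ fun n _ => Submodule.mem_iSup_of_mem n (hf n)

/-- A homogeneous submodule, as a graded module. -/
def sub (M : GrMod 𝒜) (P : Submodule B M) (hP : ∀ n, ∀ x ∈ P, M.comp n x ∈ P) : GrMod 𝒜 where
  carrier := P
  grading n := (M.grading n).comap (P.subtype.restrictScalars k)
  isInternal := by
    refine isInternal_of_proj _
      (fun n => (M.comp n).restrict (p := P.restrictScalars k) (q := P.restrictScalars k)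
        fun x hx => hP n x hx) ?_ ?_ ?_
    · intro n x hx
      exact Subtype.ext (M.comp_same hx)
    · intro n m x hx h
      exact Subtype.ext (M.comp_ne hx h)
    · intro x
      obtain ⟨s, hs⟩ := M.exists_sum x.1
      refine mem_iSup_of_comp _ s (fun n => ⟨M.comp n x.1, hP n _ x.2⟩)
        (fun n => M.comp_mem n x.1) ?_
      apply Subtype.ext
      refine Eq.trans ?_ hs
      exact map_sum P.subtype _ s
  smul_mem hb hx := M.smul_mem hb hx

/-- The inclusion of a homogeneous submodule. -/
def subι (M : GrMod 𝒜) (P : Submodule B M) (hP : ∀ n, ∀ x ∈ P, M.comp n x ∈ P) :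
    M.sub P hP ⟶ M :=
  ⟨P.subtype, fun _ _ h => h⟩

/-- The quotient by a homogeneous submodule, as a graded module. -/
def quot (M : GrMod 𝒜) (P : Submodule B M) (hP : ∀ n, ∀ x ∈ P, M.comp n x ∈ P) : GrMod 𝒜 where
  carrier := M ⧸ P
  grading n := (M.grading n).map (P.mkQ.restrictScalars k)
  isInternal := by
    refine isInternal_of_proj _
      (fun n => (P.restrictScalars k).mapQ (P.restrictScalars k) (M.comp n)
        fun x hx => hP n x hx) ?_ ?_ ?_
    · rintro n _ ⟨x, hx, rfl⟩
      exact congrArg P.mkQ (M.comp_same hx)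
    · rintro n m _ ⟨x, hx, rfl⟩ h
      exact (congrArg P.mkQ (M.comp_ne hx h)).trans (map_zero _)
    · intro x
      obtain ⟨x, rfl⟩ := P.mkQ_surjective x
      obtain ⟨s, hs⟩ := M.exists_sum x
      refine mem_iSup_of_comp _ s (fun n => P.mkQ (M.comp n x))
        (fun n => ⟨_, M.comp_mem n x, rfl⟩) ?_
      rw [← map_sum, hs]
  smul_mem := by
    rintro i j b _ hb ⟨x, hx, rfl⟩
    exact ⟨b • x, M.smul_mem hb hx, map_smul P.mkQ b x⟩

/-- The projection to the quotient by a homogeneous submodule. -/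
def quotπ (M : GrMod 𝒜) (P : Submodule B M) (hP : ∀ n, ∀ x ∈ P, M.comp n x ∈ P) :
    M ⟶ M.quot P hP :=
  ⟨P.mkQ, fun _ x h => ⟨x, h, rfl⟩⟩

/-- The zero graded module. -/
def zero (𝒜 : ℤ → Submodule k B) : GrMod 𝒜 where
  carrier := PUnit
  grading _ := ⊥
  isInternal := isInternal_of_proj _ 0 (fun _ _ _ => rfl) (fun _ _ _ _ _ => rfl)
    (fun x => by rw [Subsingleton.elim x 0]; exact zero_mem _)
  smul_mem _ _ := Subsingleton.elim _ _

/-- The direct sum of two graded modules. -/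
def prod (M N : GrMod 𝒜) : GrMod 𝒜 where
  carrier := M × N
  grading n := (M.grading n).prod (N.grading n)
  isInternal := by
    refine isInternal_of_proj _ (fun n => (M.comp n).prodMap (N.comp n)) ?_ ?_ ?_
    · intro n x hx
      exact Prod.ext (M.comp_same hx.1) (N.comp_same hx.2)
    · intro n m x hx h
      exact Prod.ext (M.comp_ne hx.1 h) (N.comp_ne hx.2 h)
    · intro x
      obtain ⟨s, hs⟩ := M.exists_sum x.1
      obtain ⟨t, ht⟩ := N.exists_sum x.2
      have : x = (x.1, 0) + (0, x.2) := by simp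
      rw [this]
      refine add_mem ?_ ?_
      · refine mem_iSup_of_comp _ s (fun n => (M.comp n x.1, 0))
          (fun n => ⟨M.comp_mem n x.1, zero_mem _⟩) ?_
        ext
        · simp [hs, Prod.fst_sum]
        · simp [Prod.snd_sum]
      · refine mem_iSup_of_comp _ t (fun n => (0, N.comp n x.2))
          (fun n => ⟨zero_mem _, N.comp_mem n x.2⟩) ?_
        ext
        · simp [Prod.fst_sum]
        · simp [ht, Prod.snd_sum]
  smul_mem hb hx := ⟨M.smul_mem hb hx.1, N.smul_mem hb hx.2⟩

lemma isZero_zero : IsZero (zero 𝒜) := by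
  rw [IsZero.iff_id_eq_zero]
  ext x
  exact Subsingleton.elim (α := PUnit) _ _

instance : HasZeroObject (GrMod 𝒜) := ⟨zero 𝒜, isZero_zero⟩

instance : HasBinaryBiproducts (GrMod 𝒜) where
  has_binary_biproduct M N := HasBinaryBiproduct.mk
    { bicone :=
        { pt := M.prod N
          fst := ⟨LinearMap.fst B M N, fun _ _ h => h.1⟩
          snd := ⟨LinearMap.snd B M N, fun _ _ h => h.2⟩
          inl := ⟨LinearMap.inl B M N, fun n _ h => ⟨h, (N.grading n).zero_mem⟩⟩
          inr := ⟨LinearMap.inr B M N, fun n _ h => ⟨(M.grading n).zero_mem, h⟩⟩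
          inl_fst := by ext; rfl
          inl_snd := by ext; rfl
          inr_fst := by ext; rfl
          inr_snd := by ext; rfl }
      isBilimit := isBinaryBilimitOfTotal _ (by
        ext x
        exact Prod.ext (add_zero x.1) (zero_add x.2)) }

instance : HasFiniteProducts (GrMod 𝒜) :=
  have : HasTerminal (GrMod 𝒜) := HasZeroObject.hasTerminal
  hasFiniteProducts_of_has_binary_and_terminal

/-! #### Kernels and cokernels; the category of graded modules is abelian -/

section Abelian

variable {M N : GrMod 𝒜} (f : M ⟶ N)

lemma ker_homog (n : ℤ) (x : M) (hx : x ∈ LinearMap.ker f.lin) :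
    M.comp n x ∈ LinearMap.ker f.lin := by
  rw [LinearMap.mem_ker] at hx ⊢
  rw [hom_comp, hx, map_zero]

lemma range_homog (n : ℤ) (x : N) (hx : x ∈ LinearMap.range f.lin) :
    N.comp n x ∈ LinearMap.range f.lin := by
  obtain ⟨y, rfl⟩ := hx
  exact ⟨M.comp n y, hom_comp f n y⟩

/-- A morphism whose values lie in a homogeneous submodule factors through it. -/
def codRestrict {L : GrMod 𝒜} (g : L ⟶ M) (P : Submodule B M)
    (hP : ∀ n, ∀ x ∈ P, M.comp n x ∈ P) (h : ∀ x, g.lin x ∈ P) : L ⟶ M.sub P hP :=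
  ⟨g.lin.codRestrict P h, fun n x hx => g.map_mem n x hx⟩

/-- A morphism which kills a homogeneous submodule factors through the quotient. -/
def quotLift (P : Submodule B M)
    (hP : ∀ n, ∀ x ∈ P, M.comp n x ∈ P) (h : P ≤ LinearMap.ker f.lin) : M.quot P hP ⟶ N :=
  ⟨P.liftQ f.lin h, by
    rintro n _ ⟨x, hx, rfl⟩
    exact f.map_mem n x hx⟩

lemma subι_ker : M.subι (LinearMap.ker f.lin) (ker_homog f) ≫ f = 0 := by
  ext x
  exact x.2

lemma quotπ_range : f ≫ N.quotπ (LinearMap.range f.lin) (range_homog f) = 0 := by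
  ext x
  exact (Submodule.Quotient.mk_eq_zero _).2 ⟨x, rfl⟩

/-- The kernel of a morphism. -/
def kerFork : KernelFork f :=
  KernelFork.ofι (M.subι (LinearMap.ker f.lin) (ker_homog f)) (subι_ker f)

/-- `kerFork f` is a kernel. -/
def kerForkIsLimit : IsLimit (kerFork f) :=
  KernelFork.IsLimit.ofι _ (subι_ker f)
    (fun {_} g hg => codRestrict g _ (ker_homog f) fun x =>
      congrArg (fun h : _ ⟶ N => h.lin x) hg)
    (fun _ _ => by ext; rfl)
    (fun {_} g hg m hm => by
      ext x
      exact Subtype.ext (congrArg (fun h : _ ⟶ M => h.lin x) hm))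

/-- The cokernel of a morphism. -/
def cokerCofork : CokernelCofork f :=
  CokernelCofork.ofπ (N.quotπ (LinearMap.range f.lin) (range_homog f)) (quotπ_range f)

/-- `cokerCofork f` is a cokernel. -/
def cokerCoforkIsColimit : IsColimit (cokerCofork f) :=
  CokernelCofork.IsColimit.ofπ _ (quotπ_range f)
    (fun {_} g hg => quotLift g _ (range_homog f) (by
      rintro _ ⟨x, rfl⟩
      exact congrArg (fun h : M ⟶ _ => h.lin x) hg))
    (fun _ _ => by ext; rfl)
    (fun {_} g hg m hm => by
      ext x
      obtain ⟨x, rfl⟩ := Submodule.mkQ_surjective _ x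
      exact congrArg (fun h : N ⟶ _ => h.lin x) hm)

instance : HasKernels (GrMod 𝒜) where
  has_limit f := HasLimit.mk ⟨kerFork f, kerForkIsLimit f⟩

instance : HasCokernels (GrMod 𝒜) where
  has_colimit f := HasColimit.mk ⟨cokerCofork f, cokerCoforkIsColimit f⟩

lemma injective_of_mono [Mono f] : Function.Injective f.lin := by
  rw [← LinearMap.ker_eq_bot, eq_bot_iff]
  intro x hx
  have h : M.subι (LinearMap.ker f.lin) (ker_homog f) = 0 := by
    rw [← cancel_mono f, zero_comp]
    ext y
    exact y.2
  exact congrArg (fun g : M.sub _ (ker_homog f) ⟶ M => g.lin ⟨x, hx⟩) h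

lemma mono_of_injective (h : Function.Injective f.lin) : Mono f where
  right_cancellation g₁ g₂ e := by
    ext x
    exact h (congrArg (fun g : _ ⟶ N => g.lin x) e)

lemma surjective_of_epi [Epi f] : Function.Surjective f.lin := by
  intro y
  have h : N.quotπ (LinearMap.range f.lin) (range_homog f) = 0 := by
    rw [← cancel_epi f, comp_zero]
    ext x
    exact (Submodule.Quotient.mk_eq_zero _).2 ⟨x, rfl⟩
  exact (Submodule.Quotient.mk_eq_zero _).1
    (congrArg (fun g : N ⟶ N.quot _ (range_homog f) => g.lin y) h)

/-- A bijective morphism is an isomorphism. -/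
def isoOfBijective (h : Function.Bijective f.lin) : M ≅ N where
  hom := f
  inv := ⟨(LinearEquiv.ofBijective f.lin h).symm, fun n y hy => by
    obtain ⟨x, rfl⟩ := h.2 y
    have : x = M.comp n x := h.1 (by rw [hom_comp, N.comp_same hy])
    have h' : (LinearEquiv.ofBijective f.lin h).symm (f.lin x) = x :=
      (LinearEquiv.ofBijective f.lin h).symm_apply_apply x
    erw [h']
    rw [this]
    exact M.comp_mem n x⟩
  hom_inv_id := by ext x; exact (LinearEquiv.ofBijective f.lin h).symm_apply_apply x
  inv_hom_id := by ext x; exact (LinearEquiv.ofBijective f.lin h).apply_symm_apply x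

/-- Every monomorphism is a kernel. -/
@[reducible] def normalMono [Mono f] : NormalMono f where
  Z := N.quot (LinearMap.range f.lin) (range_homog f)
  g := N.quotπ (LinearMap.range f.lin) (range_homog f)
  w := quotπ_range f
  isLimit :=
    let f' := codRestrict f (LinearMap.range f.lin) (range_homog f) fun x => ⟨x, rfl⟩
    have hf' : Function.Bijective f'.lin :=
      ⟨fun x y h => injective_of_mono f (congrArg Subtype.val h), by
        rintro ⟨_, x, rfl⟩
        exact ⟨x, rfl⟩⟩
    let e := isoOfBijective f' hf'
    have key {L : GrMod 𝒜} (g : L ⟶ N.sub _ (range_homog f)) :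
        (g ≫ e.inv) ≫ f = g ≫ N.subι _ (range_homog f) := by
      change (g ≫ e.inv) ≫ e.hom ≫ N.subι _ (range_homog f) = _
      simp
    KernelFork.IsLimit.ofι _ (quotπ_range f)
      (fun {_} g hg => codRestrict g _ (range_homog f) (fun x =>
        (Submodule.Quotient.mk_eq_zero _).1
          (congrArg (fun h : _ ⟶ N.quot _ (range_homog f) => h.lin x) hg)) ≫ e.inv)
      (fun {_} g hg => key _)
      (fun {_} g hg m hm => by
        rw [← cancel_mono f, hm]
        symm
        refine (key _).trans ?_
        rfl)

/-- Every epimorphism is a cokernel. -/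
@[reducible] def normalEpi [Epi f] : NormalEpi f where
  W := M.sub (LinearMap.ker f.lin) (ker_homog f)
  g := M.subι (LinearMap.ker f.lin) (ker_homog f)
  w := subι_ker f
  isColimit :=
    let f' := quotLift f (LinearMap.ker f.lin) (ker_homog f) le_rfl
    have hf' : Function.Bijective f'.lin :=
      ⟨LinearMap.ker_eq_bot.1 (Submodule.ker_liftQ_eq_bot _ _ _ le_rfl), fun y => by
        obtain ⟨x, rfl⟩ := surjective_of_epi f y
        exact ⟨Submodule.Quotient.mk x, rfl⟩⟩
    let e := isoOfBijective f' hf'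
    have key {L : GrMod 𝒜} (g : M.quot _ (ker_homog f) ⟶ L) :
        f ≫ e.inv ≫ g = M.quotπ _ (ker_homog f) ≫ g := by
      change (M.quotπ _ (ker_homog f) ≫ e.hom) ≫ e.inv ≫ g = _
      simp
    CokernelCofork.IsColimit.ofπ _ (subι_ker f)
      (fun {_} g hg => e.inv ≫ quotLift g _ (ker_homog f) (fun x hx =>
        congrArg (fun h : M.sub _ (ker_homog f) ⟶ _ => h.lin ⟨x, hx⟩) hg))
      (fun {_} g hg => key _)
      (fun {_} g hg m hm => by
        rw [← cancel_epi f, hm]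
        symm
        refine (key _).trans ?_
        rfl)

end Abelian

instance : Abelian (GrMod 𝒜) where
  normalMonoOfMono f _ := ⟨normalMono f⟩
  normalEpiOfEpi f _ := ⟨normalEpi f⟩

/-! #### Degree shifts and the regular module -/

/-- The degree shift `M(n)`, with `M(n)_i = M_{n + i}`. -/
def shift (M : GrMod 𝒜) (n : ℤ) : GrMod 𝒜 where
  carrier := M
  grading i := M.grading (n + i)
  isInternal := isInternal_of_proj _ (fun i => M.comp (n + i)) (fun _ _ hx => M.comp_same hx)
    (fun _ _ _ hx h => M.comp_ne hx (by omega)) (fun x => by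
      obtain ⟨s, hs⟩ := M.exists_sum x
      rw [← hs]
      refine Submodule.sum_mem _ fun m _ => Submodule.mem_iSup_of_mem (m - n) ?_
      rw [add_sub_cancel]
      exact M.comp_mem m x)
  smul_mem {i j _ _} hb hx := by
    rw [show n + (i + j) = i + (n + j) by omega]
    exact M.smul_mem hb hx

/-- The forgetful functor to (ungraded) left `B`-modules. -/
def forget (𝒜 : ℤ → Submodule k B) : GrMod 𝒜 ⥤ ModuleCat.{u} B where
  obj M := ModuleCat.of B M
  map f := ModuleCat.ofHom f.lin

lemma hom_ext_homog {M N : GrMod 𝒜} {f g : M ⟶ N}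
    (h : ∀ n, ∀ x ∈ M.grading n, f.lin x = g.lin x) : f = g := by
  ext x
  induction x using M.induction_homog with
  | h0 => simp
  | ha x y hx hy => rw [map_add, map_add, hx, hy]
  | hh n x hx => exact h n x hx

section GradedRing

variable [GradedAlgebra 𝒜]

variable (𝒜) in
/-- `B` as a graded left module over itself. -/
def self : GrMod 𝒜 where
  carrier := B
  grading := 𝒜
  isInternal := DirectSum.Decomposition.isInternal 𝒜
  smul_mem hb hx := SetLike.mul_mem_graded hb hx

/-- A graded module given by its components: a family of `k`-modules `V i` with associative and
unital multiplication maps `𝒜 i × V j → V (i + j)`. -/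
structure Components (𝒜 : ℤ → Submodule k B) [GradedAlgebra 𝒜] where
  V : ℤ → Type u
  [addCommGroup : ∀ i, AddCommGroup (V i)]
  [module : ∀ i, Module k (V i)]
  act : ∀ {i j l : ℤ}, i + j = l → (𝒜 i →ₗ[k] V j →ₗ[k] V l)
  one_act : ∀ (j : ℤ) (x : V j), act (zero_add j) ⟨1, SetLike.one_mem_graded 𝒜⟩ x = x
  mul_act : ∀ {i i' j l m : ℤ} (h : i' + j = l) (h' : i + l = m) (h'' : i + i' + j = m)
    (a : 𝒜 i) (b : 𝒜 i') (x : V j),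
    act h'' ⟨a * b, SetLike.mul_mem_graded a.2 b.2⟩ x = act h' a (act h b x)

namespace Components

attribute [instance] addCommGroup module

variable (C : Components 𝒜)

/-- The bilinear action of `B` on `⨁ V j`. -/
def actHom : B →ₗ[k] Module.End k (⨁ j, C.V j) :=
  DirectSum.toModule k ℤ _ (fun i =>
    (DirectSum.toModule k ℤ (𝒜 i →ₗ[k] ⨁ j, C.V j) fun j =>
      ((C.act (i := i) (j := j) rfl).compr₂ (DirectSum.lof k ℤ C.V (i + j))).flip).flip) ∘ₗ
    (DirectSum.decomposeLinearEquiv 𝒜).toLinearMap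

lemma actHom_lof {i j l : ℤ} (h : i + j = l) (a : 𝒜 i) (x : C.V j) :
    C.actHom a (DirectSum.lof k ℤ C.V j x) = DirectSum.lof k ℤ C.V l (C.act h a x) := by
  subst h
  simp only [actHom, LinearMap.comp_apply, LinearEquiv.coe_coe,
    DirectSum.decomposeLinearEquiv_apply, DirectSum.decompose_coe]
  erw [DirectSum.toModule_lof k (M := fun i => ↥(𝒜 i)) i a]
  simp

lemma actHom_one : C.actHom 1 = 1 := by
  refine DirectSum.linearMap_ext k fun j => LinearMap.ext fun x => ?_
  exact (C.actHom_lof (zero_add j) ⟨1, SetLike.one_mem_graded 𝒜⟩ x).trans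
    (congrArg _ (C.one_act j x))

lemma actHom_mul (a b : B) : C.actHom (a * b) = C.actHom a * C.actHom b := by
  induction a using DirectSum.Decomposition.inductionOn 𝒜 with
  | zero => simp
  | add a a' ha ha' => simp only [add_mul, map_add, ha, ha']
  | homogeneous a =>
    induction b using DirectSum.Decomposition.inductionOn 𝒜 with
    | zero => simp
    | add b b' hb hb' => simp only [mul_add, map_add, hb, hb']
    | homogeneous b =>
      rename_i i i'
      refine DirectSum.linearMap_ext k fun j => LinearMap.ext fun x => ?_
      simp only [LinearMap.comp_apply, Module.End.mul_apply]
      rw [C.actHom_lof rfl b x, C.actHom_lof rfl a,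
        ← C.mul_act rfl rfl (add_assoc _ _ _) a b x]
      exact C.actHom_lof (add_assoc _ _ _) ⟨a * b, SetLike.mul_mem_graded a.2 b.2⟩ x

/-- The graded module `⨁ V j`. -/
def toGrMod : GrMod 𝒜 :=
  letI : Module B (⨁ j, C.V j) :=
    Module.compHom _ (AlgHom.ofLinearMap C.actHom C.actHom_one C.actHom_mul).toRingHom
  { carrier := ⨁ j, C.V j
    tower := ⟨fun c b x => LinearMap.congr_fun (C.actHom.map_smul c b) x⟩
    grading := fun j => LinearMap.range (DirectSum.lof k ℤ C.V j)
    isInternal := by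
      refine isInternal_of_proj _
        (fun j => DirectSum.lof k ℤ C.V j ∘ₗ DirectSum.component k ℤ C.V j) ?_ ?_ ?_
      · rintro j _ ⟨x, rfl⟩
        simp [DirectSum.component.lof_self]
      · rintro j l _ ⟨x, rfl⟩ h
        simp [DirectSum.component.of, h]
      · intro x
        induction x using DirectSum.induction_on with
        | zero => exact zero_mem _
        | of j x => exact Submodule.mem_iSup_of_mem j ⟨x, rfl⟩
        | add x y hx hy => exact add_mem hx hy
    smul_mem := by
      rintro i j b _ hb ⟨x, rfl⟩
      exact ⟨C.act rfl ⟨b, hb⟩ x, (C.actHom_lof rfl ⟨b, hb⟩ x).symm⟩ }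

/-- The inclusion of the component of degree `j`. -/
def inc (j : ℤ) : C.V j →ₗ[k] C.toGrMod := DirectSum.lof k ℤ C.V j

lemma smul_inc {i j l : ℤ} (h : i + j = l) (a : 𝒜 i) (x : C.V j) :
    (a : B) • C.inc j x = C.inc l (C.act h a x) :=
  C.actHom_lof h a x

lemma toGrMod_induction {p : C.toGrMod → Prop} (x : C.toGrMod)
    (h0 : p 0) (ha : ∀ x y, p x → p y → p (x + y)) (hh : ∀ n x, p (C.inc n x)) : p x :=
  DirectSum.induction_on (motive := p) x h0 hh ha

/-- The linear map out of `⨁ V j` given by linear maps on the components. -/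
def desc {W : Type u} [AddCommGroup W] [Module k W] (f : ∀ j, C.V j →ₗ[k] W) :
    C.toGrMod →ₗ[k] W :=
  DirectSum.toModule k ℤ W f

lemma desc_inc {W : Type u} [AddCommGroup W] [Module k W] (f : ∀ j, C.V j →ₗ[k] W)
    (j : ℤ) (x : C.V j) : C.desc f (C.inc j x) = f j x :=
  DirectSum.toModule_lof k j x

end Components

/-! #### Enough injectives -/

section Coinduced

variable (N : Type u) [AddCommGroup N] [Module B N] [Module k N] [IsScalarTower k B N]

variable (𝒜) in
/-- The components of the coinduced module: `N` in every degree. -/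
def coindComponents : Components 𝒜 where
  V _ := N
  act {i _ _} _ := (Algebra.lsmul k k N).toLinearMap ∘ₗ (𝒜 i).subtype
  one_act _ x := one_smul B x
  mul_act _ _ _ a b x := mul_smul (a : B) (b : B) x

variable (𝒜) in
/-- The graded module with component `N` in every degree (right adjoint to forgetting
the grading). -/
def coind : GrMod 𝒜 := (coindComponents 𝒜 N).toGrMod

/-- The inclusion of `N` as component of degree `j`. -/
def coindLof (j : ℤ) : N →ₗ[k] coind 𝒜 N := (coindComponents 𝒜 N).inc j

lemma smul_coindLof {i : ℤ} {b : B} (hb : b ∈ 𝒜 i) (j : ℤ) (x : N) :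
    b • coindLof (𝒜 := 𝒜) N j x = coindLof N (i + j) (b • x) :=
  (coindComponents 𝒜 N).smul_inc rfl ⟨b, hb⟩ x

lemma coind_induction {p : coind 𝒜 N → Prop} (x : coind 𝒜 N)
    (h0 : p 0) (ha : ∀ x y, p x → p y → p (x + y)) (hh : ∀ n x, p (coindLof N n x)) : p x :=
  (coindComponents 𝒜 N).toGrMod_induction x h0 ha hh

/-- The sum of the components. -/
def coindSumk : coind 𝒜 N →ₗ[k] N := (coindComponents 𝒜 N).desc fun _ => LinearMap.id

lemma coindSumk_lof (n : ℤ) (x : N) : coindSumk (𝒜 := 𝒜) N (coindLof N n x) = x :=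
  (coindComponents 𝒜 N).desc_inc (fun _ => LinearMap.id) n x

/-- The sum of the components, as a `B`-linear map. -/
def coindSum : coind 𝒜 N →ₗ[B] N where
  toFun := coindSumk N
  map_add' := map_add _
  map_smul' b x := by
    simp only [RingHom.id_apply]
    induction b using DirectSum.Decomposition.inductionOn 𝒜 with
    | zero => simp
    | add a a' ha ha' => simp only [add_smul, map_add, ha, ha']
    | homogeneous b =>
      induction x using coind_induction with
      | h0 => simp
      | ha x y hx hy => simp only [smul_add, map_add, hx, hy]
      | hh n x => rw [smul_coindLof N b.2, coindSumk_lof, coindSumk_lof]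

lemma coindSum_lof (n : ℤ) (x : N) : coindSum (𝒜 := 𝒜) N (coindLof N n x) = x :=
  coindSumk_lof N n x

variable {N} {M : GrMod 𝒜} (f : M →ₗ[B] N)

/-- The map to the coinduced module attached to an ungraded linear map. -/
def coindLiftk : M →ₗ[k] coind 𝒜 N :=
  letI := M.isInternal.chooseDecomposition
  DirectSum.toModule k ℤ (coind 𝒜 N)
    (fun n => coindLof N n ∘ₗ f.restrictScalars k ∘ₗ (M.grading n).subtype) ∘ₗ
    (DirectSum.decomposeLinearEquiv M.grading).toLinearMap

lemma coindLiftk_homog {n : ℤ} {x : M} (hx : x ∈ M.grading n) :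
    coindLiftk f x = coindLof N n (f x) := by
  let _ := M.isInternal.chooseDecomposition
  simp only [coindLiftk, LinearMap.comp_apply, LinearEquiv.coe_coe,
    DirectSum.decomposeLinearEquiv_apply, DirectSum.decompose_of_mem M.grading hx]
  erw [DirectSum.toModule_lof k (M := fun i => ↥(M.grading i)) n ⟨x, hx⟩]
  rfl

/-- The graded map to the coinduced module attached to an ungraded linear map. -/
def coindLift : M ⟶ coind 𝒜 N where
  lin :=
    { toFun := coindLiftk f
      map_add' := map_add _
      map_smul' := fun b x => by
        simp only [RingHom.id_apply]
        induction b using DirectSum.Decomposition.inductionOn 𝒜 with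
        | zero => simp
        | add a a' ha ha' => simp only [add_smul, map_add, ha, ha']
        | homogeneous b =>
          induction x using M.induction_homog with
          | h0 => simp
          | ha x y hx hy => simp only [smul_add, map_add, hx, hy]
          | hh n x hx =>
            rw [coindLiftk_homog f hx, coindLiftk_homog f (M.smul_mem b.2 hx),
              smul_coindLof N b.2, map_smul] }
  map_mem n x hx := ⟨f x, (coindLiftk_homog f hx).symm⟩

lemma coindLift_homog {n : ℤ} {x : M} (hx : x ∈ M.grading n) :
    (coindLift f).lin x = coindLof N n (f x) := coindLiftk_homog f hx

/-- The adjunction bijection. -/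
def coindEquiv : (M →ₗ[B] N) ≃ (M ⟶ coind 𝒜 N) where
  toFun f := coindLift f
  invFun g := coindSum N ∘ₗ g.lin
  left_inv f := by
    ext x
    induction x using M.induction_homog with
    | h0 => simp
    | ha x y hx hy => rw [map_add, map_add, hx, hy]
    | hh n x hx =>
      rw [LinearMap.comp_apply, coindLift_homog f hx, coindSum_lof]
  right_inv g := by
    refine hom_ext_homog fun n x hx => ?_
    rw [coindLift_homog _ hx, LinearMap.comp_apply]
    obtain ⟨y, hy⟩ := g.map_mem n x hx
    rw [← hy]
    exact congrArg _ (coindSum_lof N n y)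

end Coinduced

/-- Forgetting the grading has a right adjoint. -/
lemma exists_adj : ∃ R, Nonempty (forget 𝒜 ⊣ R) := by
  let k' (N : ModuleCat.{u} B) : Module k N := Module.compHom N (algebraMap k B)
  have tw (N : ModuleCat.{u} B) : IsScalarTower k B N :=
    ⟨fun c b x => by rw [Algebra.smul_def, mul_smul]; rfl⟩
  exact ⟨_, ⟨Adjunction.adjunctionOfEquivRight
    (fun (M : GrMod 𝒜) (N : ModuleCat.{u} B) =>
      (ModuleCat.homEquiv (M := (forget 𝒜).obj M) (N := N)).trans
        (coindEquiv (𝒜 := 𝒜) (M := M) (N := N)))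
    (fun M' M N f g => hom_ext_homog fun n x hx => by
      refine (coindLift_homog _ hx).trans ?_
      exact (coindLift_homog (N := N) g.hom (f.map_mem n x hx)).symm)⟩⟩

instance : (forget 𝒜).PreservesMonomorphisms where
  preserves f _ := (ModuleCat.mono_iff_injective _).2 (injective_of_mono f)

instance : (forget 𝒜).ReflectsMonomorphisms where
  reflects f h := mono_of_injective f ((ModuleCat.mono_iff_injective _).1 h)

instance : EnoughInjectives (GrMod 𝒜) :=
  let ⟨_, ⟨adj⟩⟩ := exists_adj (𝒜 := 𝒜)
  EnoughInjectives.of_adjunction adj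

end GradedRing
/-! #### Local cohomology -/

section LocalCohomology

variable [GradedAlgebra 𝒜]

/-- The torsion submodule `{x | B_{≥ n} x = 0 for some n ≥ 1}`. -/
def torsionSubmodule (M : GrMod 𝒜) : Submodule B M where
  carrier := {x | ∃ n : ℕ, 1 ≤ n ∧ ∀ i : ℤ, (n : ℤ) ≤ i → ∀ a ∈ 𝒜 i, a • x = 0}
  zero_mem' := ⟨1, le_rfl, fun _ _ _ _ => smul_zero _⟩
  add_mem' := by
    rintro x y ⟨n, hn, hx⟩ ⟨m, hm, hy⟩
    refine ⟨max n m, by omega, fun i hi a ha => ?_⟩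
    rw [smul_add, hx i (by omega) a ha, hy i (by omega) a ha, add_zero]
  smul_mem' := by
    rintro b x ⟨n, hn, hx⟩
    induction b using DirectSum.Decomposition.inductionOn 𝒜 with
    | zero => exact ⟨1, le_rfl, fun _ _ _ _ => by simp⟩
    | add b b' hb hb' =>
      obtain ⟨p, hp, hb⟩ := hb
      obtain ⟨q, hq, hb'⟩ := hb'
      refine ⟨max p q, by omega, fun i hi a ha => ?_⟩
      rw [add_smul, smul_add, hb i (by omega) a ha, hb' i (by omega) a ha, add_zero]
    | homogeneous b =>
      rename_i j
      refine ⟨n + j.natAbs, by omega, fun i hi a ha => ?_⟩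
      rw [← mul_smul]
      exact hx (i + j) (by omega) _ (SetLike.mul_mem_graded ha b.2)

lemma torsion_homog (M : GrMod 𝒜) (n : ℤ) (x : M) (hx : x ∈ M.torsionSubmodule) :
    M.comp n x ∈ M.torsionSubmodule := by
  obtain ⟨m, hm, hx⟩ := hx
  refine ⟨m, hm, fun i hi a ha => ?_⟩
  rw [← M.comp_smul ha, hx i hi a ha, map_zero]

variable (𝒜) in
/-- The torsion functor `Γ_𝔪` on graded left modules. -/
def torsion : GrMod 𝒜 ⥤ GrMod 𝒜 where
  obj M := M.sub M.torsionSubmodule M.torsion_homog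
  map {M N} f := codRestrict (M.subι _ M.torsion_homog ≫ f) _ N.torsion_homog (by
    rintro ⟨x, n, hn, hx⟩
    refine ⟨n, hn, fun i hi a ha => ?_⟩
    exact (map_smul f.lin a x).symm.trans ((congrArg f.lin (hx i hi a ha)).trans (map_zero _)))

instance : (torsion 𝒜).Additive where

instance : (torsion 𝒜).Linear k where

variable (𝒜) in
/-- The `i`-th local cohomology functor, the `i`-th right derived functor of `Γ_𝔪` on the category
of graded left modules. -/
def localCohomology (i : ℕ) : GrMod 𝒜 ⥤ GrMod 𝒜 := (torsion 𝒜).rightDerived i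

instance (i : ℕ) : (localCohomology 𝒜 i).Additive := by
  exact ⟨fun {_ _ f g} => rightDerived_map_add (torsion 𝒜) i f g⟩

instance (i : ℕ) : (localCohomology 𝒜 i).Linear k := by
  exact ⟨fun f c => rightDerived_map_smul (torsion 𝒜) i c f⟩

/-! #### The dual of the local cohomology bimodule -/

/-- The action of a morphism of graded modules on the components of degree `0`. -/
def degZeroMap {M N : GrMod 𝒜} (f : M ⟶ N) : M.grading 0 →ₗ[k] N.grading 0 :=
  (f.lin.restrictScalars k).restrict (f.map_mem 0)

/-- Right multiplication by an element `b` of degree `j`, as a morphism `B(n) ⟶ B(n + j)` of graded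
left modules. -/
def rightMul {n j m : ℤ} (h : n + j = m) (b : 𝒜 j) : (self 𝒜).shift n ⟶ (self 𝒜).shift m where
  lin := LinearMap.toSpanSingleton B B (b : B)
  map_mem i x hx := by
    have := SetLike.mul_mem_graded (A := 𝒜) hx b.2
    rw [show n + i + j = m + i by omega] at this
    exact this

lemma rightMul_apply {n j m : ℤ} (h : n + j = m) (b : 𝒜 j) (x : B) :
    (rightMul h b).lin x = (x * (b : B) : B) := rfl

variable (𝒜) in
/-- The component of degree `n` of the local cohomology `R^d Γ_𝔪(B)`, written as the degree `0`
component of `R^d Γ_𝔪(B(n))` (local cohomology commutes with degree shifts). -/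
abbrev localCohomologyComponent (d : ℕ) (n : ℤ) :
    Submodule k ((localCohomology 𝒜 d).obj ((self 𝒜).shift n)).carrier :=
  ((localCohomology 𝒜 d).obj ((self 𝒜).shift n)).grading 0

/-- The right action of `b ∈ B_j` on the local cohomology bimodule `R^d Γ_𝔪(B)`, from degree `n` to
degree `n + j`: it is induced by right multiplication on `B`. -/
def localCohomologyRightMul (d : ℕ) {n j m : ℤ} (h : n + j = m) (b : 𝒜 j) :
    localCohomologyComponent 𝒜 d n →ₗ[k] localCohomologyComponent 𝒜 d m :=
  degZeroMap ((localCohomology 𝒜 d).map (rightMul h b))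

lemma localCohomologyRightMul_add (d : ℕ) {n j m : ℤ} (h : n + j = m) (b b' : 𝒜 j) :
    localCohomologyRightMul d h (b + b') =
      localCohomologyRightMul d h b + localCohomologyRightMul d h b' := by
  have : rightMul h (b + b') = rightMul h b + rightMul h b' := by
    ext x
    exact mul_add (R := B) x (b : B) (b' : B)
  rw [localCohomologyRightMul, this, Functor.map_add]
  rfl

lemma localCohomologyRightMul_smul (d : ℕ) {n j m : ℤ} (h : n + j = m) (c : k) (b : 𝒜 j) :
    localCohomologyRightMul d h (c • b) = c • localCohomologyRightMul d h b := by
  have : rightMul h (c • b) = c • rightMul h b := by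
    ext x
    exact mul_smul_comm (β := B) c x (b : B)
  rw [localCohomologyRightMul, this, Functor.map_smul]
  rfl

variable (𝒜) in
/-- The components of the graded dual of the bimodule `R^d Γ_𝔪(B)`: in degree `m` it is the space
`Hom_k(R^d Γ_𝔪(B)_{-m}, k)`, and `b φ = (x ↦ φ (x b))`. -/
def omegaComponents (d : ℕ) : Components 𝒜 where
  V m := Module.Dual k (localCohomologyComponent 𝒜 d (-m))
  act {i j l} h :=
    { toFun := fun b => (localCohomologyRightMul d (by omega : -l + i = -j) b).dualMap
      map_add' := fun b b' => by
        rw [localCohomologyRightMul_add]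
        ext φ x
        simp
      map_smul' := fun c b => by
        rw [localCohomologyRightMul_smul]
        ext φ x
        simp }
  one_act j φ := by
    have : rightMul (by omega : -j + 0 = -j) ⟨1, SetLike.one_mem_graded 𝒜⟩ =
        𝟙 ((self 𝒜).shift (-j)) := by
      ext x
      exact mul_one (M := B) x
    ext x
    simp only [LinearMap.coe_mk, AddHom.coe_mk, LinearMap.dualMap_apply]
    rw [localCohomologyRightMul, this, CategoryTheory.Functor.map_id]
    rfl
  mul_act {i i' j l m} h h' h'' a b φ := by
    have : rightMul (by omega : -m + (i + i') = -j) ⟨(a : B) * (b : B), SetLike.mul_mem_graded a.2 b.2⟩ =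
        rightMul (by omega : -m + i = -l) a ≫ rightMul (by omega : -l + i' = -j) b := by
      ext x
      exact (mul_assoc (G := B) x (a : B) (b : B)).symm
    ext x
    simp only [LinearMap.coe_mk, AddHom.coe_mk, LinearMap.dualMap_apply]
    rw [localCohomologyRightMul, this, Functor.map_comp]
    rfl

variable (𝒜) in
/-- The graded left module `R^d Γ_𝔪(B)^*`, the graded dual of the graded bimodule `R^d Γ_𝔪(B)`. -/
def omega (d : ℕ) : GrMod 𝒜 := (omegaComponents 𝒜 d).toGrMod

end LocalCohomology

end GrMod

/-! #### Right modules -/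

section Opposite

variable (𝒜 : ℤ → Submodule k B)

/-- The grading of the opposite algebra; graded left modules over it are graded right
`B`-modules. -/
def opGrading (i : ℤ) : Submodule k Bᵐᵒᵖ :=
  (𝒜 i).map (MulOpposite.opLinearEquiv k : B ≃ₗ[k] Bᵐᵒᵖ).toLinearMap

lemma mem_opGrading {i : ℤ} {x : Bᵐᵒᵖ} : x ∈ opGrading 𝒜 i ↔ x.unop ∈ 𝒜 i := by
  constructor
  · rintro ⟨y, hy, rfl⟩
    exact hy
  · intro h
    exact ⟨x.unop, h, rfl⟩

variable [GradedAlgebra 𝒜]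

lemma opGrading_isInternal : DirectSum.IsInternal (opGrading 𝒜) := by
  let e : B ≃ₗ[k] Bᵐᵒᵖ := MulOpposite.opLinearEquiv k
  refine GrMod.isInternal_of_proj _
    (fun n => e.toLinearMap ∘ₗ (GrMod.self 𝒜).comp n ∘ₗ e.symm.toLinearMap) ?_ ?_ ?_
  · rintro n _ ⟨x, hx, rfl⟩
    exact congrArg e ((GrMod.self 𝒜).comp_same (x := x) hx)
  · rintro n m _ ⟨x, hx, rfl⟩ h
    exact congrArg e ((GrMod.self 𝒜).comp_ne (x := x) hx h)
  · intro x
    obtain ⟨s, hs⟩ := (GrMod.self 𝒜).exists_sum x.unop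
    refine GrMod.mem_iSup_of_comp _ s (fun n => e ((GrMod.self 𝒜).comp n x.unop))
      (fun n => ⟨_, (GrMod.self 𝒜).comp_mem n x.unop, rfl⟩) ?_
    exact (map_sum e _ s).symm.trans (congrArg e hs)

instance : GradedAlgebra (opGrading 𝒜) where
  one_mem := (mem_opGrading 𝒜).2 (SetLike.one_mem_graded 𝒜)
  mul_mem i j x y hx hy := by
    rw [mem_opGrading] at *
    rw [add_comm]
    exact SetLike.mul_mem_graded hy hx
  toDecomposition := (opGrading_isInternal 𝒜).chooseDecomposition

end Opposite

/-! #### Cohomological dimension, depth, Cohen-Macaulay modules -/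

section CohenMacaulay

variable (𝒜 : ℤ → Submodule k B)

/-- A commonly graded algebra is bounded below and locally finite. -/
def IsCommonlyGraded : Prop :=
  (∃ n : ℤ, ∀ i < n, 𝒜 i = ⊥) ∧ ∀ i, FiniteDimensional k (𝒜 i)

variable [GradedAlgebra 𝒜]

/-- The cohomological dimension of the graded algebra: the supremum of the `i` such that
`R^i Γ_𝔪(N) ≠ 0` for some graded left module `N`. -/
def cd : ℕ∞ :=
  ⨆ (i : ℕ) (_ : ∃ N : GrMod 𝒜, ¬ IsZero ((GrMod.localCohomology 𝒜 i).obj N)), (i : ℕ∞)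

variable {𝒜}

/-- The cohomological dimension of a graded module, `max {i | R^i Γ_𝔪(M) ≠ 0}`. -/
def moduleCd (M : GrMod 𝒜) : ℕ∞ :=
  ⨆ (i : ℕ) (_ : ¬ IsZero ((GrMod.localCohomology 𝒜 i).obj M)), (i : ℕ∞)

/-- The depth of a graded module, `min {i | R^i Γ_𝔪(M) ≠ 0}` (infinite if there is no such
`i`). -/
def depth (M : GrMod 𝒜) : ℕ∞ :=
  ⨅ (i : ℕ) (_ : ¬ IsZero ((GrMod.localCohomology 𝒜 i).obj M)), (i : ℕ∞)

/-- Cohen-Macaulay graded modules. The zero module is not Cohen-Macaulay. -/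
def IsCM (M : GrMod 𝒜) : Prop :=
  Module.Finite B M ∧ moduleCd M < ⊤ ∧ depth M = moduleCd M

/-- Maximal Cohen-Macaulay graded modules. -/
def IsMCM (M : GrMod 𝒜) : Prop :=
  cd 𝒜 < ⊤ ∧ IsCM M ∧ moduleCd M = cd 𝒜

variable (𝒜)

/-- The graded algebra is Cohen-Macaulay: it is maximal Cohen-Macaulay as a left and as a right
module over itself. -/
def IsCMAlgebra : Prop :=
  IsMCM (GrMod.self 𝒜) ∧ IsMCM (GrMod.self (opGrading 𝒜))

/-- Finite Cohen-Macaulay type: up to isomorphism and degree shift there are only finitely many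
indecomposable maximal Cohen-Macaulay graded left modules. -/
def IsFiniteCMType : Prop :=
  ∃ (n : ℕ) (F : Fin n → GrMod 𝒜), ∀ M : GrMod 𝒜, IsMCM M → Indecomposable M →
    ∃ (i : Fin n) (j : ℤ), Nonempty (M ≅ (F i).shift j)

end CohenMacaulay

/-! #### Global dimension and representation dimension -/

/-- The left global dimension of a ring: the supremum of the projective dimensions of its left
modules. -/
def leftGlobalDim (R : Type u) [Ring R] : WithBot ℕ∞ :=
  ⨆ M : ModuleCat.{u} R, projectiveDimension M

/-- The global dimension of a ring: the larger one of its left and right global dimensions (the two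
coincide for noetherian rings). -/
def globalDim (R : Type u) [Ring R] : WithBot ℕ∞ :=
  max (leftGlobalDim R) (leftGlobalDim Rᵐᵒᵖ)

/-- The representation dimension of a Cohen-Macaulay graded algebra `B` of depth `d`: the infimum of
the global dimensions of the rings `End_B(B ⊕ ω ⊕ M)`, where `ω = R^d Γ_𝔪(B)^*` and `M` runs over
the maximal Cohen-Macaulay graded left modules. -/
def repDim (𝒜 : ℤ → Submodule k B) [GradedAlgebra 𝒜] : WithBot ℕ∞ :=
  ⨅ (M : GrMod 𝒜) (_ : IsMCM M),
    globalDim (Module.End B (B × GrMod.omega 𝒜 (depth (GrMod.self 𝒜)).toNat × M))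

end GradedCM

end

noncomputable section

set_option linter.unusedSectionVars false

/-! ### Global dimension tested on finitely generated modules of one side. -/

namespace GradedCM

/-! ### Global dimension -/

section GlobalDimension

open Abelian

variable {R : Type u} [Ring R]

/-! Let `R` be the central graded subring over which `B` is finite, let `d = cd(B)`, and say that a
module has depth at least `e` if its local cohomology vanishes below degree `e`. Finite CM type
provides one MCM module `M` that contains `B` and, up to shift, every indecomposable MCM module as a
summand. Put `N = B ⊕ ω ⊕ M`. A finitely generated graded module of depth at least `d` is zero or
MCM (`isMCM_of_lc_isZero`), and it splits into indecomposables because its degree-zero endomorphisms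
form a finite-dimensional space. So it is a summand of a sum of shifts of `N`
(`isAdd_of_indecomposable`).

Auslander's argument then bounds projective dimensions over `End(N)`. The second syzygy of a
finitely generated graded right module can be taken to be `Hom(N, Y)`, where `Y` is the kernel of a
map between sums of shifts of `N`, hence of depth at least `min(2, d)`. Cover `Y` by a sum of shifts
of `N` in such a way that `Hom(N, -)` keeps the cover surjective. Each kernel gains one unit of
depth, and once the depth reaches `d` the module `Hom(N, -)` is projective. This gives the bound
`max 2 d` (`hom_hasProjectiveDimensionLT`, `hasProjectiveDimensionLT_of_finite`).

The argument needs `ω` to be finitely generated of depth at least `d`. Over `R`, `ω` is the graded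
dual of `H^d(B)` (`exists_omega_equiv`), and duals of local cohomology are finitely generated over
`R` (`isCofinite_lc`). A regular sequence of length `d` on the dual is built by induction
(`exists_isWeaklyRegular`): an element `y` regular on both `P` and the dual of its top local
cohomology makes `y` surjective on that cohomology. Hence the top degree drops by one for modules
killed by `y`, and the dual modulo `y` is the corresponding dual for `P/yP`. Prime avoidance
supplies `y`, since the dual has no socle in positive cohomological degree
(`LcVanishes.eq_zero_of_smul`).

Finally, the bound for finitely generated graded right modules is carried to all modules.
Filtrations with finitely generated associated graded module reach the ungraded finitely generated
ones (`hasProjectiveDimensionLT_of_graded`). Baer's criterion reaches all right modules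
(`leftGlobalDim_le_of_finite`), and `k`-duality turns the bound on injective dimensions of right
modules into one on projective dimensions of left modules (`globalDim_le_of_finite`). -/

lemma hasInjectiveDimensionLT_of_ext_quotient_ideal (n : ℕ) (Z : ModuleCat.{u} R)
    (h : ∀ (I : Ideal R) (i : ℕ), n + 1 ≤ i →
      Subsingleton (Ext.{u} (ModuleCat.of R (R ⧸ I)) Z i)) : HasInjectiveDimensionLT Z (n + 1) := by
  induction n generalizing Z with
  | zero =>
    rw [zero_add, ← injective_iff_hasInjectiveDimensionLT_one]
    -- Baer's criterion: a map from an ideal `I` to `Z` extends to the ring because its obstruction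
    -- lies in `Ext¹(R/I, Z) = 0`.
    refine (Module.injective_iff_injective_object R Z).1 (Module.Baer.injective fun I g => ?_)
    have hS : (I.mkQ.shortComplexKer).ShortExact :=
      LinearMap.shortExact_shortComplexKer I.mkQ_surjective
    have := h I 1 le_rfl
    let e : I.mkQ.ker ≃ₗ[R] I := LinearEquiv.ofEq _ _ I.ker_mkQ
    obtain ⟨x, hx⟩ := Ext.contravariant_sequence_exact₁ hS Z
      (Ext.mk₀ (ModuleCat.ofHom (g ∘ₗ e.toLinearMap))) (n₁ := 1) rfl (this.elim _ _)
    obtain ⟨φ, rfl⟩ := (Ext.mk₀_bijective _ _).2 x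
    rw [Ext.mk₀_comp_mk₀, (Ext.mk₀_bijective _ _).1.eq_iff] at hx
    refine ⟨φ.hom, fun x hx' => ?_⟩
    exact congrArg (fun t : ModuleCat.of R I.mkQ.ker ⟶ Z =>
      t.hom ⟨x, by rw [I.ker_mkQ]; exact hx'⟩) hx
  | succ n ih =>
    -- Dimension shifting: for positive `i`, `Extⁱ(R/I, -)` of the cosyzygy embeds in `Extⁱ⁺¹(R/I,
    -- Z)`.
    let ⟨p⟩ := EnoughInjectives.presentation Z
    have hS : (ShortComplex.mk _ _ (cokernel.condition p.f)).ShortExact :=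
      { exact := ShortComplex.exact_cokernel p.f }
    rw [← hS.hasInjectiveDimensionLT_X₃_iff n p.injective]
    refine ih _ fun I i hi => ⟨fun a b => ?_⟩
    suffices ∀ a : Ext.{u} (ModuleCat.of R (R ⧸ I)) (cokernel p.f) i, a = 0 by
      rw [this a, this b]
    intro a
    have := h I (i + 1) (by omega)
    obtain ⟨x, rfl⟩ := Ext.covariant_sequence_exact₃ _ hS a rfl (this.elim _ _)
    have hp := p.injective
    obtain ⟨i, rfl⟩ : ∃ j, i = j + 1 := ⟨i - 1, by omega⟩
    rw [Ext.eq_zero_of_injective x, Ext.zero_comp]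

lemma hasInjectiveDimensionLT_of_finite (n : ℕ)
    (h : ∀ X : ModuleCat.{u} R, Module.Finite R X → HasProjectiveDimensionLT X (n + 1))
    (Z : ModuleCat.{u} R) : HasInjectiveDimensionLT Z (n + 1) :=
  hasInjectiveDimensionLT_of_ext_quotient_ideal n Z fun I i hi =>
    have := h (ModuleCat.of R (R ⧸ I)) (inferInstanceAs (Module.Finite R (R ⧸ I)))
    HasProjectiveDimensionLT.subsingleton _ (n + 1) i hi Z

/-- The global dimension is bounded by the projective dimensions of the finitely generated
modules. -/
lemma leftGlobalDim_le_of_finite (n : ℕ)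
    (h : ∀ X : ModuleCat.{u} R, Module.Finite R X → HasProjectiveDimensionLT X (n + 1)) :
    leftGlobalDim R ≤ n := by
  refine iSup_le fun X => ?_
  rw [projectiveDimension_le_iff]
  refine HasProjectiveDimensionLT.mk.{u} fun i hi Y e => ?_
  -- `X` is arbitrary, so the bound is taken in the second variable of `Ext`, where it holds for
  -- every `Y`.
  have := hasInjectiveDimensionLT_of_finite n h Y
  exact Ext.eq_zero_of_hasInjectiveDimensionLT e (n + 1) hi

end GlobalDimension

/-! ### Left and right global dimension -/

section Dual

variable (k : Type u) {A : Type u} [Field k] [Ring A] [Algebra k A]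

/-- The `k`-linear dual of a left `A`-module, a right `A`-module. -/
def KDual (Y : Type u) [AddCommGroup Y] [Module k Y] : Type u := Y →ₗ[k] k

namespace KDual

variable {k}
variable {Y : Type u} [AddCommGroup Y] [Module A Y] [Module k Y] [IsScalarTower k A Y]
variable {Z : Type u} [AddCommGroup Z] [Module A Z] [Module k Z] [IsScalarTower k A Z]
variable {W : Type u} [AddCommGroup W] [Module A W] [Module k W] [IsScalarTower k A W]

instance : AddCommGroup (KDual k Y) := inferInstanceAs (AddCommGroup (Y →ₗ[k] k))
instance : FunLike (KDual k Y) Y k := inferInstanceAs (FunLike (Y →ₗ[k] k) Y k)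

@[ext] lemma ext {φ ψ : KDual k Y} (h : ∀ y, φ y = ψ y) : φ = ψ := LinearMap.ext h

@[simp] lemma add_apply (φ ψ : KDual k Y) (y : Y) : (φ + ψ) y = φ y + ψ y := rfl
lemma map_add (φ : KDual k Y) (x y : Y) : φ (x + y) = φ x + φ y := LinearMap.map_add φ x y
lemma map_zero (φ : KDual k Y) : φ 0 = 0 := LinearMap.map_zero φ
lemma map_sum (φ : KDual k Y) {ι : Type*} (s : Finset ι) (g : ι → Y) :
    φ (∑ i ∈ s, g i) = ∑ i ∈ s, φ (g i) :=
  let ψ : Y →ₗ[k] k := φ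
  _root_.map_sum ψ g s

instance : Module Aᵐᵒᵖ (KDual k Y) where
  smul a φ := LinearMap.comp (φ : Y →ₗ[k] k) (Algebra.lsmul k k Y a.unop)
  one_smul φ := by ext y; exact congrArg φ (one_smul A y)
  mul_smul a b φ := by ext y; exact congrArg φ (mul_smul b.unop a.unop y)
  smul_zero a := rfl
  smul_add a φ ψ := rfl
  add_smul a b φ := by
    ext y
    exact (congrArg φ (add_smul a.unop b.unop y)).trans (map_add φ _ _)
  zero_smul φ := by ext y; exact (congrArg φ (zero_smul A y)).trans (map_zero φ)

lemma smul_apply (a : Aᵐᵒᵖ) (φ : KDual k Y) (y : Y) : (a • φ) y = φ (a.unop • y) := rfl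

/-- The dual of an `A`-linear map. -/
def dmap (f : Y →ₗ[A] Z) : KDual k Z →ₗ[Aᵐᵒᵖ] KDual k Y where
  toFun φ := LinearMap.comp (φ : Z →ₗ[k] k) (f.restrictScalars k)
  map_add' _ _ := rfl
  map_smul' a φ := by ext y; exact congrArg φ (f.map_smul a.unop y).symm

lemma dmap_injective {f : Y →ₗ[A] Z} (hf : Function.Surjective f) :
    Function.Injective (dmap (k := k) f) := fun φ ψ h => by
  ext z
  obtain ⟨y, rfl⟩ := hf z
  exact congrArg (fun t : KDual k Y => t y) h

lemma dmap_surjective {f : Y →ₗ[A] Z} (hf : Function.Injective f) :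
    Function.Surjective (dmap (k := k) f) := fun φ => by
  obtain ⟨g, hg⟩ := LinearMap.exists_leftInverse_of_injective (f.restrictScalars k)
    (LinearMap.ker_eq_bot.2 hf)
  refine ⟨LinearMap.comp (φ : Y →ₗ[k] k) g, ?_⟩
  ext y
  exact congrArg φ (LinearMap.congr_fun hg y)

lemma dmap_exact {f : Y →ₗ[A] Z} {g : Z →ₗ[A] W} (h : Function.Exact f g) :
    Function.Exact (dmap (k := k) g) (dmap f) := by
  intro φ
  constructor
  · intro hφ
    have h1 : LinearMap.ker (g.restrictScalars k) ≤ LinearMap.ker (φ : Z →ₗ[k] k) := by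
      intro z hz
      obtain ⟨y, rfl⟩ := (h z).1 hz
      exact congrArg (fun t : KDual k Y => t y) hφ
    obtain ⟨ψ, hψ⟩ := LinearMap.exists_extend
      (((LinearMap.ker (g.restrictScalars k)).liftQ (φ : Z →ₗ[k] k) h1) ∘ₗ
        (g.restrictScalars k).quotKerEquivRange.symm.toLinearMap)
    refine ⟨ψ, ?_⟩
    ext z
    have := LinearMap.congr_fun hψ ⟨g z, z, rfl⟩
    refine this.trans ?_
    have h2 : (g.restrictScalars k).quotKerEquivRange.symm ⟨g z, z, rfl⟩ =
        Submodule.Quotient.mk z := by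
      rw [LinearEquiv.symm_apply_eq]
      rfl
    simp only [LinearMap.comp_apply, LinearEquiv.coe_coe]
    erw [h2]
    rfl
  · rintro ⟨ψ, rfl⟩
    ext y
    exact (congrArg ψ ((h (f y)).2 ⟨y, rfl⟩)).trans (map_zero ψ)

/-- Maps `W → D(Aⁿ)` are the same as `n`-tuples of `k`-linear functionals on `W`, and those always
extend. The extension of `f` is assembled from the functionals `g j`, read off at the basis vectors
after a `k`-linear retraction `r` of `i`. -/
instance injective_pi (n : ℕ) : Module.Injective Aᵐᵒᵖ (KDual k (Fin n → A)) where
  out U W _ _ _ _ i hi f := by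
    let _ : Module k U := Module.compHom U (algebraMap k Aᵐᵒᵖ)
    let _ : Module k W := Module.compHom W (algebraMap k Aᵐᵒᵖ)
    have tU : IsScalarTower k Aᵐᵒᵖ U :=
      ⟨fun c b x => by rw [Algebra.smul_def, mul_smul]; rfl⟩
    have tW : IsScalarTower k Aᵐᵒᵖ W :=
      ⟨fun c b x => by rw [Algebra.smul_def, mul_smul]; rfl⟩
    obtain ⟨r, hr⟩ := LinearMap.exists_leftInverse_of_injective (i.restrictScalars k)
      (LinearMap.ker_eq_bot.2 hi)
    have hf (c : k) (x : U) (y : Fin n → A) : f (c • x) y = c • f x y := by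
      have : f (c • x) = (algebraMap k Aᵐᵒᵖ c) • f x := f.map_smul (algebraMap k Aᵐᵒᵖ c) x
      rw [this, smul_apply]
      have h2 : (MulOpposite.unop (algebraMap k Aᵐᵒᵖ c)) • y = c • y := by
        ext j
        exact (Algebra.smul_def c (y j)).symm
      rw [h2]
      exact LinearMap.map_smul (f x) c y
    let g (j : Fin n) (w : W) : k := f (r w) (Pi.single j 1)
    have g_add (j : Fin n) (w w' : W) : g j (w + w') = g j w + g j w' := by
      simp only [g, LinearMap.map_add, add_apply]
    have g_smul (j : Fin n) (c : k) (w : W) : g j (c • w) = c • g j w := by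
      simp only [g, LinearMap.map_smul, hf]
    have tw (c : k) (a : A) (w : W) : MulOpposite.op (c • a) • w = c • MulOpposite.op a • w := by
      rw [MulOpposite.op_smul, smul_assoc]
    refine ⟨{ toFun := fun w =>
                { toFun := fun y => ∑ j, g j (MulOpposite.op (y j) • w)
                  map_add' := fun y y' => by
                    simp only [Pi.add_apply, MulOpposite.op_add, add_smul, g_add,
                      Finset.sum_add_distrib]
                  map_smul' := fun c y => by
                    simp only [Pi.smul_apply, tw, g_smul, Finset.smul_sum, RingHom.id_apply] }
              map_add' := fun w w' => by
                ext y
                change ∑ j, g j (MulOpposite.op (y j) • (w + w')) =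
                  ∑ j, g j (MulOpposite.op (y j) • w) + ∑ j, g j (MulOpposite.op (y j) • w')
                simp only [smul_add, g_add, Finset.sum_add_distrib]
              map_smul' := fun a w => by
                ext y
                change ∑ j, g j (MulOpposite.op (y j) • a • w) =
                  ∑ j, g j (MulOpposite.op (a.unop * y j) • w)
                simp only [← mul_smul, MulOpposite.op_mul, MulOpposite.op_unop] }, fun x => ?_⟩
    ext y
    have key (j : Fin n) : g j (MulOpposite.op (y j) • i x) = f x (Pi.single j (y j)) := by
      simp only [g]
      rw [← i.map_smul]
      have := LinearMap.congr_fun hr (MulOpposite.op (y j) • x)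
      simp only [LinearMap.comp_apply, LinearMap.coe_restrictScalars, LinearMap.id_apply] at this
      rw [this, f.map_smul, smul_apply, MulOpposite.unop_op, ← Pi.single_smul, smul_eq_mul, mul_one]
    change ∑ j, g j (MulOpposite.op (y j) • i x) = f x y
    rw [Finset.sum_congr rfl fun j _ => key j]
    have h1 : y = ∑ j, Pi.single j (y j) := (Finset.univ_sum_single y).symm
    conv_rhs => rw [h1]
    exact (map_sum (f x) _ _).symm

variable [IsNoetherianRing A]

/-- A finitely generated module over a noetherian algebra is projective if its dual is
injective. -/
lemma projective_of_injective [Module.Finite A Y] [Module.Injective Aᵐᵒᵖ (KDual k Y)] :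
    Module.Projective A Y := by
  obtain ⟨n, π, hπ⟩ := Module.Finite.exists_fin' A Y
  obtain ⟨m, r, hr⟩ := Module.Finite.exists_fin' A (LinearMap.ker π)
  let rel : Fin m → Fin n → A := fun i => (r (Pi.single i 1) : Fin n → A)
  let y : Fin n → Y := fun j => π (Pi.single j 1)
  have π_eq (z : Fin n → A) : π z = ∑ j, z j • y j := by
    conv_lhs => rw [← Finset.univ_sum_single z]
    rw [_root_.map_sum]
    refine Finset.sum_congr rfl fun j _ => ?_
    rw [← LinearMap.map_smul, ← Pi.single_smul, smul_eq_mul, mul_one]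
  have rel_eq (i : Fin m) : ∑ j, rel i j • y j = 0 := by
    rw [← π_eq]
    exact (r (Pi.single i 1)).2
  have ker_eq (z : Fin n → A) (hz : π z = 0) : ∃ c : Fin m → A, z = ∑ i, c i • rel i := by
    obtain ⟨c, hc⟩ := hr ⟨z, hz⟩
    refine ⟨c, ?_⟩
    have h1 : r c = ∑ i, c i • r (Pi.single i 1) := by
      conv_lhs => rw [← Finset.univ_sum_single c]
      rw [_root_.map_sum]
      refine Finset.sum_congr rfl fun j _ => ?_
      rw [← LinearMap.map_smul, ← Pi.single_smul, smul_eq_mul, mul_one]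
    have h2 := congrArg Subtype.val (hc.symm.trans h1)
    simpa [rel] using h2
  -- Injectivity of `D(Y)` yields a retraction `ρ` of `D(π)`. The rest of the proof turns it into a
  -- section of `π`, using only the finite presentation by `π` and `rel`.
  obtain ⟨ρ, hρ⟩ := Module.Injective.out (Q := KDual k Y) (dmap (k := k) π) (dmap_injective hπ)
    LinearMap.id
  have flin {M : Type u} [AddCommGroup M] [Module A M] [Module k M] [IsScalarTower k A M]
      (f : Y →ₗ[A] M) (c : k) (x : Y) : f (c • x) = c • f x := by
    rw [← algebraMap_smul A c, LinearMap.map_smul, algebraMap_smul]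
  -- the image of `Hom(Y, F)` in `Y ^ n`
  let Rm : (Fin n → (Fin n → A)) →ₗ[k] (Fin m → (Fin n → A)) :=
    LinearMap.pi fun i => ∑ j, (Algebra.lsmul k k (Fin n → A) (rel i j)) ∘ₗ LinearMap.proj j
  have Rm_eq (v : Fin n → (Fin n → A)) (i : Fin m) : Rm v i = ∑ j, rel i j • v j := by
    simp [Rm, LinearMap.pi_apply, LinearMap.sum_apply]
  -- A tuple killed by all relations is the tuple of values on the `y j` of a map out of `Y`, so
  -- `ker Rm` is `Hom(Y, Aⁿ)`.
  have lift_hom (v : Fin n → (Fin n → A)) (hv : Rm v = 0) :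
      ∃ g : Y →ₗ[A] (Fin n → A), ∀ j, g (y j) = v j := by
    let G : (Fin n → A) →ₗ[A] (Fin n → A) := ∑ j, (LinearMap.toSpanSingleton A _ (v j)) ∘ₗ
      LinearMap.proj j
    have G_eq (z : Fin n → A) : G z = ∑ j, z j • v j := by
      simp [G, LinearMap.sum_apply]
    have hG : LinearMap.ker π ≤ LinearMap.ker G := by
      intro z hz
      obtain ⟨c, rfl⟩ := ker_eq z hz
      rw [LinearMap.mem_ker, _root_.map_sum]
      refine Finset.sum_eq_zero fun i _ => ?_
      rw [LinearMap.map_smul, G_eq, ← Rm_eq, hv, Pi.zero_apply, smul_zero]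
    refine ⟨(LinearMap.ker π).liftQ G hG ∘ₗ (π.quotKerEquivOfSurjective hπ).symm.toLinearMap,
      fun j => ?_⟩
    have h2 : (π.quotKerEquivOfSurjective hπ).symm (y j) =
        Submodule.Quotient.mk (Pi.single j 1) := by
      rw [LinearEquiv.symm_apply_eq]
      rfl
    simp only [LinearMap.comp_apply, LinearEquiv.coe_coe]
    erw [h2]
    rw [Submodule.liftQ_apply, G_eq, Finset.sum_eq_single j]
    · simp
    · intro b _ hb
      simp [hb]
    · simp
  let Im : Submodule k (Fin n → Y) :=
    { carrier := {w | ∃ g : Y →ₗ[A] (Fin n → A), ∀ j, π (g (y j)) = w j}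
      add_mem' := by
        rintro w w' ⟨g, hg⟩ ⟨g', hg'⟩
        exact ⟨g + g', fun j => by simp [hg, hg']⟩
      zero_mem' := ⟨0, fun j => by simp⟩
      smul_mem' := by
        rintro c w ⟨g, hg⟩
        refine ⟨g ∘ₗ
          { toFun := fun x => c • x
            map_add' := fun _ _ => smul_add _ _ _
            map_smul' := fun a x => by
              rw [RingHom.id_apply, ← algebraMap_smul A c x, ← algebraMap_smul A c (a • x),
                ← mul_smul, ← mul_smul, Algebra.commutes] }, fun j => ?_⟩
        simp only [LinearMap.comp_apply, LinearMap.coe_mk, AddHom.coe_mk, Pi.smul_apply]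
        rw [flin g, ← hg j, ← algebraMap_smul A c, LinearMap.map_smul, algebraMap_smul] }
  -- Membership of `y` in `Im` says exactly that `π` has a section. Otherwise some functional `μ`
  -- vanishes on `Im` but not at `y`; since `μ ∘ π` kills `ker Rm`, it factors through `Rm` as `ν`.
  have hmem : y ∈ Im := by
    by_contra hy
    obtain ⟨μ, hμ, hμ'⟩ := Submodule.exists_le_ker_of_notMem hy
    -- `μ ∘ π` vanishes on the kernel of `Rm`
    let πn : (Fin n → (Fin n → A)) →ₗ[k] (Fin n → Y) :=
      LinearMap.pi fun j => (π.restrictScalars k) ∘ₗ LinearMap.proj j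
    have h1 : LinearMap.ker Rm ≤ LinearMap.ker (μ ∘ₗ πn) := by
      intro v hv
      obtain ⟨g, hg⟩ := lift_hom v hv
      exact hμ' ⟨g, fun j => by rw [hg]; rfl⟩
    obtain ⟨ν, hν⟩ : ∃ ν : (Fin m → (Fin n → A)) →ₗ[k] k, ν ∘ₗ Rm = μ ∘ₗ πn := by
      obtain ⟨ν, hν⟩ := LinearMap.exists_extend (((LinearMap.ker Rm).liftQ (μ ∘ₗ πn) h1) ∘ₗ
        Rm.quotKerEquivRange.symm.toLinearMap)
      refine ⟨ν, LinearMap.ext fun z => ?_⟩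
      have := LinearMap.congr_fun hν ⟨Rm z, z, rfl⟩
      refine this.trans ?_
      have h2 : Rm.quotKerEquivRange.symm ⟨Rm z, z, rfl⟩ = Submodule.Quotient.mk z := by
        rw [LinearEquiv.symm_apply_eq]
        rfl
      simp only [LinearMap.comp_apply, LinearEquiv.coe_coe]
      erw [h2]
      rfl
    let νi (i : Fin m) : KDual k (Fin n → A) := ν ∘ₗ LinearMap.single k (fun _ => Fin n → A) i
    let μj (j : Fin n) : KDual k Y := μ ∘ₗ LinearMap.single k (fun _ => Y) j
    have h3 (j : Fin n) : dmap (k := k) π (μj j) = ∑ i, MulOpposite.op (rel i j) • νi i := by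
      ext z
      have h4 := LinearMap.congr_fun hν (Pi.single j z)
      have h5 : πn (Pi.single j z) = Pi.single j (π z) := by
        ext l
        by_cases hl : l = j
        · subst hl; simp [πn]
        · simp [πn, hl]
      have h6 : Rm (Pi.single j z) = ∑ i, Pi.single i (rel i j • z) := by
        rw [Finset.univ_sum_single (fun i => rel i j • z)]
        ext1 i
        rw [Rm_eq, Finset.sum_eq_single j]
        · simp
        · intro b _ hb
          simp [hb]
        · simp
      simp only [LinearMap.comp_apply, h5, h6] at h4
      rw [_root_.map_sum] at h4
      refine h4.symm.trans ?_
      have : ∀ (s : Finset (Fin m)), (∑ i ∈ s, MulOpposite.op (rel i j) • νi i) z =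
          ∑ i ∈ s, (MulOpposite.op (rel i j) • νi i) z := by
        intro s
        exact LinearMap.sum_apply (M := Fin n → A) (M₂ := k) s
          (fun i => (MulOpposite.op (rel i j) • νi i : (Fin n → A) →ₗ[k] k)) z
      rw [this]
      rfl
    -- The identity `h3` lives in `D(Aⁿ)`; `ρ` carries it back to `D(Y)`. Evaluated at the `y j`,
    -- its right side becomes a sum of functionals at the relations `∑ j, rel i j • y j = 0`, which
    -- forces `μ y = 0`.
    have h4 (j : Fin n) : μj j = ∑ i, MulOpposite.op (rel i j) • ρ (νi i) := by
      have := hρ (μj j)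
      rw [h3, _root_.map_sum ρ, LinearMap.id_apply] at this
      rw [← this]
      exact Finset.sum_congr rfl fun i _ => LinearMap.map_smul _ _ _
    apply hμ
    have h5 : μ y = ∑ j, μj j (y j) := by
      conv_lhs => rw [← Finset.univ_sum_single y]
      exact _root_.map_sum μ _ _
    have h6 (j : Fin n) : μj j (y j) = ∑ i, ρ (νi i) (rel i j • y j) := by
      rw [h4]
      exact LinearMap.sum_apply (M := Y) (M₂ := k) Finset.univ
          (fun i => (MulOpposite.op (rel i j) • ρ (νi i) : Y →ₗ[k] k)) (y j)
    rw [h5, Finset.sum_congr rfl fun j _ => h6 j, Finset.sum_comm]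
    refine Finset.sum_eq_zero fun i _ => ?_
    have h7 := map_sum (ρ (νi i)) Finset.univ (fun j => rel i j • y j)
    rw [rel_eq] at h7
    exact h7.symm.trans (map_zero _)
  obtain ⟨g, hg⟩ := hmem
  refine Module.Projective.of_split g π (LinearMap.ext fun x => ?_)
  obtain ⟨z, rfl⟩ := hπ x
  rw [π_eq]
  simp [hg]

/-- The dual of a free cover of `Y` is a short exact sequence with injective middle term. So a
syzygy of `Y` corresponds to a cosyzygy of `D(Y)`, and induction reduces to the case where `D(Y)` is
injective. Noetherianity keeps the syzygies finitely generated. -/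
lemma hasProjectiveDimensionLT_of_dual (n : ℕ) (Y : Type u) [AddCommGroup Y] [Module A Y]
    [Module k Y] [IsScalarTower k A Y] [Module.Finite A Y]
    (h : HasInjectiveDimensionLT (ModuleCat.of Aᵐᵒᵖ (KDual k Y)) (n + 1)) :
    HasProjectiveDimensionLT (ModuleCat.of A Y) (n + 1) := by
  induction n generalizing Y with
  | zero =>
    rw [zero_add] at *
    rw [← injective_iff_hasInjectiveDimensionLT_one] at h
    rw [← projective_iff_hasProjectiveDimensionLT_one]
    have := (Module.injective_iff_injective_object Aᵐᵒᵖ (KDual k Y)).2 h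
    exact (IsProjective.iff_projective Y).1 (projective_of_injective (k := k))
  | succ n ih =>
    obtain ⟨m, π, hπ⟩ := Module.Finite.exists_fin' A Y
    have hS : (π.shortComplexKer).ShortExact := LinearMap.shortExact_shortComplexKer hπ
    have hF : Projective (ModuleCat.of A (Fin m → A)) :=
      (IsProjective.iff_projective (Fin m → A)).1 inferInstance
    refine (hS.hasProjectiveDimensionLT_X₃_iff n hF).2 ?_
    let S : ShortComplex (ModuleCat.{u} Aᵐᵒᵖ) := ShortComplex.mk
      (ModuleCat.ofHom (dmap (k := k) π)) (ModuleCat.ofHom (dmap (k := k) (LinearMap.ker π).subtype))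
      (by
        ext φ x
        exact (congrArg φ x.2).trans (map_zero φ))
    have hS' : S.ShortExact :=
      { exact := (ShortComplex.ShortExact.moduleCat_exact_iff_function_exact _).2
          (dmap_exact (LinearMap.exact_subtype_ker_map π))
        mono_f := (ModuleCat.mono_iff_injective _).2 (dmap_injective hπ)
        epi_g := (ModuleCat.epi_iff_surjective _).2
          (dmap_surjective (LinearMap.ker π).injective_subtype) }
    have hI : Injective (ModuleCat.of Aᵐᵒᵖ (KDual k (Fin m → A))) :=
      (Module.injective_iff_injective_object _ _).1 inferInstance
    exact ih (LinearMap.ker π) ((hS'.hasInjectiveDimensionLT_X₃_iff n hI).2 h)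

end KDual

/-- If the finitely generated right modules over a noetherian algebra have projective dimension at
most `n`, then the global dimension is at most `n`. -/
lemma globalDim_le_of_finite (k : Type u) {A : Type u} [Field k] [Ring A] [Algebra k A]
    [IsNoetherianRing A] (n : ℕ)
    (h : ∀ X : ModuleCat.{u} Aᵐᵒᵖ, Module.Finite Aᵐᵒᵖ X → HasProjectiveDimensionLT X (n + 1)) :
    globalDim A ≤ n := by
  refine max_le (leftGlobalDim_le_of_finite n fun Y hY => ?_) (leftGlobalDim_le_of_finite n h)
  let _ : Module k Y := Module.compHom Y (algebraMap k A)
  have : IsScalarTower k A Y := ⟨fun c b x => by rw [Algebra.smul_def, mul_smul]; rfl⟩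
  -- Every right module has injective dimension at most `n` by `h`; in particular the dual of the
  -- left module `Y` does.
  exact KDual.hasProjectiveDimensionLT_of_dual (k := k) n Y
    (hasInjectiveDimensionLT_of_finite n h _)

end Dual

end GradedCM

/-! ### Graded free modules and filtrations: from graded to ungraded projective dimension. -/

namespace GradedCM

variable {k B : Type u} [Field k] [Ring B] [Algebra k B] {𝒜 : ℤ → Submodule k B}

namespace GrMod

/-! ### Elementwise criteria in the category of graded modules -/

section Elements

variable {M N : GrMod 𝒜}

lemma epi_of_surjective (f : M ⟶ N) (h : Function.Surjective f.lin) : Epi f where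
  left_cancellation g₁ g₂ e := by
    ext y
    obtain ⟨x, rfl⟩ := h y
    exact congrArg (fun g : M ⟶ _ => g.lin x) e

lemma isZero_iff (M : GrMod 𝒜) : IsZero M ↔ ∀ x : M, x = 0 := by
  rw [IsZero.iff_id_eq_zero]
  constructor
  · intro h x
    exact congrArg (fun g : M ⟶ M => g.lin x) h
  · intro h
    ext x
    exact h x

lemma exact_iff (S : ShortComplex (GrMod 𝒜)) :
    S.Exact ↔ ∀ y, S.g.lin y = 0 → ∃ x, S.f.lin x = y := by
  rw [S.exact_iff_epi_kernel_lift]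
  constructor
  · intro h y hy
    let z := (kernel.lift S.g (S.X₂.subι _ (ker_homog S.g)) (subι_ker S.g)).lin ⟨y, hy⟩
    obtain ⟨x, hx⟩ := surjective_of_epi (kernel.lift S.g S.f S.zero) z
    refine ⟨x, ?_⟩
    have h1 := congrArg (fun t => (kernel.ι S.g).lin t) hx
    have h2 := congrArg (fun t : S.X₁ ⟶ S.X₂ => t.lin x) (kernel.lift_ι S.g S.f S.zero)
    have h3 := congrArg (fun t : S.X₂.sub _ (ker_homog S.g) ⟶ S.X₂ => t.lin ⟨y, hy⟩)
      (kernel.lift_ι S.g (S.X₂.subι _ (ker_homog S.g)) (subι_ker S.g))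
    exact h2.symm.trans (h1.trans h3)
  · intro h
    refine epi_of_surjective _ fun y => ?_
    obtain ⟨x, hx⟩ := h ((kernel.ι S.g).lin y)
      (congrArg (fun t : kernel S.g ⟶ _ => t.lin y) (kernel.condition S.g))
    refine ⟨x, injective_of_mono (kernel.ι S.g) ?_⟩
    exact (congrArg (fun t : S.X₁ ⟶ S.X₂ => t.lin x) (kernel.lift_ι S.g S.f S.zero)).trans hx

lemma shortExact_mk {L : GrMod 𝒜} (f : L ⟶ M) (g : M ⟶ N) (w : f ≫ g = 0)
    (hf : Function.Injective f.lin) (hg : Function.Surjective g.lin)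
    (h : ∀ y, g.lin y = 0 → ∃ x, f.lin x = y) : (ShortComplex.mk f g w).ShortExact :=
  { exact := (exact_iff _).2 h
    mono_f := mono_of_injective f hf
    epi_g := epi_of_surjective g hg }

/-- The elements all of whose components have degree at most `n`. -/
def le (M : GrMod 𝒜) (n : ℤ) : Submodule k M := ⨅ (m : ℤ) (_ : n < m), LinearMap.ker (M.comp m)

lemma mem_le {n : ℤ} {x : M} : x ∈ M.le n ↔ ∀ m, n < m → M.comp m x = 0 := by
  simp [le, Submodule.mem_iInf]

lemma comp_comp_ne (M : GrMod 𝒜) (x : M) {n m : ℤ} (h : n ≠ m) : M.comp m (M.comp n x) = 0 :=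
  M.comp_ne (M.comp_mem n x) h

lemma exists_support (M : GrMod 𝒜) (x : M) :
    ∃ s : Finset ℤ, ∑ n ∈ s, M.comp n x = x ∧ ∀ m ∉ s, M.comp m x = 0 := by
  obtain ⟨s, hs⟩ := M.exists_sum x
  refine ⟨s, hs, fun m hm => ?_⟩
  rw [← hs, map_sum]
  exact Finset.sum_eq_zero fun n hn => M.comp_comp_ne x (by rintro rfl; exact hm hn)

lemma exists_mem_le (M : GrMod 𝒜) (x : M) : ∃ n, x ∈ M.le n := by
  obtain ⟨s, -, hs⟩ := M.exists_support x
  obtain ⟨n, hn⟩ := s.exists_le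
  exact ⟨-n + 2 * n, mem_le.2 fun m hm => hs m fun h => by have := hn m h; omega⟩

lemma le_mono (M : GrMod 𝒜) : Monotone M.le := fun n m h x hx =>
  mem_le.2 fun l hl => mem_le.1 hx l (by omega)

lemma smul_mem_le {i j : ℤ} {b : B} {x : M} (hb : b ∈ 𝒜 i) (hx : x ∈ M.le j) :
    b • x ∈ M.le (i + j) := mem_le.2 fun m hm => by
  rw [show m = i + (m - i) by omega, M.comp_smul hb, mem_le.1 hx _ (by omega), smul_zero]

lemma mem_le_of_mem {n : ℤ} {x : M} (hx : x ∈ M.grading n) : x ∈ M.le n :=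
  mem_le.2 fun _ hm => M.comp_ne hx (by omega)

lemma sub_comp_mem_le {n : ℤ} {x : M} (hx : x ∈ M.le n) : x - M.comp n x ∈ M.le (n - 1) :=
  mem_le.2 fun m hm => by
    by_cases h : m = n
    · subst h
      rw [map_sub, M.comp_same (M.comp_mem _ _), sub_self]
    · rw [map_sub, mem_le.1 hx m (by omega), M.comp_comp_ne x (Ne.symm h), sub_zero]

lemma exists_top {x : M} (hx : x ≠ 0) : ∃ n, M.comp n x ≠ 0 ∧ x ∈ M.le n := by
  classical
  obtain ⟨s, hs, hs'⟩ := M.exists_support x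
  have hne : (s.filter fun n => M.comp n x ≠ 0).Nonempty := by
    by_contra h
    rw [Finset.not_nonempty_iff_eq_empty, Finset.filter_eq_empty_iff] at h
    apply hx
    rw [← hs]
    exact Finset.sum_eq_zero fun n hn => not_not.1 (h hn)
  obtain ⟨n, hn, hmax⟩ := (s.filter fun n => M.comp n x ≠ 0).exists_max_image id hne
  rw [Finset.mem_filter] at hn
  refine ⟨n, hn.2, mem_le.2 fun m hm => ?_⟩
  by_contra h
  have := hmax m (Finset.mem_filter.2 ⟨by by_contra h'; exact h (hs' m h'), h⟩)
  simp only [id_eq] at this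
  omega

/-- The components in small degrees vanish. -/
def IsBddBelow (M : GrMod 𝒜) : Prop := ∃ b : ℤ, ∀ i < b, M.grading i = ⊥

lemma le_eq_bot {b : ℤ} (hb : ∀ i < b, M.grading i = ⊥) {n : ℤ} (hn : n < b) : M.le n = ⊥ := by
  rw [eq_bot_iff]
  intro x hx
  refine M.ext_comp fun m => ?_
  rw [map_zero]
  by_cases h : n < m
  · exact mem_le.1 hx m h
  · have := M.comp_mem m x
    rw [hb m (by omega)] at this
    exact this

end Elements

variable [GradedAlgebra 𝒜]

namespace Components

variable (C : Components 𝒜)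

lemma inc_mem (n : ℤ) (x : C.V n) : C.inc n x ∈ C.toGrMod.grading n := ⟨x, rfl⟩

lemma exists_inc {n : ℤ} {x : C.toGrMod} (hx : x ∈ C.toGrMod.grading n) : ∃ y, C.inc n y = x := hx

lemma inc_injective (n : ℤ) : Function.Injective (C.inc n) :=
  DirectSum.of_injective (β := C.V) n

/-- The `B`-linear map out of `⨁ V j` given by compatible `k`-linear maps on the components. -/
def descLin {W : Type u} [AddCommGroup W] [Module B W] [Module k W] [IsScalarTower k B W]
    (f : ∀ j, C.V j →ₗ[k] W)
    (hf : ∀ (i j : ℤ) (b : 𝒜 i) (x : C.V j), f (i + j) (C.act rfl b x) = (b : B) • f j x) :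
    C.toGrMod →ₗ[B] W where
  toFun := C.desc f
  map_add' := map_add _
  map_smul' b x := by
    simp only [RingHom.id_apply]
    induction b using DirectSum.Decomposition.inductionOn 𝒜 with
    | zero => simp
    | add a a' ha ha' => simp only [add_smul, map_add, ha, ha']
    | homogeneous b =>
      induction x using C.toGrMod_induction with
      | h0 => simp
      | ha x y hx hy => simp only [smul_add, map_add, hx, hy]
      | hh n x => rw [C.smul_inc rfl, C.desc_inc, C.desc_inc, hf]

lemma descLin_inc {W : Type u} [AddCommGroup W] [Module B W] [Module k W] [IsScalarTower k B W]
    (f : ∀ j, C.V j →ₗ[k] W)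
    (hf : ∀ (i j : ℤ) (b : 𝒜 i) (x : C.V j), f (i + j) (C.act rfl b x) = (b : B) • f j x)
    (n : ℤ) (x : C.V n) : C.descLin f hf (C.inc n x) = f n x := C.desc_inc f n x

/-- The morphism of graded modules given by compatible `k`-linear maps on the components. -/
def descHom {M : GrMod 𝒜} (f : ∀ j, C.V j →ₗ[k] M)
    (hf : ∀ (i j : ℤ) (b : 𝒜 i) (x : C.V j), f (i + j) (C.act rfl b x) = (b : B) • f j x)
    (hf' : ∀ j x, f j x ∈ M.grading j) : C.toGrMod ⟶ M where
  lin := C.descLin f hf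
  map_mem := by
    rintro n _ ⟨x, rfl⟩
    exact (C.descLin_inc f hf n x).symm ▸ hf' n x

lemma descHom_inc {M : GrMod 𝒜} (f : ∀ j, C.V j →ₗ[k] M)
    (hf : ∀ (i j : ℤ) (b : 𝒜 i) (x : C.V j), f (i + j) (C.act rfl b x) = (b : B) • f j x)
    (hf' : ∀ j x, f j x ∈ M.grading j) (n : ℤ) (x : C.V n) :
    (C.descHom f hf hf').lin (C.inc n x) = f n x := C.desc_inc f n x

end Components

/-! ### Graded free modules -/

section Free

variable {ι : Type u} (deg : ι → ℤ)

variable (𝒜) in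
/-- The projection of `B` to its component of degree `n`. -/
def selfComp (n : ℤ) : B →ₗ[k] B := (self 𝒜).comp n

variable (𝒜) in
lemma exists_sum_selfComp (b : B) : ∃ s : Finset ℤ, ∑ n ∈ s, selfComp 𝒜 n b = b :=
  (self 𝒜).exists_sum b

/-- The components of an element of the free module. -/
def freeProj (n : ℤ) : (ι →₀ B) →ₗ[k] (ι →₀ B) :=
  Finsupp.lsum k fun i => Finsupp.lsingle (R := k) i ∘ₗ selfComp 𝒜 (n - deg i)

lemma freeProj_single (n : ℤ) (i : ι) (b : B) :
    freeProj (𝒜 := 𝒜) deg n (Finsupp.single i b) =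
      Finsupp.single i (selfComp 𝒜 (n - deg i) b) := by
  rw [freeProj, Finsupp.lsum_single]
  rfl

lemma freeProj_apply (n : ℤ) (i : ι) (f : ι →₀ B) :
    freeProj (𝒜 := 𝒜) deg n f i = selfComp 𝒜 (n - deg i) (f i) := by
  classical
  induction f using Finsupp.induction_linear with
  | zero => simp only [map_zero, Finsupp.coe_zero, Pi.zero_apply]
  | add f g hf hg =>
    rw [map_add, Finsupp.add_apply, Finsupp.add_apply, hf, hg]
    exact (map_add _ _ _).symm
  | single j b =>
    rw [freeProj_single, Finsupp.single_apply, Finsupp.single_apply]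
    split_ifs with h
    · rw [h]
    · exact (map_zero _).symm

variable (𝒜) in
/-- The graded free module with a generator of degree `deg i` for each `i`. -/
abbrev free : GrMod 𝒜 where
  carrier := ι →₀ B
  grading n := ⨅ i, (𝒜 (n - deg i)).comap (Finsupp.lapply i)
  isInternal := by
    classical
    refine isInternal_of_proj _ (freeProj (𝒜 := 𝒜) deg) ?_ ?_ ?_
    · intro n x hx
      ext i
      rw [freeProj_apply]
      exact (self 𝒜).comp_same (Submodule.mem_iInf _ |>.1 hx i)
    · intro n m x hx h
      ext i
      rw [freeProj_apply]
      exact (self 𝒜).comp_ne (Submodule.mem_iInf _ |>.1 hx i) (by omega)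
    · intro x
      induction x using Finsupp.induction_linear with
      | zero => exact zero_mem _
      | add f g hf hg => exact add_mem hf hg
      | single i b =>
        obtain ⟨s, hs⟩ := exists_sum_selfComp 𝒜 b
        rw [← hs, ← Finsupp.singleAddHom_apply, map_sum]
        refine Submodule.sum_mem _ fun n _ => Submodule.mem_iSup_of_mem (n + deg i) ?_
        refine (Submodule.mem_iInf _).2 fun j => ?_
        rw [Submodule.mem_comap, Finsupp.lapply_apply, Finsupp.singleAddHom_apply, Finsupp.single_apply]
        split_ifs with h
        · subst h
          rw [add_sub_cancel_right]
          exact (self 𝒜).comp_mem n b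
        · exact zero_mem _
  smul_mem {i j b x} hb hx := by
    refine (Submodule.mem_iInf _).2 fun l => ?_
    have := SetLike.mul_mem_graded (A := 𝒜) hb ((Submodule.mem_iInf _).1 hx l)
    rwa [show i + (j - deg l) = i + j - deg l by omega] at this

lemma mem_free_grading {n : ℤ} {x : free 𝒜 deg} :
    x ∈ (free 𝒜 deg).grading n ↔ ∀ i, (x : ι →₀ B) i ∈ 𝒜 (n - deg i) :=
  Submodule.mem_iInf _

/-- The generators of the graded free module. -/
def freeGen (i : ι) : free 𝒜 deg := (Finsupp.single i 1 : ι →₀ B)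

lemma freeGen_mem (i : ι) : freeGen deg i ∈ (free 𝒜 deg).grading (deg i) := by
  classical
  rw [mem_free_grading]
  intro j
  have : (freeGen (𝒜 := 𝒜) deg i : ι →₀ B) j = if i = j then 1 else 0 := Finsupp.single_apply
  rw [this]
  split_ifs with h
  · subst h
    rw [sub_self]
    exact SetLike.one_mem_graded 𝒜
  · exact zero_mem _

/-- The morphism out of a graded free module given by homogeneous elements. -/
def freeDesc {M : GrMod 𝒜} (p : ι → M) (hp : ∀ i, p i ∈ M.grading (deg i)) : free 𝒜 deg ⟶ M where
  lin := Finsupp.linearCombination B p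
  map_mem n x hx := by
    rw [mem_free_grading] at hx
    refine (congrArg (· ∈ M.grading n) (Finsupp.linearCombination_apply B (v := p) x)).mpr ?_
    refine Submodule.sum_mem _ fun i _ => ?_
    have := M.smul_mem (hx i) (hp i)
    rw [sub_add_cancel] at this
    exact this

lemma freeDesc_gen {M : GrMod 𝒜} (p : ι → M) (hp : ∀ i, p i ∈ M.grading (deg i)) (i : ι) :
    (freeDesc deg p hp).lin (freeGen deg i) = p i := by
  refine (Finsupp.linearCombination_single B (v := p) 1 i).trans (one_smul _ _)

lemma free_hom_ext {M : GrMod 𝒜} {f g : free 𝒜 deg ⟶ M}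
    (h : ∀ i, f.lin (freeGen deg i) = g.lin (freeGen deg i)) : f = g := by
  have : f.lin = g.lin := Finsupp.lhom_ext' fun i => LinearMap.ext_ring (h i)
  ext x
  rw [this]

omit [GradedAlgebra 𝒜] in
lemma exists_homog_preimage {M N : GrMod 𝒜} (f : M ⟶ N) (hf : Function.Surjective f.lin) {n : ℤ}
    {y : N} (hy : y ∈ N.grading n) : ∃ x ∈ M.grading n, f.lin x = y := by
  obtain ⟨x, rfl⟩ := hf y
  exact ⟨M.comp n x, M.comp_mem n x, by rw [hom_comp, N.comp_same hy]⟩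

instance : Projective (free 𝒜 deg) where
  factors {M N} f e _ := by
    choose p hp hp' using fun i => exists_homog_preimage e (surjective_of_epi e)
      (f.map_mem _ _ (freeGen_mem deg i))
    refine ⟨freeDesc deg p hp, free_hom_ext deg fun i => ?_⟩
    rw [comp_lin, LinearMap.comp_apply, freeDesc_gen, hp']

lemma free_isBddBelow (h : (self 𝒜).IsBddBelow) {b : ℤ} (hb : ∀ i, b ≤ deg i) :
    (free 𝒜 deg).IsBddBelow := by
  obtain ⟨a, ha⟩ := h
  refine ⟨a + b, fun n hn => ?_⟩
  rw [eq_bot_iff]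
  intro x hx
  rw [mem_free_grading] at hx
  refine Finsupp.ext (f := x) (g := 0) fun i => ?_
  have h1 := hx i
  have h2 : 𝒜 (n - deg i) = ⊥ := ha _ (by have := hb i; omega)
  rw [h2] at h1
  exact h1

/-- The generators are all nonzero homogeneous elements. Zero is excluded because it lies in every
degree and would destroy the lower bound on the degrees of the generators. -/
lemma exists_free_cover (h : (self 𝒜).IsBddBelow) (M : GrMod 𝒜) (hM : M.IsBddBelow) :
    ∃ (L : GrMod 𝒜) (π : L ⟶ M), Projective L ∧ Function.Surjective π.lin ∧ L.IsBddBelow := by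
  obtain ⟨b, hb⟩ := hM
  let ι := {p : ℤ × M // p.2 ∈ M.grading p.1 ∧ p.2 ≠ 0}
  let deg : ι → ℤ := fun i => i.1.1
  let p : ι → M := fun i => i.1.2
  refine ⟨free 𝒜 deg, freeDesc deg p fun i => i.2.1, inferInstance, ?_,
    free_isBddBelow deg h (b := b) fun i => ?_⟩
  · intro x
    induction x using M.induction_homog with
    | h0 => exact ⟨0, map_zero _⟩
    | ha x y hx hy =>
      obtain ⟨x', rfl⟩ := hx
      obtain ⟨y', rfl⟩ := hy
      exact ⟨x' + y', map_add _ _ _⟩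
    | hh n x hx =>
      by_cases h0 : x = 0
      · exact ⟨0, by rw [map_zero, h0]⟩
      · exact ⟨freeGen deg ⟨(n, x), hx, h0⟩, freeDesc_gen deg p (fun i => i.2.1) _⟩
  · by_contra hlt
    have h1 := i.2.1
    rw [hb _ (not_le.1 hlt)] at h1
    exact i.2.2 h1

/-- A graded projective module splits off a graded free one, and the splitting remains after the
grading is forgotten. -/
lemma projective_of_projective (M : GrMod 𝒜)
    [Projective M] : Module.Projective B M := by
  let deg : {p : ℤ × M // p.2 ∈ M.grading p.1} → ℤ := fun i => i.1.1
  let π : free 𝒜 deg ⟶ M := freeDesc deg (fun i => i.1.2) fun i => i.2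
  have hπ : Function.Surjective π.lin := by
    intro x
    induction x using M.induction_homog with
    | h0 => exact ⟨0, map_zero _⟩
    | ha x y hx hy =>
      obtain ⟨x', rfl⟩ := hx
      obtain ⟨y', rfl⟩ := hy
      exact ⟨x' + y', map_add _ _ _⟩
    | hh n x hx => exact ⟨freeGen deg ⟨(n, x), hx⟩, freeDesc_gen deg _ _ _⟩
  have : Epi π := epi_of_surjective π hπ
  have : Module.Projective B (free 𝒜 deg) := inferInstanceAs (Module.Projective B (_ →₀ B))
  refine Module.Projective.of_split (Projective.factorThru (𝟙 M) π).lin π.lin ?_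
  ext x
  exact congrArg (fun t : M ⟶ M => t.lin x) (Projective.factorThru_comp (𝟙 M) π)

end Free

/-! ### Filtered modules -/

section Filtered

variable (X : Type u) [AddCommGroup X] [Module B X] [Module k X] [IsScalarTower k B X]

variable (𝒜) in
/-- Exhaustive filtrations, bounded below, of a module over a graded algebra. -/
structure Filt where
  F : ℤ → Submodule k X
  mono : Monotone F
  smul_mem : ∀ {i j : ℤ} {b : B} {x : X}, b ∈ 𝒜 i → x ∈ F j → b • x ∈ F (i + j)
  exhaustive : ∀ x, ∃ n, x ∈ F n
  bdd : ∃ n, F n = ⊥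

namespace Filt

variable {X} (F : Filt 𝒜 X)

/-- The components of the Rees module. -/
def reesComponents : Components 𝒜 where
  V n := F.F n
  act {i j l} h := LinearMap.mk₂ k
    (fun b x => ⟨(b : B) • (x : X), h ▸ F.smul_mem b.2 x.2⟩)
    (fun b b' x => Subtype.ext (add_smul (b : B) (b' : B) (x : X)))
    (fun c b x => Subtype.ext (smul_assoc c (b : B) (x : X)))
    (fun b x x' => Subtype.ext (smul_add (b : B) (x : X) (x' : X)))
    (fun c b x => Subtype.ext (by
      change (b : B) • c • (x : X) = c • (b : B) • (x : X)
      rw [← algebraMap_smul B c (x : X), ← algebraMap_smul B c ((b : B) • (x : X)), ← mul_smul,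
        ← mul_smul, Algebra.commutes]))
  one_act _ x := Subtype.ext (one_smul B (x : X))
  mul_act _ _ _ a b x := Subtype.ext (mul_smul (a : B) (b : B) (x : X))

/-- The Rees module of a filtered module, as a graded module. -/
def rees : GrMod 𝒜 := F.reesComponents.toGrMod

/-- The components of the associated graded module. -/
def grComponents : Components 𝒜 where
  V n := F.F n ⧸ (F.F (n - 1)).submoduleOf (F.F n)
  act {i j l} h :=
    { toFun := fun b => Submodule.mapQ _ _ (F.reesComponents.act h b) (by
        intro x hx
        have := F.smul_mem b.2 (show (x : X) ∈ F.F (j - 1) from hx)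
        rw [show i + (j - 1) = l - 1 by omega] at this
        exact this)
      map_add' := fun b b' => by
        apply Submodule.linearMap_qext
        ext x
        simp only [LinearMap.comp_apply, LinearMap.add_apply, Submodule.mkQ_apply, map_add]
        rfl
      map_smul' := fun c b => by
        apply Submodule.linearMap_qext
        ext x
        simp only [LinearMap.comp_apply, LinearMap.smul_apply, Submodule.mkQ_apply, map_smul]
        rfl }
  one_act j x := by
    obtain ⟨x, rfl⟩ := Submodule.mkQ_surjective _ x
    exact congrArg (Submodule.mkQ _) (F.reesComponents.one_act j x)
  mul_act h h' h'' a b x := by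
    obtain ⟨x, rfl⟩ := Submodule.mkQ_surjective _ x
    exact congrArg (Submodule.mkQ _) (F.reesComponents.mul_act h h' h'' a b x)

/-- The associated graded module of a filtered module. -/
def gr : GrMod 𝒜 := F.grComponents.toGrMod

/-- The class of an element of `F n` in the associated graded module. -/
def cls (n : ℤ) : F.F n →ₗ[k] F.gr :=
  F.grComponents.inc n ∘ₗ ((F.F (n - 1)).submoduleOf (F.F n)).mkQ

lemma cls_eq_zero {n : ℤ} {x : F.F n} : F.cls n x = 0 ↔ (x : X) ∈ F.F (n - 1) := by
  have : F.cls n x = 0 ↔ ((F.F (n - 1)).submoduleOf (F.F n)).mkQ x = 0 :=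
    ⟨fun h => F.grComponents.inc_injective n (h.trans (map_zero _).symm),
      fun h => (congrArg (F.grComponents.inc n) h).trans (map_zero _)⟩
  exact this.trans (Submodule.Quotient.mk_eq_zero _)

lemma cls_add {n : ℤ} (x y : F.F n) : F.cls n (x + y) = F.cls n x + F.cls n y :=
  map_add _ _ _

lemma cls_sub {n : ℤ} (x y : F.F n) : F.cls n (x - y) = F.cls n x - F.cls n y :=
  map_sub _ _ _

lemma exists_cls {n : ℤ} {y : F.gr} (hy : y ∈ F.gr.grading n) : ∃ x, F.cls n x = y := by
  obtain ⟨x, rfl⟩ := F.grComponents.exists_inc hy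
  obtain ⟨x, rfl⟩ := Submodule.mkQ_surjective _ x
  exact ⟨x, rfl⟩

lemma cls_mem (n : ℤ) (x : F.F n) : F.cls n x ∈ F.gr.grading n := F.grComponents.inc_mem n _

lemma smul_cls {i j l : ℤ} (h : i + j = l) {b : B} (hb : b ∈ 𝒜 i) (x : F.F j) :
    b • F.cls j x = F.cls l ⟨b • (x : X), h ▸ F.smul_mem hb x.2⟩ :=
  F.grComponents.smul_inc h ⟨b, hb⟩ _

lemma gr_isBddBelow : F.gr.IsBddBelow := by
  obtain ⟨b, hb⟩ := F.bdd
  refine ⟨b, fun i hi => eq_bot_iff.2 fun y hy => ?_⟩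
  obtain ⟨x, rfl⟩ := F.exists_cls hy
  refine F.cls_eq_zero.2 ?_
  have : (x : X) ∈ F.F b := F.mono hi.le x.2
  rw [hb, Submodule.mem_bot] at this
  rw [this]
  exact zero_mem _

/-- The projection of the Rees module to the associated graded module. -/
def reesπ : F.rees ⟶ F.gr :=
  F.reesComponents.descHom (fun n => F.grComponents.inc n ∘ₗ Submodule.mkQ _)
    (fun _ _ b x => (F.grComponents.smul_inc rfl b (Submodule.mkQ _ x)).symm)
    (fun n _ => F.grComponents.inc_mem n _)

lemma reesπ_inc (n : ℤ) (x : F.F n) : F.reesπ.lin (F.reesComponents.inc n x) = F.cls n x :=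
  Components.descHom_inc ..

lemma reesπ_surjective : Function.Surjective F.reesπ.lin := by
  intro y
  induction y using F.gr.induction_homog with
  | h0 => exact ⟨0, map_zero _⟩
  | ha x y hx hy =>
    obtain ⟨x', rfl⟩ := hx
    obtain ⟨y', rfl⟩ := hy
    exact ⟨x' + y', map_add _ _ _⟩
  | hh n y hy =>
    obtain ⟨x, rfl⟩ := F.exists_cls hy
    exact ⟨_, F.reesπ_inc n x⟩

/-- The map from the Rees module to the filtered module. -/
def reesSum : F.rees →ₗ[B] X :=
  F.reesComponents.descLin (fun n => (F.F n).subtype) fun _ _ _ _ => rfl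

lemma reesSum_inc (n : ℤ) (x : F.F n) : F.reesSum (F.reesComponents.inc n x) = x :=
  Components.descLin_inc ..

/-- `g` is a filtered lift of the graded map `π`. -/
def IsLift {Q : GrMod 𝒜} (π : Q ⟶ F.gr) (g : Q →ₗ[B] X) : Prop :=
  ∀ n, ∀ x ∈ Q.grading n, ∃ h : g x ∈ F.F n, F.cls n ⟨g x, h⟩ = π.lin x

/-- The Rees module surjects onto the associated graded module, so a graded projective lifts to it.
Summing the components of the lift lands in `X`. -/
lemma exists_isLift {Q : GrMod 𝒜} [Projective Q] (π : Q ⟶ F.gr) : ∃ g, F.IsLift π g := by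
  have : Epi F.reesπ := epi_of_surjective _ F.reesπ_surjective
  let s : Q ⟶ F.rees := Projective.factorThru π F.reesπ
  refine ⟨F.reesSum ∘ₗ s.lin, fun n x hx => ?_⟩
  obtain ⟨(y : F.F n), hy⟩ := F.reesComponents.exists_inc (s.map_mem n x hx)
  have h1 : (F.reesSum ∘ₗ s.lin) x = (y : F.F n) :=
    (congrArg F.reesSum hy.symm).trans (F.reesSum_inc n y)
  have h2 : (F.reesSum ∘ₗ s.lin) x ∈ F.F n := h1 ▸ Subtype.property (p := (· ∈ F.F n)) y
  refine ⟨h2, ?_⟩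
  have h3 : (⟨_, h2⟩ : F.F n) = y := Subtype.ext h1
  rw [h3, ← reesπ_inc]
  refine (congrArg F.reesπ.lin hy).trans ?_
  exact congrArg (fun t : Q ⟶ F.gr => t.lin x) (Projective.factorThru_comp π F.reesπ)

section Lift

variable {F} {Q : GrMod 𝒜} {π : Q ⟶ F.gr} {g : Q →ₗ[B] X} (hg : F.IsLift π g)

include hg

lemma IsLift.map_le {n : ℤ} {x : Q} (hx : x ∈ Q.le n) : g x ∈ F.F n := by
  obtain ⟨s, hs, -⟩ := Q.exists_support x
  rw [← hs, map_sum]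
  refine Submodule.sum_mem _ fun m _ => ?_
  by_cases h : n < m
  · rw [mem_le.1 hx m h, map_zero]
    exact zero_mem _
  · exact F.mono (not_lt.1 h) (hg m _ (Q.comp_mem m x)).1

/-- Induction on the filtration degree from the place where the filtration vanishes: a homogeneous
preimage of the class of `x` corrects `x` modulo the previous step. Hence `g` is strict. -/
lemma IsLift.exists_le (hπ : Function.Surjective π.lin) (n : ℤ) {x : X} (hx : x ∈ F.F n) :
    ∃ y ∈ Q.le n, g y = x := by
  obtain ⟨b, hb⟩ := F.bdd
  by_cases hbn : b ≤ n
  · induction n, hbn using Int.leInduction generalizing x with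
    | base =>
      rw [hb] at hx
      exact ⟨0, zero_mem _, by rw [map_zero, hx]⟩
    | succ n hbn ih =>
      obtain ⟨y, hy, hy'⟩ := exists_homog_preimage π hπ (F.cls_mem (n + 1) ⟨x, hx⟩)
      obtain ⟨h1, h2⟩ := hg _ y hy
      rw [hy'] at h2
      have h3 : x - g y ∈ F.F n := by
        have := F.cls_eq_zero (n := n + 1) (x := ⟨x, hx⟩ - ⟨g y, h1⟩)
        rw [cls_sub, h2, sub_self, add_sub_cancel_right] at this
        exact this.1 rfl
      obtain ⟨z, hz, hz'⟩ := ih h3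
      refine ⟨z + y, add_mem (Q.le_mono (by omega) hz) (mem_le_of_mem hy), ?_⟩
      rw [map_add, hz', sub_add_cancel]
  · have : x ∈ F.F b := F.mono (by omega) hx
    rw [hb] at this
    exact ⟨0, zero_mem _, by rw [map_zero, this]⟩

lemma IsLift.surjective (hπ : Function.Surjective π.lin) : Function.Surjective g := fun x => by
  obtain ⟨n, hn⟩ := F.exhaustive x
  obtain ⟨y, -, hy⟩ := hg.exists_le hπ n hn
  exact ⟨y, hy⟩

/-- If `g` lowers the filtration degree of `x`, then the leading component of `x` is killed by `π`.
-/
lemma IsLift.comp_mem_ker {n : ℤ} {x : Q} (hx : x ∈ Q.le n) (hx' : g x ∈ F.F (n - 1)) :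
    π.lin (Q.comp n x) = 0 := by
  obtain ⟨h1, h2⟩ := hg n _ (Q.comp_mem n x)
  rw [← h2, cls_eq_zero]
  change g (Q.comp n x) ∈ F.F (n - 1)
  have h3 : g (Q.comp n x) = g x - g (x - Q.comp n x) := by rw [map_sub, sub_sub_cancel]
  rw [h3]
  exact sub_mem hx' (hg.map_le (sub_comp_mem_le hx))

lemma IsLift.injective (hπ : Function.Injective π.lin) : Function.Injective g := by
  rw [← LinearMap.ker_eq_bot, eq_bot_iff]
  intro x hx
  by_contra hne
  obtain ⟨n, hn, hn'⟩ := exists_top (M := Q) (x := x) hne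
  have h1 := hg.comp_mem_ker hn' (by rw [LinearMap.mem_ker.1 hx]; exact zero_mem _)
  exact hn (hπ (h1.trans (map_zero _).symm))

end Lift

/-- The filtration induced on the kernel of a map out of a graded module. -/
def kerFilt {Q : GrMod 𝒜} (hQ : Q.IsBddBelow) (g : Q →ₗ[B] X) : Filt 𝒜 (LinearMap.ker g) where
  F n := (Q.le n).comap ((LinearMap.ker g).subtype.restrictScalars k)
  mono _ _ h _ hx := Q.le_mono h hx
  smul_mem hb hx := smul_mem_le hb hx
  exhaustive x := Q.exists_mem_le x.1
  bdd := by
    obtain ⟨b, hb⟩ := hQ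
    refine ⟨b - 1, eq_bot_iff.2 fun x hx => ?_⟩
    have h1 : (x : Q) ∈ Q.le (b - 1) := hx
    rw [le_eq_bot hb (by omega)] at h1
    exact Subtype.ext h1

/-- The inclusion of the associated graded module of the kernel. -/
def kerGr {Q : GrMod 𝒜} (hQ : Q.IsBddBelow) (g : Q →ₗ[B] X) : (kerFilt hQ g).gr ⟶ Q :=
  (kerFilt hQ g).grComponents.descHom
    (fun n => Submodule.liftQ _
      (Q.comp n ∘ₗ (LinearMap.ker g).subtype.restrictScalars k ∘ₗ ((kerFilt hQ g).F n).subtype)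
      fun x hx => mem_le.1 (show (x : LinearMap.ker g).1 ∈ Q.le (n - 1) from hx) n (by omega))
    (fun i j b x => by
      obtain ⟨x, rfl⟩ := Submodule.mkQ_surjective _ x
      exact Q.comp_smul b.2 j _)
    (fun j x => by
      obtain ⟨x, rfl⟩ := Submodule.mkQ_surjective _ x
      exact Q.comp_mem j _)

lemma kerGr_cls {Q : GrMod 𝒜} (hQ : Q.IsBddBelow) (g : Q →ₗ[B] X) (n : ℤ)
    (x : (kerFilt hQ g).F n) :
    (kerGr hQ g).lin ((kerFilt hQ g).cls n x) = Q.comp n (x : LinearMap.ker g) :=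
  Components.descHom_inc ..

lemma kerGr_injective {Q : GrMod 𝒜} (hQ : Q.IsBddBelow) (g : Q →ₗ[B] X) :
    Function.Injective (kerGr hQ g).lin := by
  rw [← LinearMap.ker_eq_bot, eq_bot_iff]
  intro y hy
  refine (kerFilt hQ g).gr.ext_comp fun n => ?_
  rw [map_zero]
  obtain ⟨x, hx⟩ := (kerFilt hQ g).exists_cls ((kerFilt hQ g).gr.comp_mem n y)
  have h1 : (kerGr hQ g).lin ((kerFilt hQ g).gr.comp n y) = 0 := by
    rw [hom_comp, LinearMap.mem_ker.1 hy, map_zero]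
  rw [← hx, kerGr_cls] at h1
  rw [← hx, cls_eq_zero]
  have h2 := sub_comp_mem_le (M := Q) (n := n) (x := (x : LinearMap.ker g).1) x.2
  rw [h1, sub_zero] at h2
  exact h2

/-- Strictness of `g` says that taking associated graded modules commutes with its kernel. If `π`
kills a homogeneous `y` of degree `n`, then `g y` is also hit by some `z` of degree below `n`, and
`y - z` is an element of `ker g` with leading component `y`. -/
lemma kerGr_shortExact {Q : GrMod 𝒜} (hQ : Q.IsBddBelow) {π : Q ⟶ F.gr} {g : Q →ₗ[B] X}
    (hg : F.IsLift π g) (hπ : Function.Surjective π.lin) :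
    ∃ w, (ShortComplex.mk (kerGr hQ g) π w).ShortExact := by
  refine ⟨?_, shortExact_mk _ _ _ (kerGr_injective hQ g) hπ ?_⟩
  · refine hom_ext_homog fun n y hy => ?_
    obtain ⟨x, rfl⟩ := (kerFilt hQ g).exists_cls hy
    rw [comp_lin, LinearMap.comp_apply, kerGr_cls]
    exact hg.comp_mem_ker x.2 (by
      have : g (x : LinearMap.ker g) = 0 := (x : LinearMap.ker g).2
      rw [this]
      exact zero_mem _)
  · have key : ∀ n, ∀ y ∈ Q.grading n, π.lin y = 0 → ∃ x, (kerGr hQ g).lin x = y := by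
      intro n y hy h0
      obtain ⟨h1, h2⟩ := hg n y hy
      rw [h0, cls_eq_zero] at h2
      obtain ⟨z, hz, hz'⟩ := hg.exists_le hπ (n - 1) h2
      have h3 : y - z ∈ LinearMap.ker g := by
        rw [LinearMap.mem_ker, map_sub, hz']
        exact sub_self _
      have h4 : (⟨y - z, h3⟩ : LinearMap.ker g) ∈ (kerFilt hQ g).F n :=
        sub_mem (mem_le_of_mem hy) (Q.le_mono (by omega) hz)
      refine ⟨(kerFilt hQ g).cls n ⟨_, h4⟩, ?_⟩
      rw [kerGr_cls]
      change Q.comp n (y - z) = y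
      rw [map_sub, Q.comp_same hy, mem_le.1 hz n (by omega), sub_zero]
    intro y hy
    have h1 (n : ℤ) : ∃ x, (kerGr hQ g).lin x = Q.comp n y :=
      key n _ (Q.comp_mem n y) (by rw [hom_comp, hy, map_zero])
    choose x hx using h1
    obtain ⟨s, hs⟩ := Q.exists_sum y
    exact ⟨∑ n ∈ s, x n, by
      rw [map_sum]
      exact (Finset.sum_congr rfl fun n _ => hx n).trans hs⟩

/-- The projective dimension of a filtered module is at most that of its associated graded
module. -/
theorem hasProjectiveDimensionLT (h : (self 𝒜).IsBddBelow) (m : ℕ) {X : Type u} [AddCommGroup X]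
    [Module B X] [Module k X] [IsScalarTower k B X] (F : Filt 𝒜 X)
    (hF : HasProjectiveDimensionLT F.gr (m + 1)) :
    HasProjectiveDimensionLT (ModuleCat.of B X) (m + 1) := by
  induction m generalizing X with
  | zero =>
    rw [zero_add] at *
    have hP := projective_iff_hasProjectiveDimensionLT_one.2 hF
    obtain ⟨g, hg⟩ := F.exists_isLift (𝟙 F.gr)
    have e := LinearEquiv.ofBijective g ⟨hg.injective Function.injective_id,
      hg.surjective Function.surjective_id⟩
    have := projective_of_projective F.gr
    have := Module.Projective.of_equiv e
    rw [← projective_iff_hasProjectiveDimensionLT_one]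
    exact (IsProjective.iff_projective X).1 this
  | succ m ih =>
    obtain ⟨L, π, hL, hπ, hL'⟩ := exists_free_cover h F.gr F.gr_isBddBelow
    obtain ⟨g, hg⟩ := F.exists_isLift π
    obtain ⟨w, hS⟩ := F.kerGr_shortExact hL' hg hπ
    -- The syzygy of the filtered module has the syzygy of `F.gr` as its associated graded module,
    -- so the induction runs on both at once.
    have h1 := (hS.hasProjectiveDimensionLT_X₃_iff m hL).1 hF
    have h2 := ih (kerFilt hL' g) h1
    have hS' : (g.shortComplexKer).ShortExact :=
      LinearMap.shortExact_shortComplexKer (hg.surjective hπ)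
    have := projective_of_projective L
    have hL'' : Projective (ModuleCat.of B L) := (IsProjective.iff_projective L).1 this
    exact (hS'.hasProjectiveDimensionLT_X₃_iff m hL'').2 h2

/-- The filtration of a finitely generated module for which the given generators have
degree `0`. -/
def ofGenerators (h : (self 𝒜).IsBddBelow) {ι : Type u} (x : ι → X)
    (hx : Submodule.span B (Set.range x) = ⊤) : Filt 𝒜 X where
  F n := ((free 𝒜 fun _ : ι => 0).le n).map ((Finsupp.linearCombination B x).restrictScalars k)
  mono n m hnm := Submodule.map_mono (le_mono _ hnm)
  smul_mem := by
    rintro i j b _ hb ⟨y, hy, rfl⟩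
    exact ⟨b • y, smul_mem_le (M := free 𝒜 fun _ : ι => 0) hb hy,
      (Finsupp.linearCombination B x).map_smul b y⟩
  exhaustive y := by
    have : y ∈ Submodule.span B (Set.range x) := hx ▸ trivial
    obtain ⟨z, rfl⟩ := (Finsupp.mem_span_range_iff_exists_finsupp).1 this
    obtain ⟨n, hn⟩ := (free 𝒜 fun _ : ι => 0).exists_mem_le z
    exact ⟨n, z, hn, rfl⟩
  bdd := by
    obtain ⟨b, hb⟩ := free_isBddBelow (𝒜 := 𝒜) (fun _ : ι => 0) h (b := 0) fun _ => le_rfl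
    refine ⟨b - 1, eq_bot_iff.2 ?_⟩
    rintro _ ⟨y, hy, rfl⟩
    have hy' : y ∈ (free 𝒜 fun _ : ι => 0).le (b - 1) := hy
    rw [le_eq_bot hb (by omega)] at hy'
    exact (congrArg (Finsupp.linearCombination B x) hy').trans (map_zero _)

/-- The classes of the given generators in degree `0` generate. A class of degree `n` is represented
by an element of the free module, which may be replaced by its component of degree `n`; its
coefficients are then homogeneous of degree `n`. -/
lemma ofGenerators_finite (h : (self 𝒜).IsBddBelow) {ι : Type u} [Finite ι] (x : ι → X)
    (hx : Submodule.span B (Set.range x) = ⊤) : Module.Finite B (ofGenerators h x hx).gr := by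
  let F := ofGenerators h x hx
  let L := free 𝒜 fun _ : ι => 0
  have h0 (i : ι) : x i ∈ F.F 0 := by
    refine ⟨freeGen _ i, mem_le_of_mem (freeGen_mem _ i), ?_⟩
    refine (Finsupp.linearCombination_single B (v := x) 1 i).trans (one_smul _ _)
  refine ⟨(Submodule.fg_def).2 ⟨Set.range fun i => F.cls 0 ⟨x i, h0 i⟩, Set.finite_range _, ?_⟩⟩
  rw [eq_top_iff]
  rintro y -
  induction y using F.gr.induction_homog with
  | h0 => exact zero_mem _
  | ha x y hx hy => exact add_mem hx hy
  | hh n y hy =>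
    obtain ⟨⟨_, ⟨z, hz, rfl⟩⟩, rfl⟩ := F.exists_cls hy
    have h1 (w : L) (hw : w ∈ L.le n) : Finsupp.linearCombination B x w ∈ F.F n := ⟨w, hw, rfl⟩
    have h2 : F.cls n ⟨_, h1 z hz⟩ = F.cls n ⟨_, h1 _ (mem_le_of_mem (L.comp_mem n z))⟩ := by
      rw [← sub_eq_zero, ← cls_sub, cls_eq_zero]
      refine ⟨_, sub_comp_mem_le hz, ?_⟩
      exact map_sub (Finsupp.linearCombination B x) _ _
    have key (w : L) (hw : w ∈ L.grading n) (s : Finset ι) :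
        ∃ hm : ∑ i ∈ s, (w : ι →₀ B) i • x i ∈ F.F n, F.cls n ⟨_, hm⟩ ∈
          Submodule.span B (Set.range fun i => F.cls 0 ⟨x i, h0 i⟩) := by
      classical
      induction s using Finset.induction_on with
      | empty =>
        refine ⟨zero_mem _, ?_⟩
        have h3 : F.cls n ⟨∑ i ∈ ∅, (w : ι →₀ B) i • x i, zero_mem _⟩ = 0 :=
          F.cls_eq_zero.2 (zero_mem _)
        rw [h3]
        exact zero_mem _
      | insert i s hi ih =>
        obtain ⟨hm, hm'⟩ := ih
        have h3 : (w : ι →₀ B) i ∈ 𝒜 n := by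
          have := (mem_free_grading (fun _ : ι => 0)).1 hw i
          rwa [sub_zero] at this
        have h4 := F.smul_mem h3 (h0 i)
        rw [add_zero] at h4
        rw [Finset.sum_insert hi]
        refine ⟨add_mem h4 hm, ?_⟩
        have h5 : F.cls n ⟨_, add_mem h4 hm⟩ = F.cls n ⟨_, h4⟩ + F.cls n ⟨_, hm⟩ :=
          F.cls_add ⟨_, h4⟩ ⟨_, hm⟩
        rw [h5]
        refine add_mem ?_ hm'
        have h6 := F.smul_cls (add_zero n) h3 ⟨x i, h0 i⟩
        rw [← h6]
        exact Submodule.smul_mem _ _ (Submodule.subset_span ⟨i, rfl⟩)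
    obtain ⟨h3, h4⟩ := key _ (L.comp_mem n z) (L.comp n z : ι →₀ B).support
    refine (congrArg (· ∈ Submodule.span B (Set.range fun i => F.cls 0 ⟨x i, h0 i⟩)) h2).mpr ?_
    exact h4

end Filt

/-- The projective dimensions of the finitely generated modules over a graded algebra, bounded
below, are controlled by those of the finitely generated graded modules. -/
theorem hasProjectiveDimensionLT_of_graded (h : (self 𝒜).IsBddBelow) (m : ℕ)
    (hm : ∀ G : GrMod 𝒜, Module.Finite B G → HasProjectiveDimensionLT G (m + 1))
    (X : ModuleCat.{u} B) (hX : Module.Finite B X) : HasProjectiveDimensionLT X (m + 1) := by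
  let _ : Module k X := Module.compHom X (algebraMap k B)
  have : IsScalarTower k B X := ⟨fun c b x => by rw [Algebra.smul_def, mul_smul]; rfl⟩
  obtain ⟨n, x, hx⟩ := Module.Finite.exists_fin (R := B) (M := X)
  have hx' : Submodule.span B (Set.range fun i : ULift.{u} (Fin n) => x i.down) = ⊤ := by
    rw [← hx]
    congr 1
    ext y
    exact ⟨fun ⟨i, hi⟩ => ⟨i.down, hi⟩, fun ⟨i, hi⟩ => ⟨⟨i⟩, hi⟩⟩
  exact Filt.hasProjectiveDimensionLT h m (Filt.ofGenerators h _ hx')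
    (hm _ (Filt.ofGenerators_finite h _ hx'))

end Filtered

end GrMod

end GradedCM

/-! ### Homological algebra of right derived functors. -/

namespace GradedCM

/-! ### The long exact sequence of right derived functors -/

section Horseshoe

variable {C D : Type*} [Category* C] [Abelian C] [Category* D] [Abelian D]

/-- The injective resolution given by an exact sequence. -/
lemma exists_injectiveResolution_of_exact {Z : C} (K : CochainComplex C ℕ) (φ : Z ⟶ K.X 0) (w : φ ≫ K.d 0 1 = 0) (hm : Mono φ)
    (h0 : (ShortComplex.mk _ _ w).Exact) (h : ∀ n, K.ExactAt (n + 1)) :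
    ∃ ι : (CochainComplex.single₀ C).obj Z ⟶ K, QuasiIso ι ∧ ι.f 0 = φ := by
  refine ⟨(CochainComplex.fromSingle₀Equiv K Z).symm ⟨φ, w⟩, ?_,
    CochainComplex.fromSingle₀Equiv_symm_apply_f_zero φ w⟩
  refine ⟨fun n => ?_⟩
  cases n with
  | zero =>
    rw [CochainComplex.quasiIsoAt₀_iff, ShortComplex.quasiIso_iff_of_zeros]
    · have e := CochainComplex.fromSingle₀Equiv_symm_apply_f_zero φ w
      refine ⟨?_, ?_⟩
      · refine (ShortComplex.exact_iff_of_iso ?_).2 h0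
        refine ShortComplex.isoMk (Iso.refl _) (Iso.refl _) (Iso.refl _) ?_ ?_
        · refine (Category.id_comp _).trans (Eq.trans ?_ (Category.comp_id _).symm)
          exact e.symm
        · exact (Category.id_comp _).trans (Category.comp_id _).symm
      · exact (congrArg (fun t : Z ⟶ K.X 0 => Mono t) e).mpr hm
    · rfl
    · rfl
    · exact K.shape _ _ (by simp)
  | succ n =>
    rw [quasiIsoAt_iff_exactAt]
    · exact h n
    · exact CochainComplex.exactAt_succ_single_obj _ _

/-- A degreewise split extension of complexes. -/
structure SplitExtension (I J : CochainComplex C ℕ) where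
  K : CochainComplex C ℕ
  i : I ⟶ K
  p : K ⟶ J
  r (n : ℕ) : K.X n ⟶ I.X n
  s (n : ℕ) : J.X n ⟶ K.X n
  i_r (n : ℕ) : i.f n ≫ r n = 𝟙 _
  s_p (n : ℕ) : s n ≫ p.f n = 𝟙 _
  s_r (n : ℕ) : s n ≫ r n = 0
  i_p (n : ℕ) : i.f n ≫ p.f n = 0
  total (n : ℕ) : r n ≫ i.f n + p.f n ≫ s n = 𝟙 _

variable {I J : CochainComplex C ℕ}

/-- The differential on `I ⊞ J` is upper triangular with off-diagonal entry `θ`; the hypothesis on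
`θ` is the vanishing of the off-diagonal entry of its square. -/
lemma exists_splitExtension (θ : ∀ n, J.X n ⟶ I.X (n + 1))
    (hθ : ∀ n, θ n ≫ I.d (n + 1) (n + 2) + J.d n (n + 1) ≫ θ (n + 1) = 0) :
    ∃ E : SplitExtension I J, ∀ n, E.K.d n (n + 1) ≫ E.r (n + 1) =
      E.r n ≫ I.d n (n + 1) + E.p.f n ≫ θ n := by
  let d (n : ℕ) : I.X n ⊞ J.X n ⟶ I.X (n + 1) ⊞ J.X (n + 1) :=
    biprod.lift (biprod.desc (I.d n (n + 1)) (θ n)) (biprod.snd ≫ J.d n (n + 1))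
  have hd (n : ℕ) : d n ≫ d (n + 1) = 0 := by
    have h := hθ n
    apply biprod.hom_ext <;> apply biprod.hom_ext'
    · simp [d]
    · simpa [d] using h
    · simp [d]
    · simp [d]
  have e (n : ℕ) : (CochainComplex.of _ d hd).d n (n + 1) = d n :=
    CochainComplex.of_d (fun n => I.X n ⊞ J.X n) d n
  refine ⟨{
    K := CochainComplex.of _ d hd
    i := CochainComplex.ofHom (Y := CochainComplex.of _ d hd) (fun n => biprod.inl) fun n => by
      refine (congrArg (biprod.inl ≫ ·) (e n)).trans ?_
      apply biprod.hom_ext <;> simp [d]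
    p := CochainComplex.ofHom (X := CochainComplex.of _ d hd) (fun n => biprod.snd) fun n => by
      refine Eq.trans ?_ (congrArg (· ≫ biprod.snd) (e n)).symm
      simp [d]
    r := fun n => biprod.fst
    s := fun n => biprod.inr
    i_r := fun n => biprod.inl_fst
    s_p := fun n => biprod.inr_snd
    s_r := fun n => biprod.inr_fst
    i_p := fun n => biprod.inl_snd
    total := fun n => biprod.total }, fun n => ?_⟩
  refine (congrArg (· ≫ biprod.fst) (e n)).trans ?_
  change d n ≫ biprod.fst = biprod.fst ≫ I.d n (n + 1) + biprod.snd ≫ θ n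
  apply biprod.hom_ext' <;> simp [d]

namespace SplitExtension

variable (E : SplitExtension I J)

lemma w : E.i ≫ E.p = 0 := by
  ext n
  exact E.i_p n

/-- The short complex of a split extension. -/
abbrev sc : ShortComplex (CochainComplex C ℕ) := ShortComplex.mk E.i E.p E.w

/-- The splittings in each degree. -/
def splitting (n : ℕ) : (E.sc.map (HomologicalComplex.eval _ _ n)).Splitting where
  r := E.r n
  s := E.s n
  f_r := E.i_r n
  s_g := E.s_p n
  id := E.total n

lemma shortExact : E.sc.ShortExact :=
  HomologicalComplex.shortExact_of_degreewise_shortExact _ fun n => (E.splitting n).shortExact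

lemma map_shortExact (F : C ⥤ D) [F.Additive] :
    (E.sc.map (F.mapHomologicalComplex (ComplexShape.up ℕ))).ShortExact := by
  refine HomologicalComplex.shortExact_of_degreewise_shortExact _ fun n => ?_
  exact ((E.splitting n).map F).shortExact

lemma injective (n : ℕ) [Injective (I.X n)] [Injective (J.X n)] : Injective (E.K.X n) := by
  have h : E.K.X n ≅ I.X n ⊞ J.X n :=
    { hom := biprod.lift (E.r n) (E.p.f n)
      inv := biprod.desc (E.i.f n) (E.s n)
      hom_inv_id := by rw [biprod.lift_desc, E.total]
      inv_hom_id := by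
        apply biprod.hom_ext <;> apply biprod.hom_ext' <;> simp [E.i_r, E.s_p, E.s_r, E.i_p] }
  exact Injective.of_iso h.symm inferInstance

end SplitExtension

/-- Simultaneous injective resolutions of a short exact sequence. -/
theorem exists_horseshoe {S : ShortComplex C} (hS : S.ShortExact) (I : InjectiveResolution S.X₁)
    (J : InjectiveResolution S.X₃) :
    ∃ (E : SplitExtension I.cocomplex J.cocomplex)
      (ι : (CochainComplex.single₀ C).obj S.X₂ ⟶ E.K),
      QuasiIso ι ∧ I.ι.f 0 ≫ E.i.f 0 = S.f ≫ ι.f 0 ∧ ι.f 0 ≫ E.p.f 0 = S.g ≫ J.ι.f 0 := by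
  have := hS.mono_f
  have := hS.epi_g
  let ιI : S.X₁ ⟶ I.cocomplex.X 0 := I.ι.f 0
  let ιJ : S.X₃ ⟶ J.cocomplex.X 0 := J.ι.f 0
  have hI : ιI ≫ I.cocomplex.d 0 1 = 0 := I.ι_f_zero_comp_complex_d
  have hJ : ιJ ≫ J.cocomplex.d 0 1 = 0 := J.ι_f_zero_comp_complex_d
  have exI : (ShortComplex.mk _ _ hI).Exact := I.exact₀
  have exJ : (ShortComplex.mk _ _ hJ).Exact := J.exact₀
  have mI : Mono ιI := inferInstanceAs (Mono (I.ι.f 0))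
  have mJ : Mono ιJ := inferInstanceAs (Mono (J.ι.f 0))
  let α : S.X₂ ⟶ I.cocomplex.X 0 := Injective.factorThru ιI S.f
  have hα : S.f ≫ α = ιI := Injective.comp_factorThru _ _
  -- `α` extends the augmentation of `S.X₁` to `S.X₂`. It need not be a cocycle, but `α ≫ d`
  -- vanishes on `S.X₁`, so it descends to `β` on `S.X₃`.
  obtain ⟨β, hβ⟩ : ∃ β : S.X₃ ⟶ I.cocomplex.X 1, S.g ≫ β = α ≫ I.cocomplex.d 0 1 :=
    ⟨hS.exact.descToInjective (α ≫ I.cocomplex.d 0 1) (by rw [← Category.assoc, hα, hI]),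
      hS.exact.comp_descToInjective _ _⟩
  have hβ' : β ≫ I.cocomplex.d 1 2 = 0 := by
    rw [← cancel_epi S.g, ← Category.assoc, hβ, Category.assoc, I.cocomplex.d_comp_d, comp_zero,
      comp_zero]
  -- The sign makes `θ₀` cancel `β` in the computation that `φ ≫ d = 0`.
  let θ₀ : J.cocomplex.X 0 ⟶ I.cocomplex.X 1 := Injective.factorThru (-β) ιJ
  have hθ₀ : ιJ ≫ θ₀ = -β := Injective.comp_factorThru _ _
  have step1 : ∃ θ₁ : J.cocomplex.X 1 ⟶ I.cocomplex.X 2,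
      J.cocomplex.d 0 1 ≫ θ₁ = -(θ₀ ≫ I.cocomplex.d 1 2) :=
    ⟨exJ.descToInjective (-(θ₀ ≫ I.cocomplex.d 1 2)) (by
      change ιJ ≫ (-(θ₀ ≫ I.cocomplex.d 1 2)) = 0
      rw [Preadditive.comp_neg, ← Category.assoc, hθ₀, Preadditive.neg_comp, hβ', neg_zero,
        neg_zero]), exJ.comp_descToInjective _ _⟩
  -- The shift of `I` with negated differential: chain maps from `J` to `I'` are exactly the
  -- admissible twists `θ`.
  let I' : CochainComplex C ℕ :=
    { X := fun n => I.cocomplex.X (n + 1)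
      d := fun i j => -I.cocomplex.d (i + 1) (j + 1)
      shape := fun i j h => by
        rw [I.cocomplex.shape _ _ (by simp only [ComplexShape.up_Rel] at h ⊢; omega), neg_zero]
      d_comp_d' := fun i j l _ _ => by simp }
  obtain ⟨θ₁, hθ₁⟩ := step1
  have stepn (n : ℕ) (a : J.cocomplex.X n ⟶ I.cocomplex.X (n + 1))
      (b : J.cocomplex.X (n + 1) ⟶ I.cocomplex.X (n + 2))
      (h : J.cocomplex.d n (n + 1) ≫ b = -(a ≫ I.cocomplex.d (n + 1) (n + 2))) :
      ∃ c : J.cocomplex.X (n + 2) ⟶ I.cocomplex.X (n + 3),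
        J.cocomplex.d (n + 1) (n + 2) ≫ c = -(b ≫ I.cocomplex.d (n + 2) (n + 3)) :=
    ⟨(J.exact_succ n).descToInjective (-(b ≫ I.cocomplex.d (n + 2) (n + 3))) (by
      change J.cocomplex.d n (n + 1) ≫ (-(b ≫ I.cocomplex.d (n + 2) (n + 3))) = 0
      rw [Preadditive.comp_neg, ← Category.assoc, h, Preadditive.neg_comp, Category.assoc,
        I.cocomplex.d_comp_d, comp_zero, neg_zero, neg_zero]),
      (J.exact_succ n).comp_descToInjective _ _⟩
  have conv {n : ℕ} {a : J.cocomplex.X n ⟶ I.cocomplex.X (n + 1)}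
      {b : J.cocomplex.X (n + 1) ⟶ I.cocomplex.X (n + 2)}
      (h : J.cocomplex.d n (n + 1) ≫ b = -(a ≫ I.cocomplex.d (n + 1) (n + 2))) :
      a ≫ I'.d n (n + 1) = J.cocomplex.d n (n + 1) ≫ b := by
    rw [h]
    exact Preadditive.comp_neg _ _
  have conv' {n : ℕ} {a : J.cocomplex.X n ⟶ I.cocomplex.X (n + 1)}
      {b : J.cocomplex.X (n + 1) ⟶ I.cocomplex.X (n + 2)}
      (h : a ≫ I'.d n (n + 1) = J.cocomplex.d n (n + 1) ≫ b) :
      J.cocomplex.d n (n + 1) ≫ b = -(a ≫ I.cocomplex.d (n + 1) (n + 2)) := by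
    rw [← h]
    exact Preadditive.comp_neg _ _
  let Θ : J.cocomplex ⟶ I' := CochainComplex.mkHom _ _ θ₀ θ₁ (conv hθ₁) fun n q =>
    ⟨(stepn n q.1 q.2.1 (conv' q.2.2)).choose, conv (stepn n q.1 q.2.1 (conv' q.2.2)).choose_spec⟩
  let θ (n : ℕ) : J.cocomplex.X n ⟶ I.cocomplex.X (n + 1) := Θ.f n
  have hθ (n : ℕ) : θ n ≫ I.cocomplex.d (n + 1) (n + 2) +
      J.cocomplex.d n (n + 1) ≫ θ (n + 1) = 0 := by
    rw [conv' (a := θ n) (b := θ (n + 1)) (Θ.comm n (n + 1)), add_neg_cancel]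
  obtain ⟨E, hE⟩ := exists_splitExtension θ hθ
  let φ : S.X₂ ⟶ E.K.X 0 := α ≫ E.i.f 0 + S.g ≫ ιJ ≫ E.s 0
  have φr : φ ≫ E.r 0 = α := by
    simp only [φ, Preadditive.add_comp, Category.assoc, E.i_r, E.s_r, comp_zero, add_zero,
      Category.comp_id]
  have φp : φ ≫ E.p.f 0 = S.g ≫ ιJ := by
    simp only [φ, Preadditive.add_comp, Category.assoc, E.i_p, E.s_p, comp_zero, zero_add,
      Category.comp_id]
  have ext' {X : C} {n : ℕ} {a b : X ⟶ E.K.X n} (h1 : a ≫ E.r n = b ≫ E.r n)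
      (h2 : a ≫ E.p.f n = b ≫ E.p.f n) : a = b := by
    rw [← Category.comp_id a, ← Category.comp_id b, ← E.total, Preadditive.comp_add,
      Preadditive.comp_add, ← Category.assoc, ← Category.assoc, ← Category.assoc,
      ← Category.assoc, h1, h2]
  have dφ : φ ≫ E.K.d 0 1 = 0 := by
    apply ext'
    · rw [Category.assoc, hE, Preadditive.comp_add, ← Category.assoc, φr, ← Category.assoc, φp,
        zero_comp, Category.assoc]
      change _ + S.g ≫ ιJ ≫ θ₀ = 0
      rw [hθ₀, Preadditive.comp_neg, hβ, add_neg_cancel]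
    · rw [Category.assoc, ← E.p.comm, ← Category.assoc, φp, Category.assoc, hJ, comp_zero,
        zero_comp]
  have mφ : Mono φ := by
    refine Preadditive.mono_of_cancel_zero _ fun {X} a ha => ?_
    have h1 : a ≫ S.g = 0 := by
      rw [← cancel_mono ιJ, Category.assoc, ← φp, ← Category.assoc, ha, zero_comp, zero_comp]
    have h2 : hS.exact.lift a h1 ≫ S.f = a := hS.exact.lift_f _ _
    rw [← h2] at ha ⊢
    have h3 : hS.exact.lift a h1 ≫ ιI = 0 := by
      rw [← hα, ← φr, ← Category.assoc, ← Category.assoc, ha, zero_comp]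
    rw [zero_of_comp_mono ιI h3, zero_comp]
  have hexact : (ShortComplex.mk _ _ dφ).Exact := by
    rw [ShortComplex.exact_iff_exact_up_to_refinements]
    intro A x hx
    change x ≫ E.K.d 0 1 = 0 at hx
    have h1 : (x ≫ E.p.f 0) ≫ J.cocomplex.d 0 1 = 0 := by
      rw [Category.assoc, E.p.comm, ← Category.assoc, hx, zero_comp]
    have h2 : exJ.lift (x ≫ E.p.f 0) h1 ≫ ιJ = x ≫ E.p.f 0 := exJ.lift_f _ _
    obtain ⟨A', π, hπ, b, hb⟩ := surjective_up_to_refinements_of_epi S.g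
      (exJ.lift (x ≫ E.p.f 0) h1)
    -- After refinement, the `J`-part of the cocycle `x` comes from `S.X₂` through `b`. The
    -- difference `z` is a cocycle in `I`, hence comes from `S.X₁`.
    let z := π ≫ x - b ≫ φ
    have z1 : z ≫ E.p.f 0 = 0 := by
      simp only [z, Preadditive.sub_comp, Category.assoc, φp]
      rw [← h2, ← Category.assoc, hb, Category.assoc, sub_self]
    have z2 : (z ≫ E.r 0) ≫ I.cocomplex.d 0 1 = 0 := by
      have h3 : z ≫ E.K.d 0 1 = 0 := by
        simp only [z, Preadditive.sub_comp, Category.assoc, hx, dφ, comp_zero, sub_self]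
      have h4 := congrArg (z ≫ ·) (hE 0)
      simp only at h4
      rw [← Category.assoc, h3, zero_comp, Preadditive.comp_add, ← Category.assoc,
        ← Category.assoc, z1, zero_comp, add_zero] at h4
      exact h4.symm
    have z3 : exI.lift (z ≫ E.r 0) z2 ≫ ιI = z ≫ E.r 0 := exI.lift_f _ _
    refine ⟨A', π, hπ, b + exI.lift (z ≫ E.r 0) z2 ≫ S.f, ?_⟩
    change π ≫ x = (b + exI.lift (z ≫ E.r 0) z2 ≫ S.f) ≫ φ
    have z4 : (exI.lift (z ≫ E.r 0) z2 ≫ S.f) ≫ φ = z := by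
      apply ext'
      · rw [Category.assoc, Category.assoc, φr, hα, z3]
      · rw [Category.assoc, Category.assoc, φp, ← Category.assoc S.f, S.zero, zero_comp,
          comp_zero, z1]
    rw [Preadditive.add_comp, z4]
    simp [z]
  obtain ⟨ι, hι, hι0⟩ := exists_injectiveResolution_of_exact E.K φ dφ mφ
    hexact fun n => E.shortExact.exactAt_X₂ (n + 1) (I.cocomplex_exactAt_succ n)
      (J.cocomplex_exactAt_succ n)
  refine ⟨E, ι, hι, ?_, ?_⟩
  · rw [hι0]
    change ιI ≫ E.i.f 0 = S.f ≫ φ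
    apply ext'
    · rw [Category.assoc, E.i_r, Category.comp_id, Category.assoc, φr, hα]
    · rw [Category.assoc, E.i_p, comp_zero, Category.assoc, φp, ← Category.assoc, S.zero,
        zero_comp]
  · rw [hι0]
    exact φp

end Horseshoe

section LES

variable {C D : Type*} [Category* C] [Abelian C] [EnoughInjectives C] [Category* D] [Abelian D]
  (F : C ⥤ D) [F.Additive]

/-- The long exact sequence of right derived functors. -/
theorem rightDerived_exact {S : ShortComplex C} (hS : S.ShortExact) (n : ℕ) :
    (∃ w, (ShortComplex.mk ((F.rightDerived n).map S.f) ((F.rightDerived n).map S.g) w).Exact) ∧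
    ∃ (δ : (F.rightDerived n).obj S.X₃ ⟶ (F.rightDerived (n + 1)).obj S.X₁),
      (∃ w, (ShortComplex.mk ((F.rightDerived n).map S.g) δ w).Exact) ∧
      (∃ w, (ShortComplex.mk δ ((F.rightDerived (n + 1)).map S.f) w).Exact) := by
  let I := InjectiveResolution.of S.X₁
  let J := InjectiveResolution.of S.X₃
  obtain ⟨E, ι, hι, h1, h2⟩ := exists_horseshoe hS I J
  -- All three derived functors are computed on the terms of one degreewise split sequence of
  -- complexes. An additive functor keeps it short exact, so the sequence is the homology sequence
  -- of its image.
  let K : InjectiveResolution S.X₂ := ⟨E.K, fun n => E.injective n, ι, hι⟩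
  have hT := E.map_shortExact F
  let T := E.sc.map (F.mapHomologicalComplex (ComplexShape.up ℕ))
  let eI (m : ℕ) : (F.rightDerived m).obj S.X₁ ≅ T.X₁.homology m := I.isoRightDerivedObj F m
  let eK (m : ℕ) : (F.rightDerived m).obj S.X₂ ≅ T.X₂.homology m := K.isoRightDerivedObj F m
  let eJ (m : ℕ) : (F.rightDerived m).obj S.X₃ ≅ T.X₃.homology m := J.isoRightDerivedObj F m
  have c1 (m : ℕ) : (F.rightDerived m).map S.f ≫ (eK m).hom =
      (eI m).hom ≫ HomologicalComplex.homologyMap T.f m :=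
    InjectiveResolution.isoRightDerivedObj_hom_naturality S.f I K E.i h1 F m
  have c2 (m : ℕ) : (F.rightDerived m).map S.g ≫ (eJ m).hom =
      (eK m).hom ≫ HomologicalComplex.homologyMap T.g m :=
    InjectiveResolution.isoRightDerivedObj_hom_naturality S.g K J E.p h2 F m
  have rel : (ComplexShape.up ℕ).Rel n (n + 1) := rfl
  have wn : (F.rightDerived n).map S.f ≫ (F.rightDerived n).map S.g = 0 := by
    rw [← cancel_mono (eJ n).hom, zero_comp, Category.assoc, c2, ← Category.assoc, c1,
      Category.assoc, ← HomologicalComplex.homologyMap_comp, T.zero,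
      HomologicalComplex.homologyMap_zero, comp_zero]
  let δ := (eJ n).hom ≫ hT.δ n (n + 1) rel ≫ (eI (n + 1)).inv
  have hδ : δ ≫ (eI (n + 1)).hom = (eJ n).hom ≫ hT.δ n (n + 1) rel := by
    simp only [δ, Category.assoc, Iso.inv_hom_id, Category.comp_id]
  have w1 : (F.rightDerived n).map S.g ≫ δ = 0 := by
    rw [← cancel_mono (eI (n + 1)).hom, zero_comp, Category.assoc, hδ, ← Category.assoc, c2,
      Category.assoc, hT.comp_δ n (n + 1) rel, comp_zero]
  have w2 : δ ≫ (F.rightDerived (n + 1)).map S.f = 0 := by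
    rw [← cancel_mono (eK (n + 1)).hom, zero_comp, Category.assoc, c1, ← Category.assoc, hδ,
      Category.assoc, hT.δ_comp n (n + 1) rel, comp_zero]
  refine ⟨⟨wn, ?_⟩, δ, ⟨w1, ?_⟩, ⟨w2, ?_⟩⟩
  · exact (ShortComplex.exact_iff_of_iso (ShortComplex.isoMk (eI n) (eK n) (eJ n) (c1 n).symm
      (c2 n).symm)).2 (hT.homology_exact₂ n)
  · exact (ShortComplex.exact_iff_of_iso (ShortComplex.isoMk (eK n) (eJ n) (eI (n + 1)) (c2 n).symm
      hδ.symm)).2 (hT.homology_exact₃ n (n + 1) rel)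
  · exact (ShortComplex.exact_iff_of_iso (ShortComplex.isoMk (eJ n) (eI (n + 1)) (eK (n + 1))
      hδ.symm (c1 (n + 1)).symm)).2 (hT.homology_exact₁ n (n + 1) rel)

end LES

end GradedCM

/-! ### Local cohomology under shifts, on torsion modules and in exact sequences. -/

namespace GradedCM

variable {k B : Type u} [Field k] [Ring B] [Algebra k B] {𝒜 : ℤ → Submodule k B}

namespace GrMod

/-! ### The shift functors -/

variable (𝒜) in
/-- The degree shift as a functor. -/
def shiftFunctor (n : ℤ) : GrMod 𝒜 ⥤ GrMod 𝒜 where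
  obj M := M.shift n
  map f := ⟨f.lin, fun i x hx => f.map_mem (n + i) x hx⟩

instance (n : ℤ) : (shiftFunctor 𝒜 n).Additive where

lemma shiftFunctor_exact (n : ℤ) (S : ShortComplex (GrMod 𝒜)) (h : S.Exact) :
    (S.map (shiftFunctor 𝒜 n)).Exact :=
  (exact_iff _).2 ((exact_iff S).1 h)

instance (n : ℤ) : (shiftFunctor 𝒜 n).PreservesHomology :=
  ((shiftFunctor 𝒜 n).exact_tfae.out 1 2).1 (shiftFunctor_exact n)

/-- Morphisms to a shifted module. -/
def unshift {M N : GrMod 𝒜} {n : ℤ} (f : M ⟶ N.shift n) : M.shift (-n) ⟶ N :=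
  ⟨f.lin, fun i x hx => by
    have h : f.lin x ∈ N.grading (n + (-n + i)) := f.map_mem (-n + i) x hx
    rwa [add_neg_cancel_left] at h⟩

/-- Morphisms to a shifted module. -/
def reshift {M N : GrMod 𝒜} {n : ℤ} (f : M.shift (-n) ⟶ N) : M ⟶ N.shift n :=
  ⟨f.lin, fun i x hx => f.map_mem (n + i) x (by
    change x ∈ M.grading (-n + (n + i))
    rwa [neg_add_cancel_left])⟩

instance injective_shift (M : GrMod 𝒜) (n : ℤ) [Injective M] : Injective (M.shift n) where
  factors {X Y} g f _ := by
    let f' : X.shift (-n) ⟶ Y.shift (-n) := (shiftFunctor 𝒜 (-n)).map f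
    have : Mono f' := mono_of_injective _ (injective_of_mono f)
    refine ⟨reshift (Injective.factorThru (unshift g) f'), ?_⟩
    ext x
    exact congrArg (fun t : X.shift (-n) ⟶ M => t.lin x)
      (Injective.comp_factorThru (unshift g) f')

/-- Multiplication by a central homogeneous element. -/
def centralMul {n j m : ℤ} (h : n + j = m) {c : B} (hc : c ∈ 𝒜 j) (hz : ∀ b, c * b = b * c) :
    shiftFunctor 𝒜 n ⟶ shiftFunctor 𝒜 m where
  app M :=
    { lin :=
        { toFun := fun x => (c • x : M)
          map_add' := fun x y => smul_add (A := M) c x y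
          map_smul' := fun b x => by
            change c • b • (x : M) = b • c • (x : M)
            rw [← mul_smul, hz, mul_smul] }
      map_mem := fun i x hx => by
        have := M.smul_mem hc hx
        rw [show j + (n + i) = m + i by omega] at this
        exact this }
  naturality M N f := by
    ext x
    exact (map_smul f.lin c x).symm

variable [GradedAlgebra 𝒜]

/-- The local cohomology modules. -/
abbrev lc (i : ℕ) (M : GrMod 𝒜) : GrMod 𝒜 := (localCohomology 𝒜 i).obj M

/-- The map induced on local cohomology. -/
abbrev lcMap (i : ℕ) {M N : GrMod 𝒜} (f : M ⟶ N) : lc i M ⟶ lc i N := (localCohomology 𝒜 i).map f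

/-- Local cohomology commutes with degree shifts, compatibly with multiplication by central
homogeneous elements. -/
theorem exists_lc_shift (i : ℕ) (M : GrMod 𝒜) :
    ∃ e : ∀ n, lc i (M.shift n) ≅ (lc i M).shift n,
      ∀ (n j m : ℤ) (h : n + j = m) (c : B) (hc : c ∈ 𝒜 j) (hz : ∀ b, c * b = b * c),
        lcMap i ((centralMul h hc hz).app M) ≫ (e m).hom =
          (e n).hom ≫ (centralMul h hc hz).app (lc i M) := by
  let I := InjectiveResolution.of M
  let F (n : ℤ) := shiftFunctor 𝒜 n
  have hres (n : ℤ) : ∃ ι : (CochainComplex.single₀ (GrMod 𝒜)).obj (M.shift n) ⟶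
      ((F n).mapHomologicalComplex _).obj I.cocomplex, QuasiIso ι ∧
        ι.f 0 = (F n).map (I.ι.f 0 : M ⟶ I.cocomplex.X 0) := by
    have h0 := I.ι_f_zero_comp_complex_d
    refine exists_injectiveResolution_of_exact
      (((F n).mapHomologicalComplex (ComplexShape.up ℕ)).obj I.cocomplex)
      ((F n).map (I.ι.f 0 : M ⟶ I.cocomplex.X 0)) ?_ ?_ ?_ ?_
    · refine ((F n).map_comp (I.ι.f 0 : M ⟶ I.cocomplex.X 0) (I.cocomplex.d 0 1)).symm.trans ?_
      exact (congrArg (F n).map h0).trans ((F n).map_zero _ _)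
    · exact mono_of_injective _ (injective_of_mono (I.ι.f 0 : M ⟶ I.cocomplex.X 0))
    · exact shiftFunctor_exact n _ I.exact₀
    · intro l
      exact shiftFunctor_exact n _ (I.cocomplex_exactAt_succ l)
  choose ι hι hι0 using hres
  -- The shifts of one fixed resolution of `M` serve for all `n`. Central multiplication is then a
  -- morphism between these resolutions, which gives the compatibility by naturality.
  let R (n : ℤ) : InjectiveResolution (M.shift n) :=
    { cocomplex := ((F n).mapHomologicalComplex _).obj I.cocomplex
      injective := fun l => injective_shift (I.cocomplex.X l) n
      ι := ι n
      quasiIso := hι n }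
  let S : ShortComplex (GrMod 𝒜) :=
    (((torsion 𝒜).mapHomologicalComplex (ComplexShape.up ℕ)).obj I.cocomplex).sc i
  let e1 (n : ℤ) : lc i ((F n).obj M) ≅ (S.map (F n)).homology := (R n).isoRightDerivedObj (torsion 𝒜) i
  let e2 : lc i M ≅ S.homology := I.isoRightDerivedObj (torsion 𝒜) i
  refine ⟨fun n => e1 n ≪≫ S.mapHomologyIso (F n) ≪≫ (F n).mapIso e2.symm, ?_⟩
  intro n j m h c hc hz
  let τ : F n ⟶ F m := centralMul h hc hz
  have c1 : lcMap i (τ.app M) ≫ (e1 m).hom =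
      (e1 n).hom ≫ ShortComplex.homologyMap (S.mapNatTrans τ) := by
    refine InjectiveResolution.isoRightDerivedObj_hom_naturality (τ.app M) (R n) (R m)
      ((NatTrans.mapHomologicalComplex τ _).app I.cocomplex) ?_ (torsion 𝒜) i
    change (ι n).f 0 ≫ τ.app (I.cocomplex.X 0) = τ.app M ≫ (ι m).f 0
    rw [hι0, hι0]
    exact τ.naturality (I.ι.f 0 : M ⟶ I.cocomplex.X 0)
  rw [ShortComplex.homologyMap_mapNatTrans] at c1
  have c2 : lcMap i (τ.app M) ≫ (e1 m).hom ≫ (S.mapHomologyIso (F m)).hom ≫ (F m).map e2.inv =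
      (e1 n).hom ≫ (S.mapHomologyIso (F n)).hom ≫ (F n).map e2.inv ≫ τ.app (lc i M) := by
    rw [← Category.assoc, c1]
    simp only [Category.assoc, Iso.inv_hom_id_assoc, τ.naturality]
  exact c2.trans rfl

/-! ### Torsion modules -/

/-- All elements are torsion. -/
def IsTorsion (M : GrMod 𝒜) : Prop := ∀ x : M, x ∈ M.torsionSubmodule

lemma map_mem_torsionSubmodule {M N : GrMod 𝒜} (f : M ⟶ N) {x : M}
    (hx : x ∈ M.torsionSubmodule) : f.lin x ∈ N.torsionSubmodule := by
  obtain ⟨n, hn, hx⟩ := hx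
  exact ⟨n, hn, fun i hi a ha => by rw [← map_smul, hx i hi a ha, map_zero]⟩

lemma mem_torsionSubmodule_of_map {M N : GrMod 𝒜} (f : M ⟶ N) (hf : Function.Injective f.lin)
    {x : M} (hx : f.lin x ∈ N.torsionSubmodule) : x ∈ M.torsionSubmodule := by
  obtain ⟨n, hn, hx⟩ := hx
  exact ⟨n, hn, fun i hi a ha => hf (by rw [map_smul, hx i hi a ha, map_zero])⟩

lemma IsTorsion.of_injective {M N : GrMod 𝒜} (f : M ⟶ N) (hf : Function.Injective f.lin)
    (hN : N.IsTorsion) : M.IsTorsion := fun _ => mem_torsionSubmodule_of_map f hf (hN _)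

lemma IsTorsion.of_surjective {M N : GrMod 𝒜} (f : M ⟶ N) (hf : Function.Surjective f.lin)
    (hM : M.IsTorsion) : N.IsTorsion := fun y => by
  obtain ⟨x, rfl⟩ := hf y
  exact map_mem_torsionSubmodule f (hM x)

lemma isTorsion_torsion (M : GrMod 𝒜) : ((torsion 𝒜).obj M).IsTorsion :=
  fun x => mem_torsionSubmodule_of_map (M.subι _ M.torsion_homog) Subtype.val_injective x.2

/-- Local cohomology is a subquotient of `Γ` of an injective module. -/
lemma isTorsion_lc (i : ℕ) (M : GrMod 𝒜) : (lc i M).IsTorsion := by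
  let I := InjectiveResolution.of M
  let K := ((torsion 𝒜).mapHomologicalComplex (ComplexShape.up ℕ)).obj I.cocomplex
  let e : lc i M ≅ K.homology i := I.isoRightDerivedObj (torsion 𝒜) i
  have h1 : (K.X i).IsTorsion := isTorsion_torsion (I.cocomplex.X i)
  have h2 : (K.cycles i).IsTorsion := h1.of_injective (K.iCycles i) (injective_of_mono _)
  have h3 : (K.homology i).IsTorsion := h2.of_surjective (K.homologyπ i) (surjective_of_epi _)
  exact h3.of_injective e.hom (injective_of_mono _)

instance : PreservesFiniteLimits (torsion 𝒜) := by
  rw [Functor.preservesFiniteLimits_iff_forall_exact_map_and_mono]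
  intro S hS
  have hf : Function.Injective S.f.lin := by
    have := hS.mono_f
    exact injective_of_mono S.f
  refine ⟨(exact_iff _).2 ?_, mono_of_injective _ ?_⟩
  · rintro ⟨y, hy⟩ h
    obtain ⟨x, rfl⟩ := (exact_iff S).1 hS.exact y (congrArg Subtype.val h)
    exact ⟨⟨x, mem_torsionSubmodule_of_map S.f hf hy⟩, rfl⟩
  · intro x y h
    exact Subtype.ext (hf (congrArg Subtype.val h))

/-- Local cohomology in degree `0` is the torsion submodule. -/
def lcZeroIso : localCohomology 𝒜 0 ≅ torsion 𝒜 := (torsion 𝒜).rightDerivedZeroIsoSelf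

lemma lc_zero_isZero_iff (M : GrMod 𝒜) :
    IsZero (lc 0 M) ↔ ∀ x ∈ M.torsionSubmodule, x = 0 := by
  rw [(lcZeroIso.app M).isZero_iff, isZero_iff]
  exact ⟨fun h x hx => congrArg Subtype.val (h ⟨x, hx⟩), fun h x => Subtype.ext (h x.1 x.2)⟩

/-- Every preimage in a torsion module is itself torsion, so `Γ` keeps such a map surjective; this
replaces the missing right exactness. -/
lemma lc_zero_surjective {M N : GrMod 𝒜} (f : M ⟶ N) (hf : Function.Surjective f.lin)
    (hM : M.IsTorsion) : Function.Surjective (lcMap 0 f).lin := by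
  have h : Epi ((torsion 𝒜).map f) := epi_of_surjective _ fun y => by
    obtain ⟨x, hx⟩ := hf y.1
    exact ⟨⟨x, hM x⟩, Subtype.ext hx⟩
  have h2 := lcZeroIso.hom.naturality f
  have : Epi (lcMap 0 f) := by
    have h3 : lcMap 0 f = (lcZeroIso.hom.app M ≫ (torsion 𝒜).map f) ≫ lcZeroIso.inv.app N := by
      rw [← h2, Category.assoc, Iso.hom_inv_id_app, Category.comp_id]
    rw [h3]
    infer_instance
  exact surjective_of_epi _

lemma lc_zero_injective {M N : GrMod 𝒜} (f : M ⟶ N) (hf : Function.Injective f.lin) :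
    Function.Injective (lcMap 0 f).lin := by
  have h : Mono ((torsion 𝒜).map f) := mono_of_injective _ fun x y h =>
    Subtype.ext (hf (congrArg Subtype.val h))
  have h2 := lcZeroIso.hom.naturality f
  have : Mono (lcMap 0 f) := by
    have h3 : lcMap 0 f = (lcZeroIso.hom.app M ≫ (torsion 𝒜).map f) ≫ lcZeroIso.inv.app N := by
      rw [← h2, Category.assoc, Iso.hom_inv_id_app, Category.comp_id]
    rw [h3]
    infer_instance
  exact injective_of_mono _

/-! ### Consequences of the long exact sequence -/

section LES

variable {S : ShortComplex (GrMod 𝒜)} (hS : S.ShortExact) (i : ℕ)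

include hS

lemma lc_exact₂ (y : lc i S.X₂) (h : (lcMap i S.g).lin y = 0) : ∃ x, (lcMap i S.f).lin x = y := by
  obtain ⟨⟨w, h1⟩, -⟩ := rightDerived_exact (torsion 𝒜) hS i
  exact (exact_iff _).1 h1 y h

lemma exists_lc_δ : ∃ δ : lc i S.X₃ ⟶ lc (i + 1) S.X₁,
    (∀ x, δ.lin ((lcMap i S.g).lin x) = 0) ∧
    (∀ y, δ.lin y = 0 → ∃ x, (lcMap i S.g).lin x = y) ∧
    (∀ x, (lcMap (i + 1) S.f).lin (δ.lin x) = 0) ∧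
    (∀ y, (lcMap (i + 1) S.f).lin y = 0 → ∃ x, δ.lin x = y) := by
  obtain ⟨-, δ, ⟨w1, h1⟩, ⟨w2, h2⟩⟩ := rightDerived_exact (torsion 𝒜) hS i
  refine ⟨δ, fun x => ?_, (exact_iff _).1 h1, fun x => ?_, (exact_iff _).1 h2⟩
  · exact congrArg (fun t : lc i S.X₂ ⟶ lc (i + 1) S.X₁ => t.lin x) w1
  · exact congrArg (fun t : lc i S.X₃ ⟶ lc (i + 1) S.X₂ => t.lin x) w2

lemma lc_isZero₂ (h1 : IsZero (lc i S.X₁)) (h3 : IsZero (lc i S.X₃)) : IsZero (lc i S.X₂) := by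
  rw [isZero_iff] at *
  intro y
  obtain ⟨x, rfl⟩ := lc_exact₂ hS i y (h3 _)
  rw [h1 x, map_zero]

lemma lc_isZero₃ (h2 : IsZero (lc i S.X₂)) (h1 : IsZero (lc (i + 1) S.X₁)) :
    IsZero (lc i S.X₃) := by
  rw [isZero_iff] at *
  obtain ⟨δ, -, h, -, -⟩ := exists_lc_δ hS i
  intro y
  obtain ⟨x, rfl⟩ := h y (h1 _)
  rw [h2 x, map_zero]

lemma lc_isZero₁ (h3 : IsZero (lc i S.X₃)) (h2 : IsZero (lc (i + 1) S.X₂)) :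
    IsZero (lc (i + 1) S.X₁) := by
  rw [isZero_iff] at *
  obtain ⟨δ, -, -, -, h⟩ := exists_lc_δ hS i
  intro y
  obtain ⟨x, rfl⟩ := h y (h2 _)
  rw [h3 x, map_zero]

lemma lc_zero_isZero₁ (h2 : IsZero (lc 0 S.X₂)) : IsZero (lc 0 S.X₁) := by
  have := hS.mono_f
  rw [isZero_iff] at *
  exact fun x => lc_zero_injective S.f (injective_of_mono _) ((h2 _).trans (map_zero _).symm)

lemma lcMap_surjective (h1 : IsZero (lc (i + 1) S.X₁)) : Function.Surjective (lcMap i S.g).lin := by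
  rw [isZero_iff] at h1
  obtain ⟨δ, -, h, -, -⟩ := exists_lc_δ hS i
  exact fun y => h y (h1 _)

lemma lcMap_injective (h1 : IsZero (lc i S.X₁)) : Function.Injective (lcMap i S.g).lin := by
  rw [isZero_iff] at h1
  rw [← LinearMap.ker_eq_bot, eq_bot_iff]
  intro y hy
  obtain ⟨x, rfl⟩ := lc_exact₂ hS i y hy
  rw [h1 x, map_zero]
  exact zero_mem _

lemma lcMap_injective_f (h3 : IsZero (lc i S.X₃)) :
    Function.Injective (lcMap (i + 1) S.f).lin := by
  rw [isZero_iff] at h3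
  obtain ⟨δ, -, -, -, h⟩ := exists_lc_δ hS i
  rw [← LinearMap.ker_eq_bot, eq_bot_iff]
  intro y hy
  obtain ⟨x, rfl⟩ := h y hy
  rw [h3 x, map_zero]
  exact zero_mem _

end LES

end GrMod

end GradedCM

namespace GradedCM

variable {k B : Type u} [Field k] [Ring B] [Algebra k B] {𝒜 : ℤ → Submodule k B}

namespace GrMod

/-! ### Local cohomology of modules which are bounded above -/

/-- The components in large degrees vanish. -/
def IsBddAbove (M : GrMod 𝒜) : Prop := ∃ b : ℤ, ∀ i, b < i → M.grading i = ⊥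

lemma IsBddAbove.of_injective {M N : GrMod 𝒜} (f : M ⟶ N) (hf : Function.Injective f.lin)
    (hN : N.IsBddAbove) : M.IsBddAbove := by
  obtain ⟨b, hb⟩ := hN
  refine ⟨b, fun i hi => eq_bot_iff.2 fun x hx => ?_⟩
  have h := f.map_mem i x hx
  rw [hb i hi] at h
  exact hf (((Submodule.mem_bot k).1 h).trans (map_zero _).symm)

lemma IsBddAbove.of_surjective {M N : GrMod 𝒜} (f : M ⟶ N) (hf : Function.Surjective f.lin)
    (hM : M.IsBddAbove) : N.IsBddAbove := by
  obtain ⟨b, hb⟩ := hM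
  refine ⟨b, fun i hi => eq_bot_iff.2 fun y hy => ?_⟩
  obtain ⟨x, rfl⟩ := hf y
  rw [← N.comp_same hy, ← hom_comp]
  have h := M.comp_mem i x
  rw [hb i hi, Submodule.mem_bot] at h
  rw [h, map_zero]
  exact zero_mem _

/-- The `k`-linear map given by linear maps on the components. -/
def desc (M : GrMod 𝒜) {W : Type u} [AddCommGroup W] [Module k W]
    (f : ∀ n, M.grading n →ₗ[k] W) : M →ₗ[k] W :=
  letI := M.isInternal.chooseDecomposition
  DirectSum.toModule k ℤ W f ∘ₗ (DirectSum.decomposeLinearEquiv M.grading).toLinearMap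

lemma desc_apply (M : GrMod 𝒜) {W : Type u} [AddCommGroup W] [Module k W]
    (f : ∀ n, M.grading n →ₗ[k] W) {n : ℤ} {x : M} (hx : x ∈ M.grading n) :
    M.desc f x = f n ⟨x, hx⟩ := by
  let _ := M.isInternal.chooseDecomposition
  simp only [desc, LinearMap.comp_apply, LinearEquiv.coe_coe,
    DirectSum.decomposeLinearEquiv_apply, DirectSum.decompose_of_mem M.grading hx]
  exact DirectSum.toModule_lof k (M := fun i => ↥(M.grading i)) n ⟨x, hx⟩

variable [GradedAlgebra 𝒜]

/-- The morphism of graded modules given by compatible linear maps on the components. -/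
def homMk {M N : GrMod 𝒜} (f : ∀ n, M.grading n →ₗ[k] N) (hf : ∀ n x, f n x ∈ N.grading n)
    (hf' : ∀ i n (b : B) (hb : b ∈ 𝒜 i) (x : M) (hx : x ∈ M.grading n),
      f (i + n) ⟨b • x, M.smul_mem hb hx⟩ = b • f n ⟨x, hx⟩) : M ⟶ N where
  lin :=
    { toFun := M.desc f
      map_add' := map_add _
      map_smul' := fun b x => by
        simp only [RingHom.id_apply]
        induction b using DirectSum.Decomposition.inductionOn 𝒜 with
        | zero => simp
        | add a a' ha ha' => simp only [add_smul, map_add, ha, ha']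
        | homogeneous b =>
          induction x using M.induction_homog with
          | h0 => simp
          | ha x y hx hy => simp only [smul_add, map_add, hx, hy]
          | hh n x hx =>
            rw [M.desc_apply f hx, M.desc_apply f (M.smul_mem b.2 hx), hf' _ _ _ b.2] }
  map_mem n x hx := by
    change M.desc f x ∈ _
    rw [M.desc_apply f hx]
    exact hf _ _

lemma homMk_apply {M N : GrMod 𝒜} (f : ∀ n, M.grading n →ₗ[k] N)
    (hf : ∀ n x, f n x ∈ N.grading n)
    (hf' : ∀ i n (b : B) (hb : b ∈ 𝒜 i) (x : M) (hx : x ∈ M.grading n),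
      f (i + n) ⟨b • x, M.smul_mem hb hx⟩ = b • f n ⟨x, hx⟩) {n : ℤ} {x : M}
    (hx : x ∈ M.grading n) : (homMk f hf hf').lin x = f n ⟨x, hx⟩ := M.desc_apply f hx

section Cofree

variable (M : GrMod 𝒜)

/-- The linear maps from `B` to `M` which are homogeneous of degree `i`. -/
def homogMaps (i : ℤ) : Submodule k (B →ₗ[k] M) where
  carrier := {φ | ∀ l, ∀ x ∈ 𝒜 l, φ x ∈ M.grading (l + i)}
  add_mem' h h' l x hx := add_mem (h l x hx) (h' l x hx)
  zero_mem' _ _ _ := zero_mem _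
  smul_mem' c _ h l x hx := Submodule.smul_mem _ c (h l x hx)

/-- The components of the cofree graded module. -/
def cofreeComponents : Components 𝒜 where
  V i := M.homogMaps i
  act {i j l} h := LinearMap.mk₂ k
    (fun b φ => ⟨(φ : B →ₗ[k] M) ∘ₗ LinearMap.mulRight k (b : B), fun p x hx => by
      have := φ.2 _ _ (SetLike.mul_mem_graded hx b.2)
      rw [show p + i + j = p + l by omega] at this
      exact this⟩)
    (fun b b' φ => Subtype.ext (LinearMap.ext fun x =>
      (congrArg (φ : B →ₗ[k] M) (mul_add x (b : B) b')).trans (map_add _ _ _)))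
    (fun c b φ => Subtype.ext (LinearMap.ext fun x =>
      (congrArg (φ : B →ₗ[k] M) (mul_smul_comm c x (b : B))).trans (map_smul _ _ _)))
    (fun _ _ _ => rfl)
    (fun _ _ _ => rfl)
  one_act _ φ := Subtype.ext (LinearMap.ext fun x => congrArg (φ : B →ₗ[k] M) (mul_one x))
  mul_act _ _ _ a b φ := Subtype.ext (LinearMap.ext fun x =>
    congrArg (φ : B →ₗ[k] M) (mul_assoc x (a : B) b).symm)

/-- The cofree graded module on the graded vector space underlying `M`. -/
def cofree : GrMod 𝒜 := M.cofreeComponents.toGrMod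

/-- The inclusion of a component. -/
def cofreeInc (i : ℤ) : M.homogMaps i →ₗ[k] M.cofree := M.cofreeComponents.inc i

lemma cofreeInc_mem (i : ℤ) (φ : M.homogMaps i) : M.cofreeInc i φ ∈ M.cofree.grading i :=
  M.cofreeComponents.inc_mem i φ

lemma cofreeInc_injective (i : ℤ) : Function.Injective (M.cofreeInc i) :=
  M.cofreeComponents.inc_injective i

lemma exists_cofreeInc {i : ℤ} {x : M.cofree} (hx : x ∈ M.cofree.grading i) :
    ∃ φ, M.cofreeInc i φ = x := hx

lemma smul_cofreeInc {i j : ℤ} {b : B} (hb : b ∈ 𝒜 i) (φ : M.homogMaps j) (ψ : M.homogMaps (i + j))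
    (h : ∀ x, (ψ : B →ₗ[k] M) x = (φ : B →ₗ[k] M) (x * b)) :
    b • M.cofreeInc j φ = M.cofreeInc (i + j) ψ := by
  refine (M.cofreeComponents.smul_inc rfl ⟨b, hb⟩ φ).trans (congrArg (M.cofreeInc (i + j)) ?_)
  exact Subtype.ext (LinearMap.ext fun x => (h x).symm)

/-- Evaluation at `1`. -/
def cofreeEval : M.cofree →ₗ[k] M :=
  M.cofreeComponents.desc fun i => LinearMap.applyₗ (1 : B) ∘ₗ (M.homogMaps i).subtype

lemma cofreeEval_inc (i : ℤ) (φ : M.homogMaps i) :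
    M.cofreeEval (M.cofreeInc i φ) = (φ : B →ₗ[k] M) 1 :=
  M.cofreeComponents.desc_inc (fun i => LinearMap.applyₗ (1 : B) ∘ₗ (M.homogMaps i).subtype) i φ

lemma linearMap_ext_homog {W : Type u} [AddCommGroup W] [Module k W] {f g : B →ₗ[k] W}
    (h : ∀ i, ∀ b ∈ 𝒜 i, f b = g b) : f = g := by
  ext b
  induction b using DirectSum.Decomposition.inductionOn 𝒜 with
  | zero => simp
  | add a a' ha ha' => simp only [map_add, ha, ha']
  | homogeneous b => exact h _ b b.2

lemma cofreeEval_smul_inc {i j : ℤ} {b : B} (hb : b ∈ 𝒜 i) (φ : M.homogMaps j) :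
    M.cofreeEval (b • M.cofreeInc j φ) = (φ : B →ₗ[k] M) b := by
  refine (congrArg M.cofreeEval (M.cofreeComponents.smul_inc rfl ⟨b, hb⟩ φ)).trans
    ((M.cofreeEval_inc _ _).trans ?_)
  exact congrArg (φ : B →ₗ[k] M) (one_mul b)

variable {M}

/-- The morphism to the cofree module given by a degree preserving linear map. -/
def cofreeLift {Y : GrMod 𝒜} (h : Y →ₗ[k] M) (hh : ∀ n, ∀ y ∈ Y.grading n, h y ∈ M.grading n) :
    Y ⟶ M.cofree :=
  homMk (fun n => M.cofreeInc n ∘ₗ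
      { toFun := fun y => ⟨h ∘ₗ (LinearMap.toSpanSingleton B Y y).restrictScalars k,
          fun _ _ hx => hh _ _ (Y.smul_mem hx y.2)⟩
        map_add' := fun y y' => Subtype.ext (LinearMap.ext fun x =>
          (congrArg h (smul_add x (y : Y) y')).trans (map_add _ _ _))
        map_smul' := fun c y => Subtype.ext (LinearMap.ext fun x => by
          refine (congrArg h ?_).trans (map_smul h c _)
          change x • c • (y : Y) = c • x • (y : Y)
          rw [← algebraMap_smul B c, ← algebraMap_smul B c, ← mul_smul, ← mul_smul,
            Algebra.commutes]) })
    (fun n _ => M.cofreeInc_mem n _)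
    (fun i n b hb x hx => by
      symm
      refine M.smul_cofreeInc hb _ _ fun z => congrArg h ?_
      exact (mul_smul z b x).symm)

lemma cofreeLift_apply {Y : GrMod 𝒜} (h : Y →ₗ[k] M)
    (hh : ∀ n, ∀ y ∈ Y.grading n, h y ∈ M.grading n) {n : ℤ} {y : Y} (hy : y ∈ Y.grading n) :
    ∃ φ : M.homogMaps n, (∀ b, (φ : B →ₗ[k] M) b = h (b • y)) ∧
      (cofreeLift h hh).lin y = M.cofreeInc n φ :=
  ⟨_, fun _ => rfl, homMk_apply _ _ _ hy⟩

/-- `cofree` is right adjoint to the forgetful functor to graded vector spaces, and there every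
subobject splits. -/
instance : Injective M.cofree where
  factors {X Y} g f _ := by
    obtain ⟨p, hp⟩ := LinearMap.exists_leftInverse_of_injective (f.lin.restrictScalars k)
      (LinearMap.ker_eq_bot.2 (injective_of_mono f))
    have hp (x : X) : p (f.lin x) = x := LinearMap.congr_fun hp x
    let h0 : Y →ₗ[k] M := M.cofreeEval ∘ₗ g.lin.restrictScalars k ∘ₗ p
    -- The retraction `p` need not preserve degrees, so only the degree-preserving part of `h0` is
    -- used. On the image of `f` nothing is lost, since `h0` preserves degrees there.
    let h : Y →ₗ[k] M := Y.desc fun n => M.comp n ∘ₗ h0 ∘ₗ (Y.grading n).subtype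
    have h1 {n : ℤ} {y : Y} (hy : y ∈ Y.grading n) : h y = M.comp n (h0 y) := Y.desc_apply _ hy
    have h2 {n : ℤ} {x : X} (hx : x ∈ X.grading n) : h (f.lin x) = M.cofreeEval (g.lin x) := by
      rw [h1 (f.map_mem n x hx)]
      have h3 : h0 (f.lin x) = M.cofreeEval (g.lin x) :=
        congrArg (fun t => M.cofreeEval (g.lin t)) (hp x)
      rw [h3]
      obtain ⟨φ, hφ⟩ := M.exists_cofreeInc (g.map_mem n x hx)
      rw [← hφ, cofreeEval_inc]
      have := φ.2 0 1 (SetLike.one_mem_graded 𝒜)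
      rw [zero_add] at this
      exact M.comp_same this
    refine ⟨cofreeLift h fun n y hy => by rw [h1 hy]; exact M.comp_mem n _,
      hom_ext_homog fun n x hx => ?_⟩
    obtain ⟨φ, hφ, hφ'⟩ := cofreeLift_apply h (fun n y hy => by rw [h1 hy]; exact M.comp_mem n _)
      (f.map_mem n x hx)
    refine hφ'.trans ?_
    obtain ⟨ψ, hψ⟩ := M.exists_cofreeInc (g.map_mem n x hx)
    rw [← hψ]
    refine congrArg _ (Subtype.ext (linearMap_ext_homog (𝒜 := 𝒜) fun i b hb => ?_))
    rw [hφ, ← map_smul, h2 (X.smul_mem hb hx), map_smul, ← hψ, M.cofreeEval_smul_inc hb]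

variable (M)

/-- The embedding in the cofree module. -/
def toCofree : M ⟶ M.cofree := cofreeLift LinearMap.id fun _ _ h => h

lemma toCofree_injective : Function.Injective M.toCofree.lin := by
  rw [← LinearMap.ker_eq_bot, eq_bot_iff]
  intro x hx
  refine M.ext_comp fun n => ?_
  have h1 : M.toCofree.lin (M.comp n x) = 0 := by
    rw [hom_comp, LinearMap.mem_ker.1 hx, map_zero]
  obtain ⟨φ, hφ, hφ'⟩ := cofreeLift_apply (M := M) LinearMap.id (fun _ _ h => h) (M.comp_mem n x)
  have h2 : M.cofreeInc n φ = 0 := hφ'.symm.trans h1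
  have h3 : φ = 0 := M.cofreeInc_injective n (h2.trans (map_zero _).symm)
  have h4 := hφ 1
  rw [h3, one_smul] at h4
  rw [map_zero]
  exact h4.symm

/-- A map of large degree sends the components of `B`, which start at `a`, beyond the last nonzero
component of `M`. So the injective hull used here is still bounded above, hence torsion. -/
lemma cofree_isBddAbove (hB : (self 𝒜).IsBddBelow) (hM : M.IsBddAbove) : M.cofree.IsBddAbove := by
  obtain ⟨a, ha⟩ := hB
  obtain ⟨b, hb⟩ := hM
  refine ⟨b - a, fun i hi => eq_bot_iff.2 fun x hx => ?_⟩
  obtain ⟨φ, rfl⟩ := M.exists_cofreeInc hx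
  have : φ = 0 := Subtype.ext (linearMap_ext_homog (𝒜 := 𝒜) fun l x hx => by
    by_cases hl : l < a
    · have h : x ∈ (⊥ : Submodule k B) := (ha l hl : 𝒜 l = ⊥) ▸ hx
      rw [(Submodule.mem_bot k).1 h, map_zero, map_zero]
    · have h := φ.2 l x hx
      rw [hb _ (by omega)] at h
      exact h)
  rw [this, map_zero]
  exact zero_mem _

end Cofree

lemma IsBddAbove.isTorsion {M : GrMod 𝒜} (hM : M.IsBddAbove) : M.IsTorsion := by
  obtain ⟨b, hb⟩ := hM
  intro x
  induction x using M.induction_homog with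
  | h0 => exact zero_mem _
  | ha x y hx hy => exact add_mem hx hy
  | hh n x hx =>
    refine ⟨(b - n).toNat + 1, by omega, fun i hi a ha => ?_⟩
    have h := M.smul_mem ha hx
    rw [hb _ (by omega)] at h
    exact h

/-- The homogeneous multiples of a torsion element stay below a fixed degree, and finitely many
generators share such a bound. -/
lemma IsTorsion.isBddAbove {M : GrMod 𝒜} [Module.Finite B M] (hM : M.IsTorsion) :
    M.IsBddAbove := by
  classical
  have key (x : M) : ∃ b : ℤ, ∀ i, ∀ a ∈ 𝒜 i, ∀ n, b < n → M.comp n (a • x) = 0 := by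
    induction x using M.induction_homog with
    | h0 => exact ⟨0, fun i a _ n _ => by rw [smul_zero, map_zero]⟩
    | ha x y hx hy =>
      obtain ⟨b, hb⟩ := hx
      obtain ⟨b', hb'⟩ := hy
      refine ⟨max b b', fun i a ha n hn => ?_⟩
      rw [smul_add, map_add, hb i a ha n (by omega), hb' i a ha n (by omega), add_zero]
    | hh j x hx =>
      obtain ⟨m, -, hm⟩ := hM x
      refine ⟨m + j, fun i a ha n hn => ?_⟩
      by_cases h : (m : ℤ) ≤ i
      · rw [hm i h a ha, map_zero]
      · exact M.comp_ne (M.smul_mem ha hx) (by omega)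
  obtain ⟨s, hs⟩ := (Module.Finite.fg_top : (⊤ : Submodule B M).FG)
  choose b hb using key
  obtain ⟨c, hc⟩ := (s.image b).exists_le
  refine ⟨c, fun i hi => eq_bot_iff.2 fun y hy => ?_⟩
  have h1 : ∀ y ∈ Submodule.span B (s : Set M), M.comp i y = 0 := by
    intro y hy
    induction hy using Submodule.closure_induction with
    | zero => exact map_zero _
    | add x y _ _ hx hy => rw [map_add, hx, hy, add_zero]
    | smul_mem a x hx =>
      induction a using DirectSum.Decomposition.inductionOn 𝒜 with
      | zero => rw [zero_smul, map_zero]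
      | add a a' ha ha' => rw [add_smul, map_add, ha, ha', add_zero]
      | homogeneous a =>
        exact hb x _ a a.2 i (lt_of_le_of_lt (hc _ (Finset.mem_image_of_mem b hx)) hi)
  rw [← M.comp_same hy, h1 y (by rw [hs]; trivial)]
  exact zero_mem _

/-- The local cohomology of a module bounded above is concentrated in degree `0`. -/
theorem lc_isZero_of_isBddAbove (hB : (self 𝒜).IsBddBelow) (i : ℕ) {M : GrMod 𝒜}
    (hM : M.IsBddAbove) : IsZero (lc (i + 1) M) := by
  induction i generalizing M with
  | zero =>
    let S := ShortComplex.mk M.toCofree _ (quotπ_range M.toCofree)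
    have hS : S.ShortExact := shortExact_mk _ _ _ M.toCofree_injective
      (Submodule.mkQ_surjective _) fun y hy => (Submodule.Quotient.mk_eq_zero _).1 hy
    have hE := M.cofree_isBddAbove hB hM
    have hz : IsZero (lc 1 M.cofree) := (torsion 𝒜).isZero_rightDerived_obj_injective_succ 0 _
    rw [isZero_iff] at hz ⊢
    obtain ⟨δ, h1, -, -, h4⟩ := exists_lc_δ hS 0
    intro y
    obtain ⟨x, rfl⟩ := h4 y (hz _)
    -- The cofree module is torsion, so `Γ` is surjective onto that of the quotient and the
    -- connecting map is zero.
    obtain ⟨z, rfl⟩ := lc_zero_surjective S.g (Submodule.mkQ_surjective _) hE.isTorsion x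
    exact h1 z
  | succ i ih =>
    let S := ShortComplex.mk M.toCofree _ (quotπ_range M.toCofree)
    have hS : S.ShortExact := shortExact_mk _ _ _ M.toCofree_injective
      (Submodule.mkQ_surjective _) fun y hy => (Submodule.Quotient.mk_eq_zero _).1 hy
    have hE := M.cofree_isBddAbove hB hM
    exact lc_isZero₁ hS (i + 1) (ih (hE.of_surjective S.g (Submodule.mkQ_surjective _)))
      ((torsion 𝒜).isZero_rightDerived_obj_injective_succ _ _)

end GrMod

end GradedCM

/-! ### Graded duality and Nakayama's lemma over a commutative graded ring. -/

namespace GradedCM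

namespace GrMod

/-! ### Graded duals over commutative graded algebras -/

section Dual

variable {k R : Type u} [Field k] [CommRing R] [Algebra k R] {ℛ : ℤ → Submodule k R}

section

variable (X : GrMod ℛ)

/-- The linear functionals which vanish on almost all components. -/
def gdualSubmodule : Submodule k (X →ₗ[k] k) where
  carrier := {φ | ∃ s : Finset ℤ, ∀ n ∉ s, ∀ x ∈ X.grading n, φ x = 0}
  add_mem' := by
    classical
    rintro φ ψ ⟨s, hs⟩ ⟨t, ht⟩
    refine ⟨s ∪ t, fun n hn x hx => ?_⟩
    rw [Finset.mem_union, not_or] at hn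
    rw [LinearMap.add_apply, hs n hn.1 x hx, ht n hn.2 x hx, add_zero]
  zero_mem' := ⟨∅, fun _ _ _ _ => rfl⟩
  smul_mem' := by
    rintro c φ ⟨s, hs⟩
    exact ⟨s, fun n hn x hx => by rw [LinearMap.smul_apply, hs n hn x hx, smul_zero]⟩

/-- Multiplication by an element of `R`, as a `k`-linear map. -/
def actLin (r : R) : X →ₗ[k] X where
  toFun x := r • x
  map_add' := smul_add r
  map_smul' c x := by
    rw [RingHom.id_apply, ← algebraMap_smul R c x, ← algebraMap_smul R c (r • x), ← mul_smul,
      ← mul_smul, mul_comm]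

lemma actLin_apply (r : R) (x : X) : X.actLin r x = r • x := rfl

variable [GradedAlgebra ℛ]

lemma comp_actLin_mem (r : R) {φ : X →ₗ[k] k} (hφ : φ ∈ X.gdualSubmodule) :
    φ ∘ₗ X.actLin r ∈ X.gdualSubmodule := by
  classical
  induction r using DirectSum.Decomposition.inductionOn ℛ with
  | zero =>
    have : φ ∘ₗ X.actLin 0 = 0 := by ext x; simp [actLin_apply]
    rw [this]
    exact zero_mem _
  | add r r' hr hr' =>
    have : φ ∘ₗ X.actLin (r + r') = φ ∘ₗ X.actLin r + φ ∘ₗ X.actLin r' := by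
      ext x
      simp [actLin_apply, add_smul]
    rw [this]
    exact add_mem hr hr'
  | homogeneous r =>
    rename_i i
    obtain ⟨s, hs⟩ := hφ
    refine ⟨s.image fun n => n - i, fun n hn x hx => ?_⟩
    refine hs (i + n) (fun h => hn ?_) _ (X.smul_mem r.2 hx)
    exact Finset.mem_image.2 ⟨i + n, h, by omega⟩

/-- The `R`-module structure of the graded dual. -/
@[reducible] def gdualModule : Module R X.gdualSubmodule where
  smul r φ := ⟨φ.1 ∘ₗ X.actLin r, X.comp_actLin_mem r φ.2⟩
  one_smul φ := Subtype.ext (LinearMap.ext fun x => congrArg φ.1 (one_smul R x))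
  mul_smul r r' φ := Subtype.ext (LinearMap.ext fun x => congrArg φ.1 (by
    rw [actLin_apply, actLin_apply, actLin_apply, mul_comm, mul_smul]))
  smul_zero r := rfl
  smul_add r φ ψ := rfl
  add_smul r r' φ := Subtype.ext (LinearMap.ext fun x =>
    (congrArg φ.1 (add_smul r r' x)).trans (map_add _ _ _))
  zero_smul φ := Subtype.ext (LinearMap.ext fun x =>
    (congrArg φ.1 (zero_smul R x)).trans (map_zero _))

/-- The graded dual of a graded module over a commutative graded algebra. -/
def gdual : GrMod ℛ :=
  letI := X.gdualModule
  { carrier := X.gdualSubmodule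
    tower := ⟨fun c r φ => Subtype.ext (LinearMap.ext fun x => by
      refine (congrArg φ.1 (smul_assoc c r x)).trans (map_smul _ _ _))⟩
    grading := fun n =>
      { carrier := {φ | ∀ m, m ≠ -n → ∀ x ∈ X.grading m, φ.1 x = 0}
        add_mem' := fun {φ ψ} h h' m hm x hx => by
          refine (LinearMap.add_apply φ.1 ψ.1 x).trans ?_
          rw [h m hm x hx, h' m hm x hx, add_zero]
        zero_mem' := fun _ _ _ _ => rfl
        smul_mem' := fun c φ h m hm x hx => by
          refine (LinearMap.smul_apply c φ.1 x).trans ?_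
          rw [h m hm x hx, smul_zero] }
    isInternal := by
      classical
      have hp (n : ℤ) (φ : X →ₗ[k] k) : φ ∘ₗ X.comp n ∈ X.gdualSubmodule :=
        ⟨{n}, fun m hm x hx => by
          rw [Finset.mem_singleton] at hm
          rw [LinearMap.comp_apply, X.comp_ne hx hm, map_zero]⟩
      let p (n : ℤ) : X.gdualSubmodule →ₗ[k] X.gdualSubmodule :=
        { toFun := fun φ => ⟨φ.1 ∘ₗ X.comp (-n), hp (-n) φ.1⟩
          map_add' := fun _ _ => rfl
          map_smul' := fun _ _ => rfl }
      refine isInternal_of_proj (V := X.gdualSubmodule) _ p ?_ ?_ ?_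
      · intro n φ hφ
        refine Subtype.ext (LinearMap.ext fun x => ?_)
        change φ.1 (X.comp (-n) x) = φ.1 x
        induction x using X.induction_homog with
        | h0 => simp
        | ha x y hx hy => simp only [map_add, hx, hy]
        | hh m x hx =>
          by_cases h : m = -n
          · subst h
            rw [X.comp_same hx]
          · rw [X.comp_ne hx h, map_zero, hφ m h x hx]
      · intro n m φ hφ h
        refine Subtype.ext (LinearMap.ext fun x => ?_)
        exact hφ (-n) (by omega) _ (X.comp_mem (-n) x)
      · intro φ
        obtain ⟨s, hs⟩ := φ.2
        refine mem_iSup_of_comp (V := X.gdualSubmodule) _ (s.image fun n => -n) (fun n => p n φ)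
          ?_ ?_
        · intro n m hm x hx
          exact (congrArg φ.1 (X.comp_ne hx hm)).trans (map_zero _)
        · refine Subtype.ext (LinearMap.ext fun x => ?_)
          have h1 : (∑ n ∈ s.image fun n => -n, p n φ).1 x = ∑ n ∈ s, φ.1 (X.comp n x) := by
            rw [Submodule.coe_sum, LinearMap.sum_apply, Finset.sum_image (by
              intro a _ b _ h; exact neg_injective h)]
            simp [p]
          refine h1.trans ?_
          clear h1
          induction x using X.induction_homog with
          | h0 => simp
          | ha x y hx hy => simp only [map_add, Finset.sum_add_distrib, hx, hy]
          | hh m x hx =>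
            by_cases h : m ∈ s
            · rw [Finset.sum_eq_single_of_mem m h fun n _ hn => by
                rw [X.comp_ne hx hn.symm, map_zero], X.comp_same hx]
            · rw [hs m h x hx]
              exact Finset.sum_eq_zero fun n hn => by
                rw [X.comp_ne hx (by rintro rfl; exact h hn), map_zero]
    smul_mem := fun {i j r φ} hr hφ m hm x hx => hφ (i + m) (by omega) _ (X.smul_mem hr hx) }

/-- The evaluation of functionals. -/
def gdualEval (φ : X.gdual) : X →ₗ[k] k := (show X.gdualSubmodule from φ).1

variable {X}

lemma gdual_ext {φ ψ : X.gdual} (h : ∀ x, X.gdualEval φ x = X.gdualEval ψ x) : φ = ψ :=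
  Subtype.ext (LinearMap.ext h)

@[simp] lemma gdualEval_smul (r : R) (φ : X.gdual) (x : X) :
    X.gdualEval (r • φ) x = X.gdualEval φ (r • x) := rfl

@[simp] lemma gdualEval_zero (x : X) : X.gdualEval 0 x = 0 := rfl

lemma exists_gdualEval {φ : X →ₗ[k] k} {s : Finset ℤ} (hs : ∀ n ∉ s, ∀ x ∈ X.grading n, φ x = 0) :
    ∃ ψ : X.gdual, X.gdualEval ψ = φ := ⟨⟨φ, s, hs⟩, rfl⟩

lemma gdual_bdd (φ : X.gdual) : ∃ s : Finset ℤ, ∀ n ∉ s, ∀ x ∈ X.grading n, X.gdualEval φ x = 0 :=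
  (show X.gdualSubmodule from φ).2

/-- Functionals on a quotient extend to functionals. -/
lemma exists_gdual_extension {Y : GrMod ℛ} (f : X →ₗ[R] Y) (n : ℤ)
    (hf : ∀ i, ∀ x ∈ X.grading i, f x ∈ Y.grading (n + i)) (φ : X.gdual)
    (h : ∀ x, f x = 0 → X.gdualEval φ x = 0) :
    ∃ ψ : Y.gdual, ∀ x, Y.gdualEval ψ (f x) = X.gdualEval φ x := by
  classical
  obtain ⟨s, hs⟩ := gdual_bdd φ
  have fk : ∀ (c : k) x, f (c • x) = c • f x := fun c x => by
    rw [← algebraMap_smul R c x, map_smul, algebraMap_smul]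
  let f' : X →ₗ[k] Y := { toFun := f, map_add' := map_add f, map_smul' := fk }
  obtain ⟨χ, hχ⟩ : ∃ χ : Y →ₗ[k] k, ∀ x, χ (f' x) = X.gdualEval φ x := by
    let q := (LinearMap.ker f').liftQ (X.gdualEval φ) fun x hx => h x hx
    let q' := (LinearMap.ker f').liftQ f' le_rfl
    obtain ⟨p, hp⟩ := LinearMap.exists_leftInverse_of_injective q' (Submodule.ker_liftQ_eq_bot' _ _ rfl)
    refine ⟨q ∘ₗ p, fun x => ?_⟩
    have := LinearMap.congr_fun hp (Submodule.Quotient.mk x)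
    exact congrArg q this
  -- The linear extension `χ` may be nonzero in infinitely many degrees; it is cut down to the
  -- translate by `n` of the degrees in `s`, outside of which `φ` vanishes.
  let ψ : Y →ₗ[k] k := Y.desc fun m =>
    if m - n ∈ s then χ ∘ₗ (Y.grading m).subtype else 0
  have hψ {m : ℤ} {y : Y} (hy : y ∈ Y.grading m) : ψ y = if m - n ∈ s then χ y else 0 := by
    refine (Y.desc_apply _ hy).trans ?_
    split_ifs <;> rfl
  obtain ⟨ψ', hψ'⟩ := exists_gdualEval (X := Y) (φ := ψ) (s := s.image fun i => n + i)
    fun m hm y hy => by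
      rw [hψ hy, if_neg]
      intro hms
      exact hm (Finset.mem_image.2 ⟨m - n, hms, by omega⟩)
  refine ⟨ψ', fun x => ?_⟩
  rw [hψ']
  induction x using X.induction_homog with
  | h0 => simp
  | ha x y hx hy => simp only [map_add, hx, hy]
  | hh m x hx =>
    rw [hψ (hf m x hx), add_sub_cancel_left]
    split_ifs with h1
    · exact hχ x
    · exact (hs m h1 x hx).symm

/-- If `yX` misses some homogeneous component of an element, a functional concentrated in that
degree vanishes on `yX` but not identically. It is then a nonzero element of the dual killed by `y`.
-/
lemma gdual_smul_surjective {y : R} {j : ℤ} (hy : y ∈ ℛ j)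
    (h : IsSMulRegular X.gdual y) (x : X) : ∃ x', y • x' = x := by
  let P : Submodule R X := LinearMap.range (LinearMap.lsmul R X y)
  have hP (n : ℤ) (x : X) (hx : x ∈ P) : X.comp n x ∈ P := by
    obtain ⟨z, rfl⟩ := hx
    refine ⟨X.comp (n - j) z, ?_⟩
    have := X.comp_smul hy (n - j) z
    rw [add_sub_cancel] at this
    exact this.symm
  by_contra hx
  have hx' : x ∉ P := fun ⟨z, hz⟩ => hx ⟨z, hz⟩
  obtain ⟨n, hn⟩ : ∃ n, X.comp n x ∉ P := by
    by_contra hall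
    push Not at hall
    obtain ⟨s, hs⟩ := X.exists_sum x
    exact hx' (hs ▸ sum_mem fun n _ => hall n)
  obtain ⟨φ, hφ, hφ'⟩ := Submodule.exists_dual_map_eq_bot_of_notMem
    (p := P.restrictScalars k) (x := X.comp n x) hn inferInstance
  have hφP (z : X) (hz : z ∈ P) : φ z = 0 := by
    have : φ z ∈ Submodule.map φ (P.restrictScalars k) := ⟨z, hz, rfl⟩
    rw [hφ'] at this
    exact this
  obtain ⟨ψ, hψ⟩ := exists_gdualEval (X := X) (φ := φ ∘ₗ X.comp n) (s := {n}) fun m hm z hz => by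
    rw [Finset.mem_singleton] at hm
    rw [LinearMap.comp_apply, X.comp_ne hz hm, map_zero]
  have h0 : y • ψ = y • 0 := gdual_ext fun z => by
    rw [gdualEval_smul, hψ, smul_zero]
    exact hφP _ (hP n _ ⟨z, rfl⟩)
  have h1 := h h0
  apply hφ
  have h2 : X.gdualEval ψ (X.comp n x) = 0 := by rw [h1, gdualEval_zero]
  rw [hψ, LinearMap.comp_apply, X.comp_same (X.comp_mem n x)] at h2
  exact h2

/-- The dual of a homogeneous linear map. -/
def gdualRes {Y : GrMod ℛ} (f : X →ₗ[R] Y) (n : ℤ)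
    (hf : ∀ i, ∀ x ∈ X.grading i, f x ∈ Y.grading (n + i)) : Y.gdual →ₗ[R] X.gdual where
  toFun φ := show X.gdualSubmodule from
    ⟨{ toFun := fun x => Y.gdualEval φ (f x)
       map_add' := fun x y => by rw [map_add, map_add]
       map_smul' := fun c x => by
        rw [← algebraMap_smul R c x, map_smul, algebraMap_smul, map_smul, RingHom.id_apply] }, by
      classical
      obtain ⟨s, hs⟩ := gdual_bdd φ
      refine ⟨s.image fun i => i - n, fun i hi x hx => hs (n + i) (fun h => hi ?_) _ (hf i x hx)⟩
      exact Finset.mem_image.2 ⟨n + i, h, by omega⟩⟩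
  map_add' _ _ := rfl
  map_smul' r φ := gdual_ext fun x => congrArg (Y.gdualEval φ) (map_smul f r x).symm

lemma gdualRes_surjective {Y : GrMod ℛ} (f : X →ₗ[R] Y) (n : ℤ)
    (hf : ∀ i, ∀ x ∈ X.grading i, f x ∈ Y.grading (n + i)) (hi : Function.Injective f) :
    Function.Surjective (gdualRes f n hf) := fun φ => by
  obtain ⟨ψ, hψ⟩ := exists_gdual_extension f n hf φ fun x hx => by
    rw [hi (hx.trans (map_zero f).symm), map_zero]
  exact ⟨ψ, gdual_ext hψ⟩

/-- A functional vanishing on the kernel of multiplication by `y` is divisible by `y`. -/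
lemma exists_smul_eq_of_gdualRes_eq_zero {Y : GrMod ℛ} (f : X →ₗ[R] Y) (n : ℤ)
    (hf : ∀ i, ∀ x ∈ X.grading i, f x ∈ Y.grading (n + i)) {y : R} {j : ℤ} (hy : y ∈ ℛ j)
    (h : ∀ z : Y, y • z = 0 → ∃ x, f x = z) (φ : Y.gdual) (hφ : gdualRes f n hf φ = 0) :
    ∃ ψ, y • ψ = φ := by
  obtain ⟨ψ, hψ⟩ := exists_gdual_extension (LinearMap.lsmul R Y y) j
    (fun i x hx => Y.smul_mem hy hx) φ fun z hz => by
      obtain ⟨x, rfl⟩ := h z hz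
      exact congrArg (fun t : X.gdual => X.gdualEval t x) hφ
  exact ⟨ψ, gdual_ext hψ⟩

lemma gdual_isBddBelow (hX : X.IsBddAbove) : X.gdual.IsBddBelow := by
  obtain ⟨b, hb⟩ := hX
  refine ⟨-b, fun i hi => eq_bot_iff.2 fun φ hφ => gdual_ext fun x => ?_⟩
  induction x using X.induction_homog with
  | h0 => simp
  | ha x y hx hy => rw [map_add, map_add, hx, hy]
  | hh n x hx =>
    by_cases h : n = -i
    · rw [hb n (by omega)] at hx
      rw [(Submodule.mem_bot k).1 hx, map_zero, map_zero]
    · exact hφ n h x hx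

/-! ### The graded Nakayama lemma -/

lemma span_homog {T : Set X} (hT : ∀ x ∈ T, ∃ i, x ∈ X.grading i) (n : ℤ) {x : X}
    (hx : x ∈ Submodule.span R T) : X.comp n x ∈ Submodule.span R T := by
  induction hx using Submodule.span_induction generalizing n with
  | mem x hx =>
    obtain ⟨i, hi⟩ := hT x hx
    by_cases h : i = n
    · subst h
      rw [X.comp_same hi]
      exact Submodule.subset_span hx
    · rw [X.comp_ne hi h]
      exact zero_mem _
  | zero => rw [map_zero]; exact zero_mem _
  | add x y _ _ hx hy => rw [map_add]; exact add_mem (hx n) (hy n)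
  | smul r x _ hx =>
    induction r using DirectSum.Decomposition.inductionOn ℛ with
    | zero => rw [zero_smul, map_zero]; exact zero_mem _
    | add r r' hr hr' => rw [add_smul, map_add]; exact add_mem hr hr'
    | homogeneous r =>
      rename_i i
      have := X.comp_smul r.2 (n - i) x
      rw [add_sub_cancel] at this
      rw [this]
      exact Submodule.smul_mem _ _ (hx _)

/-- Induction on the degree: modulo `N` a homogeneous element is `y` times one of degree smaller by
`j > 0`, and the degrees of `X` are bounded below. -/
lemma eq_top_of_sup_smul (hX : X.IsBddBelow) {y : R} {j : ℤ} (hy : y ∈ ℛ j) (hj : 0 < j)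
    (N : Submodule R X) (hN : ∀ n, ∀ x ∈ N, X.comp n x ∈ N)
    (h : ∀ x, ∃ z ∈ N, ∃ x', x = z + y • x') (x : X) : x ∈ N := by
  obtain ⟨b, hb⟩ := hX
  have key (m : ℕ) : ∀ i < b + m, ∀ x ∈ X.grading i, x ∈ N := by
    induction m with
    | zero =>
      intro i hi x hx
      rw [hb i (by simpa using hi)] at hx
      rw [(Submodule.mem_bot k).1 hx]
      exact zero_mem _
    | succ m ih =>
      intro i hi x hx
      obtain ⟨z, hz, x', hx'⟩ := h x
      have h1 := congrArg (X.comp i) hx'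
      have h2 := X.comp_smul hy (i - j) x'
      rw [add_sub_cancel] at h2
      rw [X.comp_same hx, map_add, h2] at h1
      rw [h1]
      refine add_mem (hN i z hz) (Submodule.smul_mem _ _ (ih (i - j) ?_ _ (X.comp_mem _ _)))
      push_cast at hi
      omega
  obtain ⟨s, hs⟩ := X.exists_sum x
  rw [← hs]
  refine sum_mem fun i _ => key ((i - b).toNat + 1) i (by push_cast; omega) _ (X.comp_mem i x)

/-- Since `ker ρ ⊆ yX`, lifts of generators of the image of `ρ` generate `X` modulo `yX`. Their
homogeneous components span a homogeneous submodule, to which Nakayama's lemma applies. -/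
lemma finite_of_ker_le_smul (hX : X.IsBddBelow) {y : R} {j : ℤ} (hy : y ∈ ℛ j) (hj : 0 < j)
    {Z : Type u} [AddCommGroup Z] [Module R Z] [IsNoetherian R Z] (ρ : X →ₗ[R] Z)
    (h : ∀ x, ρ x = 0 → ∃ x', y • x' = x) : Module.Finite R X := by
  classical
  obtain ⟨T, hT⟩ := IsNoetherian.noetherian (LinearMap.range ρ)
  have hT' : ∀ t ∈ T, ∃ x, ρ x = t := fun t ht => by
    have : t ∈ LinearMap.range ρ := hT ▸ Submodule.subset_span ht
    exact this
  choose! p hp using hT'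
  choose σ hσ using X.exists_sum
  let U : Set X := ⋃ t ∈ T, (fun n => X.comp n (p t)) '' (σ (p t) : Set ℤ)
  have hU : U.Finite := Set.Finite.biUnion T.finite_toSet fun t _ => (Finset.finite_toSet _).image _
  refine ⟨Submodule.fg_def.2 ⟨U, hU, eq_top_iff.2 fun x _ => ?_⟩⟩
  have hpU (t) (ht : t ∈ T) : p t ∈ Submodule.span R U := by
    rw [← hσ (p t)]
    exact sum_mem fun n hn => Submodule.subset_span
      (Set.mem_biUnion ht ⟨n, hn, rfl⟩)
  refine eq_top_of_sup_smul hX hy hj _ (fun n x hx => span_homog (fun x hx => ?_) n hx)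
    (fun x => ?_) x
  · obtain ⟨t, -, n, -, rfl⟩ := Set.mem_iUnion₂.1 hx |>.imp fun t ht => by simpa using ht
    exact ⟨n, X.comp_mem n _⟩
  · have h1 : ρ x ∈ Submodule.map ρ (Submodule.span R U) := by
      have h2 : ρ x ∈ Submodule.span R (T : Set Z) := hT ▸ ⟨x, rfl⟩
      refine Submodule.span_le.2 ?_ h2
      intro t ht
      exact ⟨p t, hpU t ht, hp t ht⟩
    obtain ⟨z, hz, hz'⟩ := h1
    obtain ⟨x', hx'⟩ := h (x - z) (by rw [map_sub, hz', sub_self])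
    exact ⟨z, hz, x', by rw [hx', add_sub_cancel]⟩

end

end Dual

end GrMod

end GradedCM

/-! ### Regular elements and torsion detected by the central subring. -/

namespace GradedCM

/-! ### Regular elements -/

/-- Prime avoidance for a subspace: over an infinite field `V` is not a finite union of proper
subspaces. No associated prime contains `V`, since the element defining that prime would be killed
by `V` and hence be zero. -/
lemma exists_isSMulRegular {k R : Type*} [Field k] [Infinite k] [CommRing R] [Algebra k R]
    [IsNoetherianRing R] {Z : Type*} [AddCommGroup Z] [Module R Z] [Module.Finite R Z]
    (V : Submodule k R) (h : ∀ z : Z, (∀ v ∈ V, v • z = 0) → z = 0) :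
    ∃ v ∈ V, IsSMulRegular Z v := by
  have hfin := associatedPrimes.finite R Z
  let f (p : Ideal R) : Submodule k V := (p.restrictScalars k).comap V.subtype
  have hfin' : (f '' associatedPrimes R Z).Finite := hfin.image f
  have hne : ⊤ ∉ hfin'.toFinset := by
    rw [Set.Finite.mem_toFinset]
    rintro ⟨p, hp, hp'⟩
    obtain ⟨hprime, z, hz⟩ := (isAssociatedPrime_iff (R := R) (M := Z)).1 hp
    have hz0 : z = 0 := h z fun v hv => by
      have hvp : v ∈ p := by
        have : (⟨v, hv⟩ : V) ∈ f p := hp' ▸ Submodule.mem_top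
        exact this
      rw [hz] at hvp
      simpa using Submodule.mem_colon_singleton.1 hvp
    apply hprime.ne_top
    rw [hz, hz0]
    exact eq_top_iff.2 fun r _ => Submodule.mem_colon_singleton.2 (by simp)
  have h1 := Subspace.biUnion_ne_univ_of_top_notMem hne
  obtain ⟨v, hv⟩ := (Set.ne_univ_iff_exists_notMem _).1 h1
  refine ⟨v.1, v.2, ?_⟩
  by_contra hv'
  have h2 : v.1 ∈ ⋃ p ∈ associatedPrimes R Z, (p : Set R) := by
    rw [biUnion_associatedPrimes_eq_compl_regular]
    exact hv'
  obtain ⟨p, hp, hvp⟩ := Set.mem_iUnion₂.1 h2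
  exact hv (Set.mem_iUnion₂.2 ⟨f p, by simpa using ⟨p, hp, rfl⟩, hvp⟩)

namespace GrMod

section

variable {k B : Type u} [Field k] [Ring B] [Algebra k B] {𝒜 : ℤ → Submodule k B}
  [GradedAlgebra 𝒜]

lemma selfComp_same {n : ℤ} {b : B} (hb : b ∈ 𝒜 n) : selfComp 𝒜 n b = b :=
  (self 𝒜).comp_same hb

lemma selfComp_ne {n m : ℤ} {b : B} (hb : b ∈ 𝒜 n) (h : n ≠ m) : selfComp 𝒜 m b = 0 :=
  (self 𝒜).comp_ne hb h

lemma selfComp_mem (n : ℤ) (b : B) : selfComp 𝒜 n b ∈ 𝒜 n := (self 𝒜).comp_mem n b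

lemma comp_smul_of_mem (M : GrMod 𝒜) {e : ℤ} {x : M} (hx : x ∈ M.grading e) (n : ℤ) (b : B) :
    M.comp n (b • x) = selfComp 𝒜 (n - e) b • x := by
  induction b using DirectSum.Decomposition.inductionOn 𝒜 with
  | zero => simp
  | add b b' hb hb' => rw [add_smul, map_add, hb, hb', map_add, add_smul]
  | homogeneous b =>
    rename_i i
    by_cases h : i = n - e
    · rw [← h, selfComp_same b.2]
      have := M.smul_mem b.2 hx
      rw [show i + e = n by omega] at this
      exact M.comp_same this
    · rw [selfComp_ne b.2 h, zero_smul]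
      exact M.comp_ne (M.smul_mem b.2 hx) (by omega)

lemma exists_homog_generators (M : GrMod 𝒜) [Module.Finite B M] :
    ∃ (T : Finset M) (d : M → ℤ), (∀ t ∈ T, t ∈ M.grading (d t)) ∧
      Submodule.span B (T : Set M) = ⊤ := by
  classical
  obtain ⟨T, hT⟩ := Module.Finite.fg_top (R := B) (M := M)
  choose σ hσ using M.exists_sum
  let U : Finset M := T.biUnion fun t => (σ t).image fun n => M.comp n t
  have hU : ∀ t ∈ U, ∃ n, t ∈ M.grading n := fun t ht => by
    obtain ⟨x, -, hx⟩ := Finset.mem_biUnion.1 ht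
    obtain ⟨n, -, rfl⟩ := Finset.mem_image.1 hx
    exact ⟨n, M.comp_mem n x⟩
  choose! d hd using hU
  refine ⟨U, d, hd, eq_top_iff.2 ?_⟩
  rw [← hT, Submodule.span_le]
  intro t ht
  rw [← hσ t]
  exact sum_mem fun n hn => Submodule.subset_span
    (Finset.mem_biUnion.2 ⟨t, ht, Finset.mem_image.2 ⟨n, hn, rfl⟩⟩)

/-- Multiplication by a central homogeneous element, as a map to a shift. -/
def smulHom (M : GrMod 𝒜) {j : ℤ} {c : B} (hc : c ∈ 𝒜 j) (hz : ∀ b, c * b = b * c) :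
    M ⟶ M.shift j where
  lin :=
    { toFun := fun x => (c • x : M)
      map_add' := fun x y => smul_add (A := M) c x y
      map_smul' := fun b x => by
        change c • b • (x : M) = b • c • (x : M)
        rw [← mul_smul, hz, mul_smul] }
  map_mem _ _ hx := M.smul_mem hc hx

/-- The case of `exists_lc_shift` that starts from the unshifted module. `M` and `M.shift 0` have
equal but not identical gradings, so the identification `z` is inserted. -/
theorem exists_lc_smulHom (i : ℕ) (M : GrMod 𝒜) (j : ℤ) :
    ∃ e : lc i (M.shift j) ≅ (lc i M).shift j, ∀ (c : B) (hc : c ∈ 𝒜 j) (hz : ∀ b, c * b = b * c)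
      (x : lc i M), e.hom.lin ((lcMap i (M.smulHom hc hz)).lin x) = c • x := by
  obtain ⟨e, he⟩ := exists_lc_shift i M
  let z (X : GrMod 𝒜) : X ⟶ X.shift 0 := ⟨LinearMap.id, fun n x hx => by
    change x ∈ X.grading (0 + n)
    rwa [zero_add]⟩
  have hzb (X : GrMod 𝒜) : IsIso (z X) :=
    (isoOfBijective (z X) Function.bijective_id).isIso_hom
  let u : lc i M ≅ lc i M := asIso (lcMap i (z M)) ≪≫ e 0 ≪≫ (asIso (z (lc i M))).symm
  refine ⟨e j ≪≫ (shiftFunctor 𝒜 j).mapIso u.symm, fun c hc hz x => ?_⟩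
  have h1 : M.smulHom hc hz = z M ≫ (centralMul (zero_add j) hc hz).app M := rfl
  have h2 : lcMap i (M.smulHom hc hz) ≫ (e j).hom =
      (u.hom ≫ z (lc i M)) ≫ (centralMul (zero_add j) hc hz).app (lc i M) := by
    have h3 : u.hom ≫ z (lc i M) = lcMap i (z M) ≫ (e 0).hom := by
      change (lcMap i (z M) ≫ (e 0).hom ≫ inv (z (lc i M))) ≫ z (lc i M) = _
      simp
    rw [h3, h1]
    refine (congrArg (· ≫ (e j).hom) ((localCohomology 𝒜 i).map_comp _ _)).trans ?_
    rw [Category.assoc]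
    exact (congrArg _ (he 0 j j (zero_add j) c hc hz)).trans (Category.assoc _ _ _).symm
  have h4 : (e j).hom.lin ((lcMap i (M.smulHom hc hz)).lin x) = (c • u.hom.lin x : lc i M) :=
    congrArg (fun t : lc i M ⟶ (lc i M).shift j => t.lin x) h2
  change u.inv.lin ((e j).hom.lin ((lcMap i (M.smulHom hc hz)).lin x)) = c • x
  refine (congrArg u.inv.lin h4).trans ((map_smul u.inv.lin c _).trans ?_)
  exact congrArg (fun t : lc i M ⟶ lc i M => c • t.lin x) u.hom_inv_id

end

/-! ### Restriction to a central graded subalgebra -/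

section

variable {k R B : Type u} [Field k] [CommRing R] [Algebra k R] [Ring B] [Algebra k B]
  [Algebra R B] [IsScalarTower k R B]

/-- The structure map of the `R`-algebra `B` preserves degrees. -/
class _root_.GradedCM.CentralGraded (ℛ : ℤ → Submodule k R) (𝒜 : ℤ → Submodule k B) : Prop where
  map_mem : ∀ {i : ℤ} {r : R}, r ∈ ℛ i → algebraMap R B r ∈ 𝒜 i

variable (ℛ : ℤ → Submodule k R) {𝒜 : ℤ → Submodule k B} [CentralGraded ℛ 𝒜]

/-- Restriction of scalars. -/
def res (M : GrMod 𝒜) : GrMod ℛ :=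
  letI : Module R M := Module.compHom M (algebraMap R B)
  { carrier := M
    tower := ⟨fun c r x => by
      change algebraMap R B (c • r) • (x : M) = c • algebraMap R B r • (x : M)
      rw [← smul_assoc c (algebraMap R B r) (x : M), Algebra.algebraMap_eq_smul_one,
        Algebra.algebraMap_eq_smul_one, smul_assoc c r (1 : B)]⟩
    grading := M.grading
    isInternal := M.isInternal
    smul_mem := fun hr hx => M.smul_mem (CentralGraded.map_mem (ℛ := ℛ) hr) hx }

variable {ℛ}

/-- A morphism as a linear map between the restrictions. -/
def resMap {M N : GrMod 𝒜} (f : M →ₗ[B] N) : M.res ℛ →ₗ[R] N.res ℛ where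
  toFun := f
  map_add' := map_add f
  map_smul' r x := map_smul f (algebraMap R B r) (show M from x)

lemma finite_res [Module.Finite R B] (M : GrMod 𝒜) [hM : Module.Finite B M] :
    Module.Finite R (M.res ℛ) := by
  let _ : Module R M := Module.compHom M (algebraMap R B)
  have : IsScalarTower R B M := ⟨fun r b x => by
    rw [Algebra.smul_def, mul_smul]
    rfl⟩
  exact Module.Finite.trans (R := R) B M

lemma finite_of_res (M : GrMod 𝒜) [hM : Module.Finite R (M.res ℛ)] : Module.Finite B M := by
  let _ : Module R M := Module.compHom M (algebraMap R B)
  have : IsScalarTower R B M := ⟨fun r b x => by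
    rw [Algebra.smul_def, mul_smul]
    rfl⟩
  have : Module.Finite R M := hM
  exact Module.Finite.of_restrictScalars_finite R B M

variable [GradedAlgebra ℛ] [IsNoetherianRing R]

variable (ℛ) in
/-- The ideal generated by a component of sufficiently divisible positive degree contains all
components of sufficiently large degree. -/
lemma exists_le_span_component : ∃ L : ℤ, 0 < L ∧ ∃ m : ℤ, ∀ i, m < i → ∀ x ∈ ℛ i,
    x ∈ Ideal.span (ℛ L : Set R) := by
  classical
  let S : Set R := {x | ∃ i, 0 < i ∧ x ∈ ℛ i}
  obtain ⟨T, hTS, hT⟩ := Submodule.fg_span_iff_fg_span_finset_subset S |>.1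
    (IsNoetherian.noetherian (Ideal.span S))
  have hTS' : ∀ t ∈ T, ∃ i, 0 < i ∧ t ∈ ℛ i := fun t ht => hTS ht
  choose! d hd0 hd using hTS'
  -- `L` is a common multiple of the degrees of the generators, so a power of each generator lies in
  -- degree exactly `L`.
  let L : ℤ := ∏ t ∈ T, d t
  have hL : 0 < L := Finset.prod_pos hd0
  let q := Ideal.span (ℛ L : Set R)
  have hrad : Ideal.span S ≤ q.radical := by
    change Submodule.span R S ≤ _
    rw [hT, Submodule.span_le]
    intro t ht
    obtain ⟨c, hc⟩ : d t ∣ L := Finset.dvd_prod_of_mem d ht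
    have hc0 : 0 < c := by
      rw [hc] at hL
      exact (pos_iff_pos_of_mul_pos hL).1 (hd0 t ht)
    refine ⟨c.toNat, Ideal.subset_span ?_⟩
    have := SetLike.pow_mem_graded c.toNat (hd t ht)
    have h2 : c.toNat • d t = L := by
      rw [nsmul_eq_mul, Int.toNat_of_nonneg hc0.le, hc, mul_comm]
    rwa [h2] at this
  obtain ⟨n, hn⟩ := Ideal.exists_pow_le_of_le_radical_of_fg hrad (IsNoetherian.noetherian _)
  obtain ⟨D, hD⟩ : ∃ D : ℤ, 0 ≤ D ∧ ∀ t ∈ T, d t ≤ D :=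
    ⟨∑ t ∈ T, d t, Finset.sum_nonneg fun t ht => (hd0 t ht).le, fun t ht =>
      Finset.single_le_sum (fun t ht => (hd0 t ht).le) ht⟩
  -- An element of degree above `s * D` is a combination of generators of degree at most `D` with
  -- homogeneous coefficients, and each coefficient still has degree above `(s - 1) * D`.
  have key (s : ℕ) : ∀ i, s * D < i → ∀ x ∈ ℛ i, x ∈ Ideal.span S ^ s := by
    induction s with
    | zero => intro i _ x _; simp
    | succ s ih =>
      intro i hi x hx
      have hi0 : 0 < i := lt_of_le_of_lt (mul_nonneg (by positivity) hD.1) hi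
      have hxS : x ∈ Submodule.span R S := Ideal.subset_span ⟨i, hi0, hx⟩
      rw [hT] at hxS
      obtain ⟨f, -, hf⟩ := Submodule.mem_span_finset.1 hxS
      have h1 : x = ∑ t ∈ T, selfComp ℛ (i - d t) (f t) * t := by
        rw [← selfComp_same hx, ← hf, map_sum]
        exact Finset.sum_congr rfl fun t ht => (self ℛ).comp_smul_of_mem (hd t ht) i (f t)
      rw [h1]
      refine sum_mem fun t ht => ?_
      rw [pow_succ]
      refine Ideal.mul_mem_mul (ih (i - d t) ?_ _ (selfComp_mem _ _)) (Ideal.subset_span (hTS ht))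
      have := hD.2 t ht
      push_cast at hi
      linarith
  exact ⟨L, hL, n * D, fun i hi x hx => hn (key n i hi x hx)⟩

variable [GradedAlgebra 𝒜] [Module.Finite R B]

variable (ℛ 𝒜) in
/-- Elements killed by a component of `R` of sufficiently divisible degree are torsion. -/
theorem exists_isTorsion_of_component : ∃ L : ℤ, 0 < L ∧ ∀ (M : GrMod 𝒜) (x : M),
    (∀ r ∈ ℛ L, algebraMap R B r • x = 0) → x ∈ M.torsionSubmodule := by
  obtain ⟨L, hL, m, hm⟩ := exists_le_span_component ℛ
  have : Module.Finite B (self 𝒜) := inferInstanceAs (Module.Finite B B)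
  have := finite_res (ℛ := ℛ) (self 𝒜)
  obtain ⟨T, d, hd, hT⟩ := exists_homog_generators ((self 𝒜).res ℛ)
  obtain ⟨D, hD⟩ : ∃ D : ℤ, ∀ t ∈ T, d t ≤ D := by
    obtain ⟨D, hD⟩ := (T.image d).exists_le
    exact ⟨-D + 2 * D, fun t ht => by linarith [hD _ (Finset.mem_image_of_mem d ht)]⟩
  refine ⟨L, hL, fun M x hx => ⟨(m + D).toNat + 1, by omega, fun i hi a ha => ?_⟩⟩
  have hq : ∀ r ∈ Ideal.span (ℛ L : Set R), algebraMap R B r • x = 0 := by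
    intro r hr
    induction hr using Submodule.span_induction with
    | mem r hr => exact hx r hr
    | zero => simp
    | add r r' _ _ hr hr' => rw [map_add, add_smul, hr, hr', add_zero]
    | smul s r _ hr => rw [smul_eq_mul, map_mul, mul_smul, hr, smul_zero]
  have haT : (show (self 𝒜).res ℛ from a) ∈ Submodule.span R (T : Set ((self 𝒜).res ℛ)) :=
    hT ▸ Submodule.mem_top
  obtain ⟨f, -, hf⟩ := Submodule.mem_span_finset.1 haT
  -- Taking the component of degree `i` makes the coefficients homogeneous. For large `i` they have
  -- degree above `m`, so they lie in the ideal generated by `ℛ L`, which kills `x`.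
  have h1 : (show (self 𝒜).res ℛ from a) = ∑ t ∈ T, selfComp ℛ (i - d t) (f t) • t := by
    rw [← ((self 𝒜).res ℛ).comp_same (n := i) (x := a) ha, ← hf, map_sum]
    exact Finset.sum_congr rfl fun t ht => ((self 𝒜).res ℛ).comp_smul_of_mem (hd t ht) i (f t)
  let φ : (self 𝒜).res ℛ →+ M :=
    { toFun := fun b => (show B from b) • x
      map_zero' := zero_smul B x
      map_add' := fun b b' => add_smul (R := B) b b' x }
  change φ a = 0
  refine (congrArg φ h1).trans ?_
  rw [map_sum]
  refine Finset.sum_eq_zero fun t ht => ?_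
  change (algebraMap R B (selfComp ℛ (i - d t) (f t)) * (show B from t)) • x = 0
  rw [Algebra.commutes, mul_smul, hq _ (hm (i - d t) ?_ _ (selfComp_mem _ _)), smul_zero]
  have := hD t ht
  push_cast at hi
  omega

end

end GrMod

end GradedCM

namespace GradedCM

namespace GrMod

/-! ### Finitely generated graded modules -/

section

variable {k B : Type u} [Field k] [Ring B] [Algebra k B] {𝒜 : ℤ → Submodule k B}
  [GradedAlgebra 𝒜]

lemma isBddBelow_of_finite (hB : (self 𝒜).IsBddBelow) (M : GrMod 𝒜) [Module.Finite B M] :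
    M.IsBddBelow := by
  obtain ⟨b, hb⟩ := hB
  obtain ⟨T, d, hd, hT⟩ := exists_homog_generators M
  obtain ⟨D, hD⟩ : ∃ D : ℤ, ∀ t ∈ T, D ≤ d t := by
    obtain ⟨D, hD⟩ := (T.image fun t => - d t).exists_le
    exact ⟨-D, fun t ht => by linarith [hD _ (Finset.mem_image_of_mem (fun t => - d t) ht)]⟩
  refine ⟨b + D, fun i hi => eq_bot_iff.2 fun x hx => ?_⟩
  have hxT : x ∈ Submodule.span B (T : Set M) := hT ▸ Submodule.mem_top
  obtain ⟨f, -, hf⟩ := Submodule.mem_span_finset.1 hxT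
  rw [← M.comp_same hx, ← hf, map_sum]
  refine sum_mem fun t ht => ?_
  rw [M.comp_smul_of_mem (hd t ht)]
  have h1 := selfComp_mem (𝒜 := 𝒜) (i - d t) (f t)
  have h2 : 𝒜 (i - d t) = ⊥ := hb _ (by linarith [hD t ht])
  rw [h2, Submodule.mem_bot] at h1
  rw [h1, zero_smul]
  exact zero_mem _

/-- Each homogeneous generator contributes only through the components of `B` between the lower
bound of `B` and the upper bound of `M`, and these are finitely many finite-dimensional spaces. -/
lemma finite_of_isBddAbove (hB : IsCommonlyGraded 𝒜) {M : GrMod 𝒜} [Module.Finite B M]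
    (hM : M.IsBddAbove) : Module.Finite k M := by
  obtain ⟨⟨b, hb⟩, hfin⟩ := hB
  obtain ⟨c, hc⟩ := hM
  obtain ⟨T, d, hd, hT⟩ := exists_homog_generators M
  let W (t : M) (i : ℤ) : Submodule k M :=
    (𝒜 i).map ((LinearMap.toSpanSingleton B M t).restrictScalars k)
  have hWfg (t i) : (W t i).FG :=
    Submodule.FG.map _ ((Module.Finite.iff_fg (N := 𝒜 i)).1 (hfin i))
  have hfg : (⨆ t ∈ T, ⨆ i ∈ Finset.Icc b (c - d t), W t i).FG :=
    Submodule.fg_biSup _ _ fun t _ => Submodule.fg_biSup _ _ fun i _ => hWfg t i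
  refine ⟨?_⟩
  have htop : (⨆ t ∈ T, ⨆ i ∈ Finset.Icc b (c - d t), W t i) = ⊤ := by
    refine eq_top_iff.2 fun x _ => ?_
    have hxT : x ∈ Submodule.span B (T : Set M) := hT ▸ Submodule.mem_top
    obtain ⟨f, -, hf⟩ := Submodule.mem_span_finset.1 hxT
    rw [← hf]
    refine sum_mem fun t ht => ?_
    obtain ⟨s, hs⟩ := exists_sum_selfComp 𝒜 (f t)
    rw [← hs, Finset.sum_smul]
    refine sum_mem fun i _ => ?_
    have hmem := selfComp_mem (𝒜 := 𝒜) i (f t)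
    by_cases hi : i ∈ Finset.Icc b (c - d t)
    · exact Submodule.mem_iSup_of_mem t (Submodule.mem_iSup_of_mem ht
        (Submodule.mem_iSup_of_mem i (Submodule.mem_iSup_of_mem hi ⟨_, hmem, rfl⟩)))
    · rw [Finset.mem_Icc, not_and_or, not_le, not_le] at hi
      rcases hi with hi | hi
      · rw [hb i hi, Submodule.mem_bot] at hmem
        rw [hmem, zero_smul]
        exact zero_mem _
      · have h1 := M.smul_mem hmem (hd t ht)
        rw [hc _ (by linarith), Submodule.mem_bot] at h1
        rw [h1]
        exact zero_mem _
  rw [← htop]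
  exact hfg

lemma lc_shift_isZero {i : ℕ} {M : GrMod 𝒜} (h : IsZero (lc i M)) (n : ℤ) :
    IsZero (lc i (M.shift n)) := by
  obtain ⟨e, -⟩ := exists_lc_shift i M
  rw [(e n).isZero_iff, isZero_iff]
  exact (isZero_iff (lc i M)).1 h

/-- The kernel of the projection to the torsion-free quotient. -/
lemma torsion_shortExact (M : GrMod 𝒜) :
    ∃ w, (ShortComplex.mk (M.subι _ M.torsion_homog) (M.quotπ _ M.torsion_homog) w).ShortExact := by
  refine ⟨?_, shortExact_mk _ _ _ Subtype.val_injective (Submodule.mkQ_surjective _) ?_⟩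
  · ext x
    exact (Submodule.Quotient.mk_eq_zero _).2 x.2
  · exact fun y hy => ⟨⟨y, (Submodule.Quotient.mk_eq_zero _).1 hy⟩, rfl⟩

lemma exact_of_injective {M N : GrMod 𝒜} (f : M ⟶ N) (hf : Function.Injective f.lin) :
    (ShortComplex.mk f (N.quotπ _ (range_homog f)) (quotπ_range f)).ShortExact :=
  shortExact_mk _ _ _ hf (Submodule.mkQ_surjective _)
    fun _ hy => (Submodule.Quotient.mk_eq_zero _).1 hy

lemma exact_of_surjective {M N : GrMod 𝒜} (f : M ⟶ N) (hf : Function.Surjective f.lin) :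
    (ShortComplex.mk (M.subι _ (ker_homog f)) f (subι_ker f)).ShortExact :=
  shortExact_mk _ _ _ Subtype.val_injective hf fun y hy => ⟨⟨y, hy⟩, rfl⟩

lemma prod_shortExact (M N : GrMod 𝒜) :
    ∃ (f : M ⟶ M.prod N) (g : M.prod N ⟶ N) (w : _), (ShortComplex.mk f g w).ShortExact :=
  ⟨⟨LinearMap.inl B M N, fun n _ h => ⟨h, (N.grading n).zero_mem⟩⟩,
    ⟨LinearMap.snd B M N, fun _ _ h => h.2⟩, by ext; rfl,
    shortExact_mk _ _ _ LinearMap.inl_injective (fun y => ⟨(0, y), rfl⟩) fun y hy =>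
      ⟨y.1, Prod.ext rfl (Eq.symm hy)⟩⟩

/-- The torsion submodule is finitely generated, hence bounded above. If high multiples of a
homogeneous `x` are torsion, then in still higher degrees they are zero, so `x` is torsion already.
-/
lemma quot_torsionSubmodule [IsNoetherianRing B] (M : GrMod 𝒜) [Module.Finite B M] :
    IsZero (lc 0 (M.quot _ M.torsion_homog)) := by
  have : Module.Finite B ((torsion 𝒜).obj M) :=
    inferInstanceAs (Module.Finite B M.torsionSubmodule)
  obtain ⟨b, hb⟩ := (isTorsion_torsion M).isBddAbove
  have key (l : ℤ) (x : M) (hx : x ∈ M.grading l)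
      (h : (M.quotπ _ M.torsion_homog).lin x ∈ (M.quot _ M.torsion_homog).torsionSubmodule) :
      x ∈ M.torsionSubmodule := by
    obtain ⟨n, hn, h⟩ := h
    refine ⟨n + (b - l).natAbs + 1, by omega, fun i hi a ha => ?_⟩
    have h1 : a • x ∈ M.torsionSubmodule :=
      (Submodule.Quotient.mk_eq_zero _).1 (h i (by omega) a ha)
    have h2 : (show (torsion 𝒜).obj M from ⟨a • x, h1⟩) ∈ ((torsion 𝒜).obj M).grading (i + l) :=
      M.smul_mem ha hx
    rw [hb _ (by omega)] at h2
    have h3 := (Submodule.mem_bot k).1 h2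
    exact congrArg Subtype.val h3
  rw [lc_zero_isZero_iff]
  intro x hx
  obtain ⟨x, rfl⟩ := Submodule.mkQ_surjective _ x
  refine (Submodule.Quotient.mk_eq_zero _).2 ?_
  obtain ⟨s, hs⟩ := M.exists_sum x
  rw [← hs]
  refine sum_mem fun l _ => key l _ (M.comp_mem l x) ?_
  rw [hom_comp]
  exact torsion_homog _ l _ hx

end

end GrMod

end GradedCM

/-! ### Quotients by central homogeneous elements and finiteness of duals. -/

namespace GradedCM

namespace GrMod

section

variable {k R B : Type u} [Field k] [CommRing R] [Algebra k R] [Ring B] [Algebra k B]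
  [Algebra R B] [IsScalarTower k R B] {ℛ : ℤ → Submodule k R} {𝒜 : ℤ → Submodule k B}
  [CentralGraded ℛ 𝒜] [GradedAlgebra ℛ] [GradedAlgebra 𝒜]

/-- Multiplication by a homogeneous element of `R`. -/
def mulHom (M : GrMod 𝒜) {j : ℤ} {y : R} (hy : y ∈ ℛ j) : M ⟶ M.shift j :=
  M.smulHom (CentralGraded.map_mem hy) (Algebra.commutes y)

lemma mulHom_injective {M : GrMod 𝒜} {j : ℤ} {y : R} (hy : y ∈ ℛ j)
    (h : IsSMulRegular (M.res ℛ) y) : Function.Injective (M.mulHom hy).lin := h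

/-- The cokernel of multiplication by a homogeneous element of `R`. -/
def modBy (M : GrMod 𝒜) {j : ℤ} {y : R} (hy : y ∈ ℛ j) : GrMod 𝒜 :=
  (M.shift j).quot _ (range_homog (M.mulHom hy))

/-- The projection to the cokernel of multiplication. -/
def modByπ (M : GrMod 𝒜) {j : ℤ} {y : R} (hy : y ∈ ℛ j) : M.shift j ⟶ M.modBy hy :=
  (M.shift j).quotπ _ (range_homog (M.mulHom hy))

lemma modByπ_surjective (M : GrMod 𝒜) {j : ℤ} {y : R} (hy : y ∈ ℛ j) :
    Function.Surjective (M.modByπ hy).lin := Submodule.mkQ_surjective _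

lemma mulHom_modByπ (M : GrMod 𝒜) {j : ℤ} {y : R} (hy : y ∈ ℛ j) :
    M.mulHom hy ≫ M.modByπ hy = 0 := quotπ_range _

lemma modBy_shortExact {M : GrMod 𝒜} {j : ℤ} {y : R} (hy : y ∈ ℛ j)
    (h : IsSMulRegular (M.res ℛ) y) :
    (ShortComplex.mk (M.mulHom hy) (M.modByπ hy) (M.mulHom_modByπ hy)).ShortExact :=
  exact_of_injective _ (mulHom_injective hy h)

lemma modByπ_eq_zero {M : GrMod 𝒜} {j : ℤ} {y : R} (hy : y ∈ ℛ j) {x : M}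
    (h : (M.modByπ hy).lin x = 0) : ∃ z : M, algebraMap R B y • z = x :=
  (Submodule.Quotient.mk_eq_zero _).1 h

lemma modBy_finite (M : GrMod 𝒜) [h : Module.Finite B M] {j : ℤ} {y : R} (hy : y ∈ ℛ j) :
    Module.Finite B (M.modBy hy) := by
  have : Module.Finite B (M.shift j) := h
  exact Module.Finite.of_surjective _ (M.modByπ_surjective hy)

/-- The annihilator of a module in `R`. -/
def ann (ℛ : ℤ → Submodule k R) [CentralGraded ℛ 𝒜] (M : GrMod 𝒜) : Ideal R :=
  Module.annihilator R (M.res ℛ)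

lemma mem_ann {M : GrMod 𝒜} {r : R} : r ∈ M.ann ℛ ↔ ∀ x : M, algebraMap R B r • x = 0 :=
  Module.mem_annihilator

lemma ann_le_of_surjective {M N : GrMod 𝒜} (f : M →ₗ[B] N) (hf : Function.Surjective f) :
    M.ann ℛ ≤ N.ann ℛ := fun r hr => mem_ann.2 fun y => by
  obtain ⟨x, rfl⟩ := hf y
  rw [← map_smul, mem_ann.1 hr, map_zero]

lemma ann_le_of_injective {M N : GrMod 𝒜} (f : M →ₗ[B] N) (hf : Function.Injective f) :
    N.ann ℛ ≤ M.ann ℛ := fun r hr => mem_ann.2 fun y => hf (by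
  rw [map_smul, mem_ann.1 hr, map_zero])

lemma mem_ann_modBy (M : GrMod 𝒜) {j : ℤ} {y : R} (hy : y ∈ ℛ j) : y ∈ (M.modBy hy).ann ℛ :=
  mem_ann.2 fun x => by
    obtain ⟨x, rfl⟩ := M.modByπ_surjective hy x
    refine (map_smul (M.modByπ hy).lin (algebraMap R B y) x).symm.trans ?_
    exact congrArg (fun f : M ⟶ M.modBy hy => f.lin x) (M.mulHom_modByπ hy)

lemma ann_le_modBy (M : GrMod 𝒜) {j : ℤ} {y : R} (hy : y ∈ ℛ j) : M.ann ℛ ≤ (M.modBy hy).ann ℛ :=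
  ann_le_of_surjective (M := M.shift j) (M.modByπ hy).lin (M.modByπ_surjective hy)

lemma exists_lc_mulHom (i : ℕ) (M : GrMod 𝒜) (j : ℤ) :
    ∃ e : lc i (M.shift j) ≅ (lc i M).shift j, ∀ (y : R) (hy : y ∈ ℛ j) (x : lc i M),
      e.hom.lin ((lcMap i (M.mulHom hy)).lin x) = algebraMap R B y • x := by
  obtain ⟨e, he⟩ := exists_lc_smulHom i M j
  exact ⟨e, fun y hy x => he _ _ _ x⟩

lemma lin_injective_of_iso {M N : GrMod 𝒜} (e : M ≅ N) : Function.Injective e.hom.lin :=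
  injective_of_mono _

lemma lc_mulHom_eq_zero_iff (i : ℕ) (M : GrMod 𝒜) {j : ℤ} {y : R} (hy : y ∈ ℛ j) (x : lc i M) :
    (lcMap i (M.mulHom hy)).lin x = 0 ↔ algebraMap R B y • x = 0 := by
  obtain ⟨e, he⟩ := exists_lc_mulHom (ℛ := ℛ) i M j
  have h1 := he y hy x
  constructor
  · intro h
    rw [h, map_zero] at h1
    exact h1.symm
  · intro h
    exact lin_injective_of_iso e (h1.trans (h.trans (map_zero e.hom.lin).symm))

lemma lc_mulHom_surjective (i : ℕ) (M : GrMod 𝒜) {j : ℤ} {y : R} (hy : y ∈ ℛ j)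
    (h : ∀ x : lc i M, ∃ x', algebraMap R B y • x' = x) :
    Function.Surjective (lcMap i (M.mulHom hy)).lin := by
  obtain ⟨e, he⟩ := exists_lc_mulHom (ℛ := ℛ) i M j
  intro z
  obtain ⟨x', hx'⟩ := h (e.hom.lin z)
  exact ⟨x', lin_injective_of_iso e ((he y hy x').trans hx')⟩

variable (ℛ 𝒜) in
/-- `L` is positive, and all elements killed by the component of degree `L` of `R` are torsion. -/
def IsTorsionDegree (L : ℤ) : Prop :=
  0 < L ∧ ∀ (M : GrMod 𝒜) (x : M), (∀ r ∈ ℛ L, algebraMap R B r • x = 0) → x ∈ M.torsionSubmodule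

variable [IsNoetherianRing R] [Module.Finite R B] {L : ℤ} (hL : IsTorsionDegree ℛ 𝒜 L)

include hL

/-- Applying prime avoidance to the product `M × Z` yields one element that is regular on both
factors. -/
lemma exists_regular [Infinite k] (M : GrMod 𝒜) [Module.Finite B M] (hM : IsZero (lc 0 M))
    (Z : Type u) [AddCommGroup Z] [Module R Z] [Module.Finite R Z]
    (hZ : ∀ z : Z, (∀ r ∈ ℛ L, r • z = 0) → z = 0) :
    ∃ y ∈ ℛ L, IsSMulRegular (M.res ℛ) y ∧ IsSMulRegular Z y := by
  have := finite_res (ℛ := ℛ) M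
  rw [lc_zero_isZero_iff] at hM
  obtain ⟨y, hy, h⟩ := exists_isSMulRegular (Z := M.res ℛ × Z) (ℛ L) fun z hz =>
    Prod.ext (hM _ (hL.2 M z.1 fun r hr => congrArg Prod.fst (hz r hr)))
      (hZ _ fun r hr => congrArg Prod.snd (hz r hr))
  refine ⟨y, hy, fun a b hab => ?_, fun a b hab => ?_⟩
  · exact congrArg Prod.fst (@h (a, 0) (b, 0) (Prod.ext hab rfl))
  · exact congrArg Prod.snd (@h (0, a) (0, b) (Prod.ext rfl hab))

lemma eq_zero_of_smul_surjective (hB : (self 𝒜).IsBddBelow) (M : GrMod 𝒜) [Module.Finite B M]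
    {y : R} (hy : y ∈ ℛ L) (h : ∀ x : M, ∃ x', algebraMap R B y • x' = x) (x : M) : x = 0 := by
  have h1 : (M.res ℛ).IsBddBelow := isBddBelow_of_finite hB M
  have := eq_top_of_sup_smul (X := M.res ℛ) h1 hy hL.1 ⊥
    (fun n x hx => by rw [(Submodule.mem_bot R).1 hx, map_zero]; exact zero_mem _)
    (fun x => by
      obtain ⟨x', hx'⟩ := h x
      exact ⟨0, zero_mem _, x', (hx'.symm.trans (zero_add _).symm)⟩) x
  have h2 := (Submodule.mem_bot R).1 this
  exact h2

/-- A finitely generated graded module without local cohomology is zero. -/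
theorem isZero_of_lc_isZero [Infinite k] (hB : (self 𝒜).IsBddBelow) (M : GrMod 𝒜)
    [hfin : Module.Finite B M] (h : ∀ i, IsZero (lc i M)) : IsZero M := by
  by_contra hM
  -- A counterexample `K` with maximal annihilator. For `y` regular on `K` the quotient `K/yK` has a
  -- strictly larger annihilator, so it vanishes and Nakayama's lemma gives `K = 0`.
  obtain ⟨I, ⟨K, hI, hKfin, hK, hK0⟩, hmax⟩ := set_has_maximal_iff_noetherian.2
    (inferInstanceAs (IsNoetherian R R))
    {I : Ideal R | ∃ K : GrMod 𝒜, K.ann ℛ = I ∧ Module.Finite B K ∧ (∀ i, IsZero (lc i K)) ∧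
      ¬ IsZero K} ⟨_, M, rfl, hfin, h, hM⟩
  obtain ⟨y, hy, hreg, -⟩ := exists_regular hL K (hK 0) PUnit fun _ _ => rfl
  have hS := modBy_shortExact hy hreg
  have hQ : IsZero (K.modBy hy) := by
    by_contra hQ
    refine hmax _ ⟨K.modBy hy, rfl, K.modBy_finite hy, fun i =>
      lc_isZero₃ hS i (lc_shift_isZero (hK i) L) (hK (i + 1)), hQ⟩ ?_
    rw [← hI]
    refine lt_of_le_of_ne (K.ann_le_modBy hy) fun heq => hK0 ((isZero_iff _).2 fun x => ?_)
    have hy' : y ∈ K.ann ℛ := heq ▸ K.mem_ann_modBy hy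
    exact mulHom_injective hy hreg ((mem_ann.1 hy' x).trans (smul_zero _).symm)
  refine hK0 ((isZero_iff _).2 (eq_zero_of_smul_surjective hL hB K hy fun x => ?_))
  exact modByπ_eq_zero hy ((isZero_iff _).1 hQ _)

omit hL

/-! ### Duals of local cohomology are finitely generated -/

variable (ℛ) in
/-- The graded dual is finitely generated over `R`, and the degrees are bounded above. -/
def IsCofinite (M : GrMod 𝒜) : Prop := Module.Finite R (M.res ℛ).gdual ∧ M.IsBddAbove

lemma IsCofinite.of_injective {M N : GrMod 𝒜} (f : M ⟶ N) (hf : Function.Injective f.lin)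
    (hN : N.IsCofinite ℛ) : M.IsCofinite ℛ := by
  have := hN.1
  exact ⟨Module.Finite.of_surjective _ (gdualRes_surjective (resMap (ℛ := ℛ) f.lin) 0
    (fun i x hx => by rw [zero_add]; exact f.map_mem i x hx) hf), hN.2.of_injective f hf⟩

lemma isCofinite_of_finite {M : GrMod 𝒜} [h : Module.Finite k M] (hM : M.IsBddAbove) :
    M.IsCofinite ℛ := by
  refine ⟨?_, hM⟩
  have : Module.Finite k (M.res ℛ) := h
  have h2 : Module.Finite k (M.res ℛ).gdual :=
    inferInstanceAs (Module.Finite k (M.res ℛ).gdualSubmodule)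
  exact Module.Finite.of_restrictScalars_finite k R _

include hL

/-- Induction on the cohomological degree. For `y` regular on `M`, the connecting map identifies the
elements of `H^{i+1}(M)` killed by `y` with a quotient of `H^i(M/yM)`. Both boundedness and finite
generation of the dual can be checked on this part. -/
theorem isCofinite_lc [Infinite k] (hB : IsCommonlyGraded 𝒜) (i : ℕ) (M : GrMod 𝒜)
    [hfin : Module.Finite B M] : (lc i M).IsCofinite ℛ := by
  have hB' : (self 𝒜).IsBddBelow := hB.1
  have : IsNoetherianRing B := 
    isNoetherianRing_iff.2 (isNoetherian_of_tower R (isNoetherian_of_isNoetherianRing_of_finite R B))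
  have hΓfin : ∀ (M : GrMod 𝒜) [Module.Finite B M], Module.Finite B ((torsion 𝒜).obj M) :=
    fun M _ => inferInstanceAs (Module.Finite B M.torsionSubmodule)
  induction i generalizing M with
  | zero =>
    have := hΓfin M
    have h1 := (isTorsion_torsion M).isBddAbove
    have := finite_of_isBddAbove hB h1
    exact (isCofinite_of_finite h1).of_injective (lcZeroIso.app M).hom (injective_of_mono _)
  | succ i ih =>
    have key (M : GrMod 𝒜) [Module.Finite B M] (hM : IsZero (lc 0 M)) :
        (lc (i + 1) M).IsCofinite ℛ := by
      obtain ⟨y, hy, hreg, -⟩ := exists_regular hL M hM PUnit fun _ _ => rfl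
      have hS := modBy_shortExact hy hreg
      have := M.modBy_finite hy
      obtain ⟨hQ1, hQ2⟩ := ih (M.modBy hy)
      obtain ⟨δ, -, -, hδ1, hδ2⟩ := exists_lc_δ hS i
      have hδ3 (x : lc (i + 1) M) (hx : algebraMap R B y • x = 0) : ∃ z, δ.lin z = x :=
        hδ2 x ((lc_mulHom_eq_zero_iff (i + 1) M hy x).2 hx)
      -- The last nonzero multiple `y ^ N • x` comes from `H^i(M/yM)` and has degree at least that
      -- of `x`, since `L` is positive.
      have hbdd : (lc (i + 1) M).IsBddAbove := by
        obtain ⟨b, hb⟩ := hQ2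
        refine ⟨b, fun n hn => eq_bot_iff.2 fun x hx => ?_⟩
        by_contra hx0
        obtain ⟨p, hp, hpx⟩ := isTorsion_lc (i + 1) M x
        have hy' (N : ℕ) : algebraMap R B y ^ N ∈ 𝒜 (N * L) := by
          have := SetLike.pow_mem_graded N (CentralGraded.map_mem (𝒜 := 𝒜) hy)
          rwa [nsmul_eq_mul] at this
        have hex : ∃ N : ℕ, algebraMap R B y ^ N • x = 0 := by
          refine ⟨p, hpx _ ?_ _ (hy' p)⟩
          have := hL.1
          nlinarith
        classical
        have h1 := Nat.find_spec hex
        have h2 : Nat.find hex ≠ 0 := fun h => hx0 (by rw [h, pow_zero, one_smul] at h1; exact h1)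
        obtain ⟨N, hN⟩ := Nat.exists_eq_succ_of_ne_zero h2
        rw [hN, pow_succ', mul_smul] at h1
        refine Nat.find_min hex (m := N) (by omega) ?_
        have h3 := (lc (i + 1) M).smul_mem (hy' N) hx
        obtain ⟨z, hz⟩ := hδ3 _ h1
        have h4 : δ.lin ((lc i (M.modBy hy)).comp (N * L + n) z) = algebraMap R B y ^ N • x := by
          rw [hom_comp, hz]
          exact comp_same _ h3
        have h5 := (lc i (M.modBy hy)).comp_mem (N * L + n) z
        have h6 : b < N * L + n := by
          have := hL.1
          have : 0 ≤ N * L := by positivity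
          linarith
        rw [hb _ h6, Submodule.mem_bot] at h5
        rw [← h4, h5, map_zero]
      refine ⟨?_, hbdd⟩
      have hδm : ∀ i', ∀ x ∈ ((lc i (M.modBy hy)).res ℛ).grading i',
          resMap (ℛ := ℛ) δ.lin x ∈ ((lc (i + 1) M).res ℛ).grading (0 + i') := fun i' x hx => by
        rw [zero_add]
        exact δ.map_mem i' x hx
      -- Dually, a functional that vanishes on the elements killed by `y` is divisible by `y`, so
      -- Nakayama's lemma for the dual applies.
      exact finite_of_ker_le_smul (gdual_isBddBelow hbdd) hy hL.1
        (gdualRes (resMap (ℛ := ℛ) δ.lin) 0 hδm)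
        fun φ hφ => exists_smul_eq_of_gdualRes_eq_zero (resMap (ℛ := ℛ) δ.lin) 0 hδm hy hδ3 φ hφ
    -- The torsion submodule has no local cohomology in positive degrees, so `H^{i+1}` of `M` embeds
    -- in that of the torsion-free quotient treated by `key`.
    have hΓ := hΓfin M
    obtain ⟨w, hS⟩ := torsion_shortExact M
    have h1 := lc_isZero_of_isBddAbove hB' i (isTorsion_torsion M).isBddAbove
    have : Module.Finite B (M.quot _ M.torsion_homog) :=
      Module.Finite.of_surjective (M.quotπ _ M.torsion_homog).lin (Submodule.mkQ_surjective _)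
    exact (key _ M.quot_torsionSubmodule).of_injective (lcMap (i + 1) _)
      (lcMap_injective hS (i + 1) h1)

end

end GrMod

end GradedCM

/-! ### Top local cohomology and the regular sequence on its dual. -/

namespace GradedCM

namespace GrMod

section

variable {k R B : Type u} [Field k] [CommRing R] [Algebra k R] [Ring B] [Algebra k B]
  [Algebra R B] [IsScalarTower k R B] {ℛ : ℤ → Submodule k R} {𝒜 : ℤ → Submodule k B}
  [CentralGraded ℛ 𝒜] [GradedAlgebra ℛ] [GradedAlgebra 𝒜]

/-! ### Vanishing of local cohomology on modules killed by an ideal -/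

variable (ℛ 𝒜) in
/-- The `i`-th local cohomology vanishes on finitely generated modules killed by `I`. -/
def LcVanishes (I : Ideal R) (i : ℕ) : Prop :=
  ∀ M : GrMod 𝒜, Module.Finite B M → I ≤ M.ann ℛ → IsZero (lc i M)

variable (ℛ) in
/-- All finitely generated modules killed by `I` are covered by shifts of `P`. -/
def IsGenerator (I : Ideal R) (P : GrMod 𝒜) : Prop :=
  ∀ (M : GrMod 𝒜), I ≤ M.ann ℛ → ∀ (n : ℤ), ∀ x ∈ M.grading n,
    ∃ (s : ℤ) (f : P.shift s ⟶ M), x ∈ LinearMap.range f.lin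

lemma LcVanishes.mono {I J : Ideal R} (h : I ≤ J) {i : ℕ} (hI : LcVanishes ℛ 𝒜 I i) :
    LcVanishes ℛ 𝒜 J i := fun M hM hJ => hI M hM (h.trans hJ)

variable [IsNoetherianRing B]

/-- Local cohomology in the top degree is right exact. -/
lemma LcVanishes.surjective {I : Ideal R} {i : ℕ} (h : LcVanishes ℛ 𝒜 I (i + 1)) {M N : GrMod 𝒜}
    [Module.Finite B M] (hI : I ≤ M.ann ℛ) (f : M ⟶ N) (hf : Function.Surjective f.lin) :
    Function.Surjective (lcMap i f).lin :=
  lcMap_surjective (exact_of_surjective f hf) i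
    (h _ (inferInstanceAs (Module.Finite B (LinearMap.ker f.lin)))
      (hI.trans (ann_le_of_injective (N := M) (LinearMap.ker f.lin).subtype
        Subtype.val_injective)))

/-- The map `f` need not be injective. It surjects onto `ker g`, and this surjection remains one on
top local cohomology. -/
lemma LcVanishes.exact {I : Ideal R} {i : ℕ} (h : LcVanishes ℛ 𝒜 I (i + 1)) {M N Q : GrMod 𝒜}
    [Module.Finite B M] (hI : I ≤ M.ann ℛ) (f : M ⟶ N) (g : N ⟶ Q) (w : f ≫ g = 0)
    (hg : Function.Surjective g.lin) (hfg : ∀ y, g.lin y = 0 → ∃ x, f.lin x = y)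
    (y : lc i N) (hy : (lcMap i g).lin y = 0) : ∃ x, (lcMap i f).lin x = y := by
  let K := N.sub _ (ker_homog g)
  let f' : M ⟶ K := codRestrict f _ (ker_homog g) fun x =>
    congrArg (fun t : M ⟶ Q => t.lin x) w
  have hf' : Function.Surjective f'.lin := fun y => by
    obtain ⟨x, hx⟩ := hfg y.1 y.2
    exact ⟨x, Subtype.ext hx⟩
  obtain ⟨z, hz⟩ := lc_exact₂ (exact_of_surjective g hg) i y hy
  obtain ⟨x, hx⟩ := h.surjective hI f' hf' z
  refine ⟨x, ?_⟩
  have h1 : lcMap i f = lcMap i f' ≫ lcMap i (N.subι _ (ker_homog g)) :=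
    (localCohomology 𝒜 i).map_comp f' (N.subι _ (ker_homog g))
  rw [h1, ← hz, ← hx]
  rfl

/-- Top local cohomology vanishes if it vanishes on a generator. -/
lemma LcVanishes.of_generator {I : Ideal R} {i : ℕ} (h : LcVanishes ℛ 𝒜 I (i + 1)) {P : GrMod 𝒜}
    (hPI : I ≤ P.ann ℛ) (hPfin : Module.Finite B P) (hP : IsGenerator ℛ I P)
    (hP0 : IsZero (lc i P)) : LcVanishes ℛ 𝒜 I i := by
  intro M hM hI
  -- A maximal homogeneous submodule with vanishing cohomology must be all of `M`: otherwise the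
  -- image of a shift of `P` could be added. The sum is a quotient of a direct sum on which `H^i`
  -- vanishes, and `H^i` is right exact.
  let T : Set (Submodule B M) :=
    {N | ∃ hN : ∀ n, ∀ x ∈ N, M.comp n x ∈ N, IsZero (lc i (M.sub N hN))}
  have hT : T.Nonempty := by
    refine ⟨⊥, fun n x hx => by rw [(Submodule.mem_bot B).1 hx, map_zero]; exact zero_mem _, ?_⟩
    refine (localCohomology 𝒜 i).map_isZero ((isZero_iff _).2 fun x => ?_)
    exact Subtype.ext ((Submodule.mem_bot B).1 x.2)
  have hnoeth : IsNoetherian B M := isNoetherian_of_isNoetherianRing_of_finite B M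
  obtain ⟨N, ⟨hN, hN0⟩, hmax⟩ := set_has_maximal_iff_noetherian.2 hnoeth T hT
  have htop (x : M) : x ∈ N := by
    by_contra hx
    obtain ⟨n, hn⟩ : ∃ n, M.comp n x ∉ N := by
      by_contra hall
      push Not at hall
      obtain ⟨s, hs⟩ := M.exists_sum x
      exact hx (hs ▸ sum_mem fun n _ => hall n)
    obtain ⟨s, f, hf⟩ := hP M hI n _ (M.comp_mem n x)
    let g : (M.sub N hN).prod (P.shift s) ⟶ M :=
      ⟨(M.subι N hN).lin.coprod f.lin, fun n x hx =>
        add_mem ((M.subι N hN).map_mem n _ hx.1) (f.map_mem n _ hx.2)⟩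
    have hNg : N ≤ LinearMap.range g.lin := fun z hz =>
      ⟨(⟨z, hz⟩, 0), by
        refine (LinearMap.coprod_apply _ _ _).trans ?_
        rw [map_zero, add_zero]
        rfl⟩
    have hfg : LinearMap.range f.lin ≤ LinearMap.range g.lin := by
      rintro _ ⟨z, rfl⟩
      refine ⟨(0, z), ?_⟩
      refine (LinearMap.coprod_apply _ _ _).trans ?_
      rw [map_zero, zero_add]
    refine hmax (LinearMap.range g.lin) ⟨range_homog g, ?_⟩ (lt_of_le_of_ne hNg fun h =>
      hn (h ▸ hfg hf))
    have hfin1 : Module.Finite B (M.sub N hN) := inferInstanceAs (Module.Finite B N)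
    have hfin2 : Module.Finite B (P.shift s) := hPfin
    have hfin : Module.Finite B ((M.sub N hN).prod (P.shift s)) :=
      inferInstanceAs (Module.Finite B (M.sub N hN × P.shift s))
    have hI' : I ≤ ((M.sub N hN).prod (P.shift s)).ann ℛ := fun r hr => mem_ann.2 fun z =>
      Prod.ext (Subtype.ext (mem_ann.1 (hI hr) _)) (mem_ann.1 (hPI hr) _)
    have hz : IsZero (lc i ((M.sub N hN).prod (P.shift s))) := by
      obtain ⟨_, _, w, hS⟩ := prod_shortExact (M.sub N hN) (P.shift s)
      exact lc_isZero₂ hS i hN0 (lc_shift_isZero hP0 s)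
    let g' := codRestrict g _ (range_homog g) fun x => ⟨x, rfl⟩
    have hg' : Function.Surjective g'.lin := by
      rintro ⟨_, x, rfl⟩
      exact ⟨x, rfl⟩
    have h1 := h.surjective hI' g' hg'
    rw [isZero_iff] at hz ⊢
    intro z
    obtain ⟨t, rfl⟩ := h1 z
    rw [hz t, map_zero]
  have hb : Function.Bijective (M.subι N hN).lin :=
    ⟨Subtype.val_injective, fun x => ⟨⟨x, htop x⟩, rfl⟩⟩
  exact ((localCohomology 𝒜 i).mapIso (isoOfBijective _ hb)).isZero_iff.1 hN0

/-- A map from a shift of `P` to a module killed by `y` factors through `P/yP`. The shift is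
corrected by `j` because `modBy` is a quotient of `P.shift j`. -/
lemma IsGenerator.modBy {I : Ideal R} {P : GrMod 𝒜} (hP : IsGenerator ℛ I P) {j : ℤ} {y : R}
    (hy : y ∈ ℛ j) : IsGenerator ℛ (I ⊔ Ideal.span {y}) (P.modBy hy) := by
  intro M hM n x hx
  obtain ⟨s, f, z, hz⟩ := hP M (le_sup_left.trans hM) n x hx
  have hyM : y ∈ M.ann ℛ := hM (Ideal.mem_sup_right (Ideal.subset_span rfl))
  let l : P →ₗ[B] M := f.lin
  let q : P.modBy hy →ₗ[B] M := Submodule.liftQ (LinearMap.range (P.mulHom hy).lin) l (by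
    rintro _ ⟨p, rfl⟩
    exact (map_smul l (algebraMap R B y) p).trans (mem_ann.1 hyM _))
  refine ⟨s - j, ⟨q, ?_⟩, (P.modByπ hy).lin z, hz⟩
  rintro i _ ⟨p, hp, rfl⟩
  refine f.map_mem i p ?_
  have h1 : p ∈ P.grading (j + (s - j + i)) := hp
  rwa [show j + (s - j + i) = s + i by omega] at h1

/-! ### Regular sequences on the dual of top local cohomology -/

variable [IsNoetherianRing R] [Module.Finite R B] {L : ℤ} (hL : IsTorsionDegree ℛ 𝒜 L)

include hL

/-- The dual of top local cohomology in positive degree has no socle. -/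
lemma LcVanishes.eq_zero_of_smul {I : Ideal R} {e : ℕ} (h : LcVanishes ℛ 𝒜 I (e + 2))
    (hB : (self 𝒜).IsBddBelow) (P : GrMod 𝒜) (hPfin : Module.Finite B P) (hPI : I ≤ P.ann ℛ)
    (φ : ((lc (e + 1) P).res ℛ).gdual) (hφ : ∀ r ∈ ℛ L, r • φ = 0) : φ = 0 := by
  by_contra hφ0
  -- Again a counterexample with maximal annihilator. If `ℛ L` kills `K`, then `K` is torsion and
  -- has no cohomology in positive degree. Otherwise some `v ∈ ℛ L` does not kill `K`, and the socle
  -- element passes to `K/vK`.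
  obtain ⟨J, ⟨K, hJ, hKfin, hKI, χ, hχ, hχ0⟩, hmax⟩ := set_has_maximal_iff_noetherian.2
    (inferInstanceAs (IsNoetherian R R))
    {J : Ideal R | ∃ K : GrMod 𝒜, K.ann ℛ = J ∧ Module.Finite B K ∧ I ≤ K.ann ℛ ∧
      ∃ φ : ((lc (e + 1) K).res ℛ).gdual, (∀ r ∈ ℛ L, r • φ = 0) ∧ φ ≠ 0}
    ⟨_, P, rfl, hPfin, hPI, φ, hφ, hφ0⟩
  by_cases hv : ∀ v ∈ ℛ L, v ∈ K.ann ℛ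
  · have h1 : K.IsTorsion := fun x => hL.2 K x fun r hr => mem_ann.1 (hv r hr) x
    have h2 := (isZero_iff _).1 (lc_isZero_of_isBddAbove hB e h1.isBddAbove)
    refine hχ0 (gdual_ext fun x => ?_)
    rw [show x = 0 from h2 x, map_zero, map_zero]
  push Not at hv
  obtain ⟨v, hv, hvK⟩ := hv
  have hQfin := K.modBy_finite hv
  have hQI := hKI.trans (K.ann_le_modBy hv)
  have hKshift : Module.Finite B (K.shift L) := hKfin
  have hQs := h.surjective (M := K.shift L) hKI (K.modByπ hv) (K.modByπ_surjective hv)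
  have hQe := h.exact hKI (K.mulHom hv) (K.modByπ hv) (K.mulHom_modByπ hv)
    (K.modByπ_surjective hv) fun x hx => modByπ_eq_zero hv hx
  obtain ⟨e', he'⟩ := exists_lc_mulHom (ℛ := ℛ) (e + 1) K L
  let X := lc (e + 1) K
  let Z := lc (e + 1) (K.modBy hv)
  let p' : X.shift L ⟶ Z := e'.inv ≫ lcMap (e + 1) (K.modByπ hv)
  let p : X →ₗ[B] Z := p'.lin
  have hps : Function.Surjective p := by
    intro z
    obtain ⟨t, rfl⟩ := hQs z
    refine ⟨e'.hom.lin t, ?_⟩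
    exact congrArg (lcMap (e + 1) (K.modByπ hv)).lin
      (congrArg (fun f : lc (e + 1) (K.shift L) ⟶ lc (e + 1) (K.shift L) => f.lin t)
        e'.hom_inv_id)
  have hpk (x : X) (hx : p x = 0) : ∃ x', algebraMap R B v • x' = x := by
    obtain ⟨x', hx'⟩ := hQe _ hx
    refine ⟨x', (he' v hv x').symm.trans ?_⟩
    rw [hx']
    exact congrArg (fun f : X.shift L ⟶ X.shift L => f.lin x) e'.inv_hom_id
  -- By right exactness `H^{e+1}(K/vK)` is the cokernel of `v` on `H^{e+1}(K)`. As `v • χ = 0`, the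
  -- functional `χ` descends to it; the degree `-L` undoes the shift in `modBy`.
  obtain ⟨ψ, hψ⟩ := exists_gdual_extension (X := X.res ℛ) (Y := Z.res ℛ) (resMap p) (-L)
    (fun i x hx => p'.map_mem (-L + i) x (by
      change x ∈ X.grading (L + (-L + i))
      rw [add_neg_cancel_left]
      exact hx)) χ (fun x hx => by
        obtain ⟨x', rfl⟩ := hpk x hx
        exact congrArg (fun φ : (X.res ℛ).gdual => gdualEval _ φ x') (hχ v hv))
  refine hmax _ ⟨K.modBy hv, rfl, hQfin, hQI, ψ, fun r hr => gdual_ext fun z => ?_, fun h0 => ?_⟩ ?_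
  · obtain ⟨x, rfl⟩ := hps z
    refine Eq.trans ?_ (congrArg (fun φ : (X.res ℛ).gdual => gdualEval _ φ x) (hχ r hr))
    refine Eq.trans ?_ (hψ (r • (show X.res ℛ from x)))
    exact congrArg (gdualEval _ ψ) (map_smul (resMap (ℛ := ℛ) p) r (show X.res ℛ from x)).symm
  · refine hχ0 (gdual_ext fun x => ?_)
    rw [← hψ x, h0]
    rfl
  · rw [← hJ]
    exact lt_of_le_of_ne (K.ann_le_modBy hv) fun heq => hvK (heq ▸ K.mem_ann_modBy hv)

open scoped Pointwise in
/-- A regular sequence on the dual of the top local cohomology of a generator. -/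
theorem exists_isWeaklyRegular [Infinite k] (hB : IsCommonlyGraded 𝒜) (e : ℕ) (I : Ideal R)
    (h : ∀ i, e < i → LcVanishes ℛ 𝒜 I i) (P : GrMod 𝒜) (hPfin : Module.Finite B P)
    (hPI : I ≤ P.ann ℛ) (hP : IsGenerator ℛ I P) (h0 : ∀ i < e, IsZero (lc i P)) :
    ∃ ys : List R, ys.length = e ∧ (∀ y ∈ ys, y ∈ ℛ L) ∧
      RingTheory.Sequence.IsWeaklyRegular ((lc e P).res ℛ).gdual ys := by
  have hB' : (self 𝒜).IsBddBelow := hB.1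
  induction e generalizing I P with
  | zero => exact ⟨[], rfl, by simp, RingTheory.Sequence.IsWeaklyRegular.nil R _⟩
  | succ e ih =>
    have := (isCofinite_lc (ℛ := ℛ) hL hB (e + 1) P).1
    -- The dual is finitely generated over `R` and has no socle, so `y` can be regular on it as well
    -- as on `P`.
    obtain ⟨y, hy, hreg, hregD⟩ := exists_regular hL P (h0 0 e.succ_pos)
      ((lc (e + 1) P).res ℛ).gdual fun φ hφ =>
        (h (e + 2) (by omega)).eq_zero_of_smul hL hB' P hPfin hPI φ hφ
    have hS := modBy_shortExact hy hreg
    have hQfin := P.modBy_finite hy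
    have hQI : I ⊔ Ideal.span {y} ≤ (P.modBy hy).ann ℛ :=
      sup_le (hPI.trans (P.ann_le_modBy hy)) ((Ideal.span_singleton_le_iff_mem _).2
        (P.mem_ann_modBy hy))
    have hQ := hP.modBy hy
    have hsurj := lc_mulHom_surjective (e + 1) P hy fun x =>
      gdual_smul_surjective (X := (lc (e + 1) P).res ℛ) hy hregD x
    have hQtop : IsZero (lc (e + 1) (P.modBy hy)) := by
      have h1 := lcMap_surjective hS (e + 1) (h (e + 2) (by omega) P hPfin hPI)
      rw [isZero_iff]
      intro z
      obtain ⟨t, rfl⟩ := h1 z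
      obtain ⟨x, rfl⟩ := hsurj t
      refine (congrArg (fun f : lc (e + 1) P ⟶ lc (e + 1) (P.modBy hy) => f.lin x)
        ((localCohomology 𝒜 (e + 1)).map_comp (P.mulHom hy) (P.modByπ hy)).symm).trans ?_
      rw [P.mulHom_modByπ hy, Functor.map_zero]
      rfl
    -- Since `y` acts surjectively on `H^{e+1}(P)`, the group `H^{e+1}(P/yP)` vanishes. As `P/yP`
    -- generates the modules killed by `I` and `y`, the top degree drops from `e + 1` to `e` for all
    -- of them.
    have hvan : ∀ i, e < i → LcVanishes ℛ 𝒜 (I ⊔ Ideal.span {y}) i := fun i hi => by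
      by_cases hie : i = e + 1
      · subst hie
        exact ((h (e + 2) (by omega)).mono le_sup_left).of_generator hQI hQfin hQ hQtop
      · exact (h i (by omega)).mono le_sup_left
    obtain ⟨ys, hlen, hys, hreg'⟩ := ih _ hvan (P.modBy hy) hQfin hQI hQ fun i hi =>
      lc_isZero₃ hS i (lc_shift_isZero (h0 i (by omega)) L) (h0 (i + 1) (by omega))
    refine ⟨y :: ys, by simp [hlen], by simpa using ⟨hy, hys⟩, ?_⟩
    rw [RingTheory.Sequence.isWeaklyRegular_cons_iff]
    refine ⟨hregD, ?_⟩
    obtain ⟨δ, hδ0, hδi, hδ1, hδ2⟩ := exists_lc_δ hS e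
    have hδinj : Function.Injective δ.lin := by
      rw [← LinearMap.ker_eq_bot, eq_bot_iff]
      intro z hz
      obtain ⟨x, rfl⟩ := hδi z hz
      rw [(isZero_iff _).1 (lc_shift_isZero (h0 e (by omega)) L) x, map_zero]
      exact zero_mem _
    have hδm : ∀ i', ∀ x ∈ ((lc e (P.modBy hy)).res ℛ).grading i',
        resMap (ℛ := ℛ) δ.lin x ∈ ((lc (e + 1) P).res ℛ).grading (0 + i') := fun i' x hx => by
      rw [zero_add]
      exact δ.map_mem i' x hx
    let ρ := gdualRes (resMap (ℛ := ℛ) δ.lin) 0 hδm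
    have hρ : Function.Surjective ρ := gdualRes_surjective _ 0 hδm hδinj
    -- The connecting map embeds `H^e(P/yP)` in `H^{e+1}(P)` as the kernel of `y`. Dually, the
    -- quotient of the dual by `y` is the dual of `H^e(P/yP)`, on which the induction provides the
    -- rest of the sequence.
    have hker : y • (⊤ : Submodule R ((lc (e + 1) P).res ℛ).gdual) = LinearMap.ker ρ := by
      ext φ
      rw [Submodule.mem_smul_pointwise_iff_exists]
      constructor
      · rintro ⟨ψ, -, rfl⟩
        refine gdual_ext fun x => ?_
        have h1 := (lc_mulHom_eq_zero_iff (e + 1) P hy _).1 (hδ1 x)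
        refine (congrArg (gdualEval _ ψ) h1).trans (map_zero _)
      · intro hφ
        obtain ⟨ψ, hψ⟩ := exists_smul_eq_of_gdualRes_eq_zero (resMap (ℛ := ℛ) δ.lin) 0 hδm hy
          (fun x hx => hδ2 x ((lc_mulHom_eq_zero_iff (e + 1) P hy x).2 hx)) φ hφ
        exact ⟨ψ, trivial, hψ⟩
    exact (LinearEquiv.isWeaklyRegular_congr
      ((Submodule.quotEquivOfEq _ _ hker).trans (ρ.quotKerEquivOfSurjective hρ)) ys).2 hreg'

end

end GrMod

end GradedCM

namespace GradedCM

namespace GrMod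

section

variable {k R B : Type u} [Field k] [CommRing R] [Algebra k R] [Ring B] [Algebra k B]
  [Algebra R B] [IsScalarTower k R B] {ℛ : ℤ → Submodule k R} {𝒜 : ℤ → Submodule k B}
  [CentralGraded ℛ 𝒜] [GradedAlgebra ℛ] [GradedAlgebra 𝒜]

/-! ### Depth and regular sequences -/

/-- A high power of `y` has degree large enough to kill `x`, and `y` can be cancelled one factor at
a time. -/
lemma eq_zero_of_isTorsion {M : GrMod 𝒜} (hM : M.IsTorsion) {L : ℤ} (hL : 0 < L) {y : R}
    (hy : y ∈ ℛ L) (h : ∀ x : M, algebraMap R B y • x = 0 → x = 0) (x : M) : x = 0 := by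
  obtain ⟨p, hp, hpx⟩ := hM x
  have hy' : algebraMap R B y ^ p ∈ 𝒜 (p * L) := by
    have := SetLike.pow_mem_graded p (CentralGraded.map_mem (𝒜 := 𝒜) hy)
    rwa [nsmul_eq_mul] at this
  have hpow (N : ℕ) : algebraMap R B y ^ N • x = 0 → x = 0 := by
    induction N with
    | zero => intro h; rwa [pow_zero, one_smul] at h
    | succ N ih =>
      intro hN
      rw [pow_succ', mul_smul] at hN
      exact ih (h _ hN)
  exact hpow p (hpx _ (by nlinarith) _ hy')

open scoped Pointwise in
/-- Local cohomology vanishes below the length of a regular sequence. -/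
theorem lc_isZero_of_isWeaklyRegular {L : ℤ} (hL : 0 < L) (ys : List R) (hys : ∀ y ∈ ys, y ∈ ℛ L)
    (M : GrMod 𝒜) (h : RingTheory.Sequence.IsWeaklyRegular (M.res ℛ) ys) (i : ℕ)
    (hi : i < ys.length) : IsZero (lc i M) := by
  induction ys generalizing M i with
  | nil => simp at hi
  | cons y ys ih =>
    rw [RingTheory.Sequence.isWeaklyRegular_cons_iff] at h
    have hy := hys y (by simp)
    have hS := modBy_shortExact hy h.1
    let q : M.res ℛ →ₗ[R] (M.modBy hy).res ℛ :=
      resMap (M := M.shift L) (ℛ := ℛ) (M.modByπ hy).lin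
    have hq : Function.Surjective q := M.modByπ_surjective hy
    have hker : y • (⊤ : Submodule R (M.res ℛ)) = LinearMap.ker q := by
      ext x
      rw [Submodule.mem_smul_pointwise_iff_exists]
      constructor
      · rintro ⟨z, -, rfl⟩
        exact congrArg (fun f : M ⟶ M.modBy hy => f.lin z) (M.mulHom_modByπ hy)
      · intro hx
        obtain ⟨z, hz⟩ := modByπ_eq_zero hy hx
        exact ⟨z, trivial, hz⟩
    have hQ : RingTheory.Sequence.IsWeaklyRegular ((M.modBy hy).res ℛ) ys :=
      (LinearEquiv.isWeaklyRegular_congr ((Submodule.quotEquivOfEq _ _ hker).trans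
        (q.quotKerEquivOfSurjective hq)) ys).1 h.2
    rw [isZero_iff]
    refine eq_zero_of_isTorsion (isTorsion_lc i M) hL hy fun x hx => ?_
    have hx' := (lc_mulHom_eq_zero_iff i M hy x).2 hx
    -- The kernel of `y` on `H^{i+1}(M)` comes from `H^i(M/yM)`, which vanishes by induction; as
    -- local cohomology is torsion, injectivity of `y` forces it to be zero.
    have hinj : Function.Injective (lcMap i (M.mulHom hy)).lin := by
      cases i with
      | zero => exact lc_zero_injective _ (mulHom_injective hy h.1)
      | succ i =>
        refine lcMap_injective_f hS i (ih (fun z hz => hys z (by simp [hz])) _ hQ i ?_)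
        simpa using hi
    exact hinj (hx'.trans (map_zero _).symm)

end

/-! ### The dualizing module -/

section

variable {k R B : Type u} [Field k] [CommRing R] [Algebra k R] [Ring B] [Algebra k B]
  [Algebra R B] [IsScalarTower k R B] (ℛ : ℤ → Submodule k R) (𝒜 : ℤ → Submodule k B)
  [CentralGraded ℛ 𝒜] [GradedAlgebra ℛ] [GradedAlgebra 𝒜]

/-- As an `R`-module, `ω` is the graded dual of local cohomology. -/
theorem exists_omega_equiv (d : ℕ) :
    Nonempty (((lc d (self 𝒜)).res ℛ).gdual ≃ₗ[R] (omega 𝒜 d).res ℛ) := by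
  obtain ⟨e, he⟩ := exists_lc_shift d (self 𝒜)
  let X := lc d (self 𝒜)
  let D := (X.res ℛ).gdual
  let W := (omega 𝒜 d).res ℛ
  have hmem (n : ℤ) (x : lc d ((self 𝒜).shift n)) (hx : x ∈ localCohomologyComponent 𝒜 d n) :
      (e n).hom.lin x ∈ X.grading n := by
    have h1 : (e n).hom.lin x ∈ X.grading (n + 0) := (e n).hom.map_mem 0 x hx
    rwa [add_zero] at h1
  let ι (n : ℤ) : localCohomologyComponent 𝒜 d n →ₗ[k] X :=
    (show lc d ((self 𝒜).shift n) →ₗ[k] X from (e n).hom.lin.restrictScalars k) ∘ₗ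
      (localCohomologyComponent 𝒜 d n).subtype
  have hι (n : ℤ) (x) : ι n x ∈ X.grading n := hmem n x.1 x.2
  let f (n : ℤ) : D.grading n →ₗ[k] W :=
    (omegaComponents 𝒜 d).inc n ∘ₗ
      { toFun := fun φ => ((X.res ℛ).gdualEval φ.1) ∘ₗ ι (-n)
        map_add' := fun _ _ => rfl
        map_smul' := fun _ _ => rfl }
  have hf (n : ℤ) (φ) : f n φ ∈ W.grading n := (omegaComponents 𝒜 d).inc_mem n _
  let F : D ⟶ W := homMk f hf fun i n r hr φ hφ => by
    have h1 := (omegaComponents 𝒜 d).smul_inc (i := i) (j := n) rfl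
      ⟨algebraMap R B r, CentralGraded.map_mem hr⟩ (((X.res ℛ).gdualEval φ) ∘ₗ ι (-n))
    refine Eq.trans ?_ h1.symm
    refine congrArg ((omegaComponents 𝒜 d).inc (i + n)) (LinearMap.ext fun x => ?_)
    change (X.res ℛ).gdualEval φ (algebraMap R B r • ι (-(i + n)) x : X) =
      (X.res ℛ).gdualEval φ (ι (-n) (localCohomologyRightMul d _ _ x))
    refine congrArg ((X.res ℛ).gdualEval φ) ?_
    -- The action on `ω` comes from right multiplication on `B`, the action on the dual from left
    -- multiplication. For elements of the central subring the two agree.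
    have h2 : rightMul (𝒜 := 𝒜) (by omega : -(i + n) + i = -n)
        ⟨algebraMap R B r, CentralGraded.map_mem hr⟩ =
        (centralMul (by omega : -(i + n) + i = -n) (CentralGraded.map_mem hr)
          (Algebra.commutes r)).app (self 𝒜) := by
      ext x
      exact (Algebra.commutes r (show B from x)).symm
    have h3 := he (-(i + n)) i (-n) (by omega) (algebraMap R B r) (CentralGraded.map_mem hr)
      (Algebra.commutes r)
    exact (congrArg (fun t : lc d ((self 𝒜).shift (-(i + n))) ⟶ X.shift (-n) => t.lin x.1)
      (((congrArg (fun t => lcMap d t ≫ (e (-n)).hom) h2).trans h3))).symm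
  have hF {n : ℤ} {φ : D} (hφ : φ ∈ D.grading n) : F.lin φ = f n ⟨φ, hφ⟩ := homMk_apply _ _ _ hφ
  have hinv (n : ℤ) (x : X) (hx : x ∈ X.grading n) : ∃ y, ι n y = x := by
    refine ⟨⟨(e n).inv.lin x, (e n).inv.map_mem 0 x ?_⟩, ?_⟩
    · change x ∈ X.grading (n + 0)
      rwa [add_zero]
    · exact congrArg (fun t : X.shift n ⟶ X.shift n => t.lin x) (e n).inv_hom_id
  have hinj : Function.Injective F.lin := by
    rw [← LinearMap.ker_eq_bot, eq_bot_iff]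
    intro φ hφ
    refine D.ext_comp fun n => ?_
    have h1 : F.lin (D.comp n φ) = 0 := ker_homog F n φ hφ
    rw [hF (D.comp_mem n φ)] at h1
    have h2 := (omegaComponents 𝒜 d).inc_injective n (h1.trans (map_zero _).symm)
    rw [map_zero]
    refine gdual_ext fun x => ?_
    induction x using (X.res ℛ).induction_homog with
    | h0 => simp
    | ha x y hx hy => rw [map_add, map_add, hx, hy]
    | hh m x hx =>
      by_cases hm : m = -n
      · subst hm
        obtain ⟨y, rfl⟩ := hinv _ x hx
        exact LinearMap.congr_fun h2 y
      · exact D.comp_mem n φ m hm x hx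
  have hsurj : Function.Surjective F.lin := by
    intro w
    induction w using W.induction_homog with
    | h0 => exact ⟨0, map_zero _⟩
    | ha x y hx hy =>
      obtain ⟨a, rfl⟩ := hx
      obtain ⟨b, rfl⟩ := hy
      exact ⟨a + b, map_add _ _ _⟩
    | hh n w hw =>
      obtain ⟨ψ, rfl⟩ := (omegaComponents 𝒜 d).exists_inc hw
      let ψ' : localCohomologyComponent 𝒜 d (-n) →ₗ[k] k := ψ
      let θ : X →ₗ[k] localCohomologyComponent 𝒜 d (-n) :=
        LinearMap.codRestrict _ ((show X →ₗ[k] lc d ((self 𝒜).shift (-n)) from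
          (e (-n)).inv.lin.restrictScalars k) ∘ₗ X.comp (-n)) fun x => by
            refine (e (-n)).inv.map_mem 0 _ ?_
            change X.comp (-n) x ∈ X.grading (-n + 0)
            rw [add_zero]
            exact X.comp_mem _ _
      have hθ (y) : θ (ι (-n) y) = y := by
        refine Subtype.ext ?_
        refine (congrArg (e (-n)).inv.lin (X.comp_same (hι (-n) y))).trans ?_
        exact congrArg (fun t : lc d ((self 𝒜).shift (-n)) ⟶ lc d ((self 𝒜).shift (-n)) =>
          t.lin y.1) (e (-n)).hom_inv_id
      have hθ0 (m : ℤ) (hm : m ≠ -n) (x : X) (hx : x ∈ X.grading m) : θ x = 0 := by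
        refine Subtype.ext ?_
        exact (congrArg (e (-n)).inv.lin (X.comp_ne hx hm)).trans (map_zero _)
      obtain ⟨φ, hφ⟩ := exists_gdualEval (X := X.res ℛ) (φ := ψ' ∘ₗ θ) (s := {-n})
        fun m hm x hx => by
          rw [Finset.mem_singleton] at hm
          exact (congrArg ψ' (hθ0 m hm x hx)).trans (map_zero ψ')
      have hφn : φ ∈ D.grading n := fun m hm x hx => by
        refine (LinearMap.congr_fun hφ x).trans ?_
        exact (congrArg ψ' (hθ0 m hm x hx)).trans (map_zero ψ')
      refine ⟨φ, (hF hφn).trans ?_⟩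
      refine congrArg ((omegaComponents 𝒜 d).inc n) (LinearMap.ext fun y => ?_)
      exact (LinearMap.congr_fun hφ (ι (-n) y)).trans (congrArg ψ' (hθ y))
  exact ⟨LinearEquiv.ofBijective F.lin ⟨hinj, hsurj⟩⟩

variable [IsNoetherianRing R] [Module.Finite R B]

include ℛ in
/-- The dualizing module is finitely generated and its local cohomology vanishes below degree `d`. -/
theorem omega_finite_and_lc_isZero [Infinite k] (hB : IsCommonlyGraded 𝒜) (d : ℕ)
    (h : ∀ i, d < i → ∀ M : GrMod 𝒜, IsZero (lc i M)) (h0 : ∀ i < d, IsZero (lc i (self 𝒜))) :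
    Module.Finite B (omega 𝒜 d) ∧ ∀ i < d, IsZero (lc i (omega 𝒜 d)) := by
  obtain ⟨L, hL⟩ := exists_isTorsion_of_component ℛ 𝒜
  have hL : IsTorsionDegree ℛ 𝒜 L := hL
  obtain ⟨e⟩ := exists_omega_equiv ℛ 𝒜 d
  have : IsNoetherianRing B :=
    isNoetherianRing_iff.2 (isNoetherian_of_tower R (isNoetherian_of_isNoetherianRing_of_finite R B))
  have hfin : Module.Finite B (self 𝒜) := inferInstanceAs (Module.Finite B B)
  have h1 := (isCofinite_lc (ℛ := ℛ) hL hB d (self 𝒜)).1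
  have h2 : Module.Finite R ((omega 𝒜 d).res ℛ) := Module.Finite.equiv e
  refine ⟨finite_of_res (ℛ := ℛ) _, fun i hi => ?_⟩
  -- The induction starts from the zero ideal and `P = B`, which generates: a homogeneous `x` of
  -- degree `n` is the image of `1` under a map from the shift of `B` by `-n`.
  obtain ⟨ys, hlen, hys, hreg⟩ := exists_isWeaklyRegular hL hB d ⊥ (fun i hi M _ _ => h i hi M)
    (self 𝒜) hfin bot_le (fun M _ n x hx =>
      ⟨-n, ⟨LinearMap.toSpanSingleton B M x, fun i b hb => by
        have := M.smul_mem (show (show B from b) ∈ 𝒜 (-n + i) from hb) hx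
        rw [show -n + i + n = i by omega] at this
        exact this⟩, (1 : B), one_smul B x⟩) h0
  exact lc_isZero_of_isWeaklyRegular hL.1 ys hys _
    ((LinearEquiv.isWeaklyRegular_congr e ys).1 hreg) i (hlen ▸ hi)

end

end GrMod

end GradedCM

/-! ### Finite products and graded Hom modules over endomorphism rings. -/

namespace GradedCM

namespace GrMod

variable {k B : Type u} [Field k] [Ring B] [Algebra k B] {𝒜 : ℤ → Submodule k B}

/-! ### Finite products -/

section Pi

variable {ι : Type u} [Finite ι]

/-- The product of a finite family of graded modules. -/
def pi (M : ι → GrMod 𝒜) : GrMod 𝒜 where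
  carrier := ∀ i, M i
  grading n := Submodule.pi Set.univ fun i => (M i).grading n
  isInternal := by
    classical
    have := Fintype.ofFinite ι
    refine isInternal_of_proj (V := ∀ i, M i) _
      (fun n => LinearMap.pi fun i => (M i).comp n ∘ₗ LinearMap.proj i) ?_ ?_ ?_
    · intro n x hx
      exact funext fun i => (M i).comp_same (hx i trivial)
    · intro n m x hx h
      exact funext fun i => (M i).comp_ne (hx i trivial) h
    · intro x
      choose s hs hs' using fun i => (M i).exists_support (x i)
      refine mem_iSup_of_comp (V := ∀ i, M i) _ (Finset.univ.biUnion s)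
        (fun n i => (M i).comp n (x i)) (fun n i _ => (M i).comp_mem n (x i)) (funext fun i => ?_)
      rw [Finset.sum_apply]
      refine Eq.trans ?_ (hs i)
      refine (Finset.sum_subset (fun n hn => ?_) fun n _ hn => hs' i n hn).symm
      exact Finset.mem_biUnion.2 ⟨i, Finset.mem_univ i, hn⟩
  smul_mem hb hx i _ := (_ : GrMod 𝒜).smul_mem hb (hx i trivial)

variable (M : ι → GrMod 𝒜)

/-- The projections from a finite product. -/
def piProj (i : ι) : pi M ⟶ M i := ⟨LinearMap.proj i, fun _ _ h => h i trivial⟩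

/-- The inclusions into a finite product. -/
def piSingle (i : ι) : M i ⟶ pi M :=
  letI := Classical.decEq ι
  ⟨LinearMap.single B (fun i => M i) i, fun n x h j _ => by
    by_cases hj : i = j
    · subst hj
      exact (congrArg (· ∈ (M i).grading n) (Pi.single_eq_same (M := fun i => M i) i x)).mpr h
    · refine (congrArg (· ∈ (M j).grading n)
        (Pi.single_eq_of_ne (M := fun i => M i) (Ne.symm hj) x)).mpr (zero_mem _)⟩

variable {M}

/-- A morphism to a finite product. -/
def piLift {Y : GrMod 𝒜} (f : ∀ i, Y ⟶ M i) : Y ⟶ pi M :=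
  ⟨LinearMap.pi fun i => (f i).lin, fun n x h i _ => (f i).map_mem n x h⟩

lemma piSingle_proj (i : ι) : piSingle M i ≫ piProj M i = 𝟙 _ := by
  classical
  ext x
  exact Pi.single_eq_same (M := fun i => M i) i x

lemma sum_single_proj [Fintype ι] (x : pi M) :
    ∑ i, (piSingle M i).lin ((piProj M i).lin x) = x := by
  classical
  refine Eq.trans (Finset.sum_congr rfl fun i _ => ?_) (Finset.univ_sum_single (M := fun i => M i) x)
  exact congrArg (fun (_ : DecidableEq ι) => Pi.single (M := fun i => M i) i (x i))
    (Subsingleton.elim _ _)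

lemma pi_finite [∀ i, Module.Finite B (M i)] : Module.Finite B (pi M) :=
  inferInstanceAs (Module.Finite B (∀ i, M i))

lemma pi_lc_isZero [GradedAlgebra 𝒜] {n : ℕ} (h : ∀ i, IsZero (lc n (M i))) :
    IsZero (lc n (pi M)) := by
  have := Fintype.ofFinite ι
  have h1 : 𝟙 (pi M) = ∑ i, piProj M i ≫ piSingle M i := by
    ext x
    refine (sum_single_proj x).symm.trans ?_
    let ev : (pi M ⟶ pi M) →+ pi M :=
      { toFun := fun f => f.lin x, map_zero' := rfl, map_add' := fun _ _ => rfl }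
    exact (map_sum ev (fun i => piProj M i ≫ piSingle M i) Finset.univ).symm
  rw [IsZero.iff_id_eq_zero, ← CategoryTheory.Functor.map_id, h1, Functor.map_sum]
  refine Finset.sum_eq_zero fun i _ => ?_
  refine (Functor.map_comp _ _ _).trans ?_
  rw [(h i).eq_of_tgt ((localCohomology 𝒜 n).map (piProj M i)) 0, zero_comp]

end Pi

/-! ### Graded homomorphism modules -/

section Hom

variable [GradedAlgebra 𝒜] (N Y Z : GrMod 𝒜)

/-- The linear maps of degree `n`. -/
def homDeg (n : ℤ) : Submodule k (N →ₗ[B] Y) where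
  carrier := {g | ∀ i, ∀ x ∈ N.grading i, g x ∈ Y.grading (n + i)}
  add_mem' h h' i x hx := add_mem (h i x hx) (h' i x hx)
  zero_mem' _ _ _ := zero_mem _
  smul_mem' c _ h i x hx := Submodule.smul_mem _ c (h i x hx)

lemma smul_comp_add {i : ℤ} {b : B} (hb : b ∈ 𝒜 i) (n j : ℤ) (y : Y) :
    Y.comp (n + (i + j)) (b • y) = b • Y.comp (n + j) y := by
  rw [show n + (i + j) = i + (n + j) by omega, Y.comp_smul hb]

variable {N Y Z}

lemma linearMap_ext {g g' : N →ₗ[B] Y} (h : ∀ n, ∀ x ∈ N.grading n, g x = g' x) : g = g' := by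
  ext x
  induction x using N.induction_homog with
  | h0 => simp
  | ha x y hx hy => rw [map_add, map_add, hx, hy]
  | hh n x hx => exact h n x hx

lemma exists_homComp (n : ℤ) (g : N →ₗ[B] Y) :
    ∃ g' : N →ₗ[B] Y, ∀ i, ∀ x ∈ N.grading i, g' x = Y.comp (n + i) (g x) := by
  let f : N ⟶ Y.shift n := homMk (M := N) (N := Y.shift n)
    (fun i => (Y.comp (n + i) ∘ₗ g.restrictScalars k) ∘ₗ (N.grading i).subtype)
    (fun i x => Y.comp_mem _ _) fun i j b hb x hx => by
      change Y.comp (n + (i + j)) (g (b • x)) = b • Y.comp (n + j) (g x)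
      rw [map_smul, smul_comp_add Y hb]
  exact ⟨f.lin, fun i x hx => homMk_apply (N := Y.shift n) _ _ _ hx⟩

/-- The component of degree `n` of a linear map. -/
def homCompLin (n : ℤ) (g : N →ₗ[B] Y) : N →ₗ[B] Y := (exists_homComp n g).choose

lemma homCompLin_apply (n : ℤ) (g : N →ₗ[B] Y) {i : ℤ} {x : N} (hx : x ∈ N.grading i) :
    homCompLin n g x = Y.comp (n + i) (g x) := (exists_homComp n g).choose_spec i x hx

variable (N Y) in
/-- The projection to the linear maps of degree `n`. -/
def homComp (n : ℤ) : (N →ₗ[B] Y) →ₗ[k] (N →ₗ[B] Y) where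
  toFun := homCompLin n
  map_add' g g' := linearMap_ext fun i x hx => by
    rw [LinearMap.add_apply, homCompLin_apply _ _ hx, homCompLin_apply _ _ hx,
      homCompLin_apply _ _ hx, LinearMap.add_apply, map_add]
  map_smul' c g := linearMap_ext fun i x hx => by
    rw [RingHom.id_apply, LinearMap.smul_apply, homCompLin_apply _ _ hx, homCompLin_apply _ _ hx,
      LinearMap.smul_apply, map_smul]

lemma homComp_apply (n : ℤ) (g : N →ₗ[B] Y) {i : ℤ} {x : N} (hx : x ∈ N.grading i) :
    homComp N Y n g x = Y.comp (n + i) (g x) := homCompLin_apply n g hx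

variable (N Y) in
-- Finite generation of `N` is what makes a linear map a finite sum of homogeneous ones: its values
-- on finitely many homogeneous generators have finitely many components.
lemma homDeg_isInternal [Module.Finite B N] : DirectSum.IsInternal (homDeg N Y) := by
  classical
  refine isInternal_of_proj _ (homComp N Y) ?_ ?_ ?_
  · intro n g hg
    refine linearMap_ext fun i x hx => ?_
    rw [homComp_apply n g hx, Y.comp_same (hg i x hx)]
  · intro n m g hg h
    refine linearMap_ext fun i x hx => ?_
    rw [homComp_apply n g hx, Y.comp_ne (hg i x hx) (by omega)]
    rfl
  · intro g
    obtain ⟨T, d, hd, hT⟩ := exists_homog_generators N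
    choose s hs hs' using fun t => Y.exists_support (g t)
    refine mem_iSup_of_comp _ (T.biUnion fun t => (s t).image fun m => m - d t)
      (fun n => homComp N Y n g) (fun n i x hx => ?_) ?_
    · rw [homComp_apply n g hx]
      exact Y.comp_mem _ _
    · refine LinearMap.ext_on hT fun t ht => ?_
      rw [LinearMap.sum_apply, Finset.sum_congr rfl fun n _ => homComp_apply n g (hd t ht)]
      have hinj : Set.InjOn (fun n : ℤ => n + d t)
          (T.biUnion fun t => (s t).image fun m => m - d t) := fun a _ b _ h => by
        simpa using h
      rw [← Finset.sum_image (f := fun m => Y.comp m (g t)) hinj]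
      refine Eq.trans ?_ (hs t)
      refine (Finset.sum_subset (fun m hm => ?_) fun m _ hm => hs' t m hm).symm
      exact Finset.mem_image.2 ⟨m - d t, Finset.mem_biUnion.2 ⟨t, ht,
        Finset.mem_image.2 ⟨m, hm, rfl⟩⟩, by omega⟩

variable (N) in
/-- The grading of the endomorphism ring. -/
def endGrading (n : ℤ) : Submodule k (Module.End B N) := homDeg N N n

instance [Module.Finite B N] : GradedAlgebra (endGrading N) where
  one_mem i x hx := by
    rw [zero_add]
    exact hx
  mul_mem i j f g hf hg l x hx := by
    rw [add_assoc]
    exact hf _ _ (hg l x hx)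
  toDecomposition := (homDeg_isInternal N N).chooseDecomposition

variable [Module.Finite B N]

variable (N Y) in
/-- The right action of endomorphisms on homomorphisms. -/
@[reducible] def homModule : Module (Module.End B N)ᵐᵒᵖ (N →ₗ[B] Y) where
  smul a g := g ∘ₗ a.unop
  one_smul _ := rfl
  mul_smul _ _ _ := rfl
  smul_zero _ := rfl
  smul_add _ _ _ := rfl
  add_smul _ _ g := LinearMap.ext fun _ => map_add g _ _
  zero_smul g := LinearMap.ext fun _ => map_zero g

variable (N Y) in
/-- The graded module of homomorphisms from `N`, over the opposite of the endomorphism ring. -/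
def hom : GrMod (opGrading (endGrading N)) :=
  letI := homModule N Y
  { carrier := N →ₗ[B] Y
    tower := ⟨fun c a g => LinearMap.ext fun x => lin_smul g c (a.unop x)⟩
    grading := homDeg N Y
    isInternal := homDeg_isInternal N Y
    smul_mem := fun {i j a g} ha hg l x hx => by
      rw [mem_opGrading] at ha
      have h1 := hg (i + l) _ (ha l x hx)
      rw [show j + (i + l) = i + j + l by omega] at h1
      exact h1 }

/-- Composition with a morphism. -/
def homMap (f : Y ⟶ Z) : hom N Y ⟶ hom N Z where
  lin :=
    { toFun := fun g => f.lin ∘ₗ (show N →ₗ[B] Y from g)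
      map_add' := fun g g' => LinearMap.ext fun x => map_add f.lin ((show N →ₗ[B] Y from g) x)
        ((show N →ₗ[B] Y from g') x)
      map_smul' := fun _ _ => rfl }
  map_mem _ _ hg i x hx := f.map_mem _ _ (hg i x hx)

/-- The functor `Hom(N, -)` maps retracts to retracts. -/
def homRetract (h : Retract Y Z) : Retract (hom N Y) (hom N Z) where
  i := homMap h.i
  r := homMap h.r
  retract := by
    ext g
    exact LinearMap.ext fun x => congrArg (fun f : Y ⟶ Y => f.lin ((show N →ₗ[B] Y from g) x))
      h.retract

/-- `Hom(N, -)` is always left exact, so surjectivity on the right is the only requirement. -/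
lemma hom_shortExact {f : Y ⟶ Z} {W : GrMod 𝒜} {g : Z ⟶ W} {w : f ≫ g = 0}
    (hS : (ShortComplex.mk f g w).ShortExact)
    (hg : Function.Surjective (homMap (N := N) g).lin) :
    ∃ w', (ShortComplex.mk (homMap (N := N) f) (homMap g) w').ShortExact := by
  have hf : Function.Injective f.lin := by
    have : Mono f := hS.mono_f
    exact injective_of_mono f
  have w0 (x) : g.lin (f.lin x) = 0 := congrArg (fun t : Y ⟶ W => t.lin x) w
  have hex := (exact_iff _).1 hS.exact
  refine ⟨?_, shortExact_mk _ _ _ (fun a b h => ?_) hg fun b hb => ?_⟩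
  · ext a
    exact LinearMap.ext fun x => w0 _
  · exact LinearMap.ext fun x => hf (LinearMap.congr_fun h x)
  · have hb' (x : N) : g.lin ((show N →ₗ[B] Z from b) x) = 0 := LinearMap.congr_fun hb x
    let e := LinearEquiv.ofInjective f.lin hf
    let b' : N →ₗ[B] LinearMap.range f.lin := LinearMap.codRestrict _ (show N →ₗ[B] Z from b)
      fun x => hex _ (hb' x)
    refine ⟨show N →ₗ[B] Y from e.symm.toLinearMap ∘ₗ b', LinearMap.ext fun x => ?_⟩
    exact congrArg Subtype.val (e.apply_symm_apply (b' x))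

end Hom

end GrMod

end GradedCM

/-! ### Auslander's argument for the endomorphism ring. -/

namespace GradedCM

lemma isNoetherian_linearMap (R : Type*) {B X Y : Type*} [CommRing R] [IsNoetherianRing R] [Ring B]
    [Algebra R B] [Module.Finite R B] [AddCommGroup X] [Module B X] [Module.Finite B X]
    [AddCommGroup Y] [Module B Y] [Module.Finite B Y] [Module R Y]
    [IsScalarTower R B Y] : IsNoetherian R (X →ₗ[B] Y) := by
  obtain ⟨T, hT⟩ := Module.Finite.fg_top (R := B) (M := X)
  have : Module.Finite R Y := Module.Finite.trans B Y
  let ev : (X →ₗ[B] Y) →ₗ[R] (T → Y) :=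
    { toFun := fun f t => f t
      map_add' := fun _ _ => rfl
      map_smul' := fun _ _ => rfl }
  refine isNoetherian_of_injective ev fun f g h => LinearMap.ext_on hT fun t ht => ?_
  exact congrFun h ⟨t, ht⟩

namespace GrMod

variable {k B : Type u} [Field k] [Ring B] [Algebra k B] {𝒜 : ℤ → Submodule k B}
  [GradedAlgebra 𝒜] (N : GrMod 𝒜)

section

variable {ι : Type u} [Finite ι] (a : ι → ℤ)

/-- A finite direct sum of shifts of `N`. -/
def sumShift : GrMod 𝒜 := pi fun i => N.shift (a i)

variable [Module.Finite B N]

/-- The generators of `Hom(N, ⨁ N(a i))`. -/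
def homGen (i : ι) : hom N (N.sumShift a) :=
  show N →ₗ[B] N.sumShift a from (piSingle (fun i => N.shift (a i)) i).lin

lemma homGen_mem (i : ι) : N.homGen a i ∈ (hom N (N.sumShift a)).grading (-a i) := by
  intro l x hx
  refine (piSingle (fun i => N.shift (a i)) i).map_mem (-a i + l) x ?_
  change x ∈ N.grading (a i + (-a i + l))
  rwa [add_neg_cancel_left]

/-- The presentation of `Hom(N, ⨁ N(a i))` as a free module. -/
def homFree : free (opGrading (endGrading N)) (fun i => -a i) ⟶ hom N (N.sumShift a) :=
  freeDesc _ (N.homGen a) (N.homGen_mem a)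

lemma homFree_apply (x : ι →₀ (Module.End B N)ᵐᵒᵖ) (n : N) (j : ι) :
    (piProj (fun i => N.shift (a i)) j).lin
      ((show N →ₗ[B] N.sumShift a from (N.homFree a).lin x) n) = (x j).unop n := by
  classical
  induction x using Finsupp.induction_linear with
  | zero => exact (congrArg _ (LinearMap.congr_fun (map_zero (N.homFree a).lin) n)).trans (map_zero _)
  | add x y hx hy =>
    refine (congrArg _ (LinearMap.congr_fun (map_add (N.homFree a).lin x y) n)).trans ?_
    refine (map_add _ _ _).trans ((congrArg₂ (· + ·) hx hy).trans ?_)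
    rfl
  | single i f =>
    have h1 : (N.homFree a).lin (Finsupp.single i f) = f • N.homGen a i :=
      Finsupp.linearCombination_single _ _ _
    refine (congrArg _ (LinearMap.congr_fun h1 n)).trans ?_
    change (piSingle (fun i => N.shift (a i)) i ≫ piProj (fun i => N.shift (a i)) j).lin
      (f.unop n) = _
    by_cases h : i = j
    · subst h
      rw [piSingle_proj, Finsupp.single_eq_same]
      rfl
    · rw [Finsupp.single_eq_of_ne (Ne.symm h)]
      exact Pi.single_eq_of_ne (M := fun i => (N.shift (a i)).carrier) (Ne.symm h) _

lemma homFree_bijective : Function.Bijective (N.homFree a).lin := by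
  have := Fintype.ofFinite ι
  constructor
  · intro x y h
    refine Finsupp.ext fun j => MulOpposite.unop_injective (LinearMap.ext fun n => ?_)
    rw [← N.homFree_apply a x n j, ← N.homFree_apply a y n j, h]
  · intro g
    let g' : N →ₗ[B] N.sumShift a := g
    refine ⟨(Finsupp.equivFunOnFinite.symm fun j =>
      MulOpposite.op (show Module.End B N from (piProj (fun i => N.shift (a i)) j).lin ∘ₗ g') :
        ι →₀ (Module.End B N)ᵐᵒᵖ), LinearMap.ext fun n => funext fun j => ?_⟩
    exact N.homFree_apply a _ n j

/-- `Hom(N, ⨁ N(a i))` is free. -/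
def homFreeIso : free (opGrading (endGrading N)) (fun i => -a i) ≅ hom N (N.sumShift a) :=
  isoOfBijective (N.homFree a) (N.homFree_bijective a)

instance : Projective (hom N (N.sumShift a)) :=
  Projective.of_iso (N.homFreeIso a) inferInstance

variable {N a}

/-- `Hom(N, -)` is full on sums of shifts of `N`. -/
lemma exists_homMap_eq {Y : GrMod 𝒜} (u : hom N (N.sumShift a) ⟶ hom N Y) :
    ∃ v : N.sumShift a ⟶ Y, u = homMap v := by
  classical
  have := Fintype.ofFinite ι
  let w (i : ι) : N →ₗ[B] Y := u.lin (N.homGen a i)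
  have hw (i : ι) : ∀ l, ∀ x ∈ N.grading l, w i x ∈ Y.grading (-a i + l) :=
    u.map_mem _ _ (N.homGen_mem a i)
  let π (i : ι) : N.sumShift a →ₗ[B] N := (piProj (fun i => N.shift (a i)) i).lin
  let v : N.sumShift a ⟶ Y :=
    { lin := ∑ i, w i ∘ₗ π i
      map_mem := fun n x hx => by
        rw [LinearMap.sum_apply]
        refine sum_mem fun i _ => ?_
        have h1 : π i x ∈ N.grading (a i + n) :=
          (piProj (fun i => N.shift (a i)) i).map_mem n x hx
        have h2 := hw i _ _ h1
        rwa [neg_add_cancel_left] at h2 }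
  refine ⟨v, ?_⟩
  have hepi : Epi (N.homFree a) := epi_of_surjective _ (N.homFree_bijective a).2
  rw [← cancel_epi (N.homFree a)]
  refine free_hom_ext _ fun i => ?_
  have h1 : (N.homFree a).lin (freeGen _ i) = N.homGen a i := freeDesc_gen _ _ _ i
  refine (congrArg u.lin h1).trans (Eq.trans ?_ (congrArg (homMap v).lin h1).symm)
  refine LinearMap.ext fun n => ?_
  let y : N.sumShift a := (piSingle (fun i => N.shift (a i)) i).lin n
  change w i n = (∑ j, w j ∘ₗ π j) y
  rw [LinearMap.sum_apply, Finset.sum_eq_single i]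
  · exact (congrArg (w i) (congrArg (fun f : N.shift (a i) ⟶ N.shift (a i) => f.lin n)
      (piSingle_proj (M := fun i => N.shift (a i)) i))).symm
  · intro j _ hj
    refine (congrArg (w j) ?_).trans (map_zero (w j))
    exact Pi.single_eq_of_ne (M := fun i => (N.shift (a i)).carrier) hj n
  · intro h
    exact absurd (Finset.mem_univ i) h

variable (N) in
-- `Hom(N, -)` turns finite sums of shifts of `N` into graded free modules, so a free cover of `G`
-- has this form. Generators of degree `d t` correspond to shifts by `-d t`.
lemma exists_homCover (G : GrMod (opGrading (endGrading N)))
    [Module.Finite (Module.End B N)ᵐᵒᵖ G] :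
    ∃ (ι : Type u) (_ : Finite ι) (a : ι → ℤ) (p : hom N (N.sumShift a) ⟶ G),
      Function.Surjective p.lin := by
  obtain ⟨T, d, hd, hT⟩ := exists_homog_generators G
  let a : T → ℤ := fun t => -d t
  let q : free (opGrading (endGrading N)) (fun i => -a i) ⟶ G :=
    freeDesc _ (fun t : T => (t : G)) fun t => by
      change (t : G) ∈ G.grading (- -d t)
      rw [neg_neg]
      exact hd t t.2
  refine ⟨T, inferInstance, a, (N.homFreeIso a).inv ≫ q, ?_⟩
  have hq : Function.Surjective q.lin := by
    rw [← LinearMap.range_eq_top]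
    refine (Finsupp.range_linearCombination _).trans ?_
    exact (congrArg (Submodule.span _) Subtype.range_coe).trans hT
  exact hq.comp (surjective_of_epi (N.homFreeIso a).inv)

lemma sumShift_finite : Module.Finite B (N.sumShift a) :=
  have (i : ι) : Module.Finite B (N.shift (a i)) := inferInstanceAs (Module.Finite B N)
  pi_finite

lemma sumShift_lc_isZero {i : ℕ} (h : IsZero (lc i N)) : IsZero (lc i (N.sumShift a)) :=
  pi_lc_isZero fun j => lc_shift_isZero h (a j)

end

section

variable [Module.Finite B N]

/-- An endomorphism of very negative degree sends every generator of `N` below the lowest degree of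
`N`, hence is zero. -/
lemma opGrading_endGrading_isBddBelow (hB : (self 𝒜).IsBddBelow) :
    (self (opGrading (endGrading N))).IsBddBelow := by
  obtain ⟨b, hb⟩ := isBddBelow_of_finite hB N
  obtain ⟨T, d, hd, hT⟩ := exists_homog_generators N
  obtain ⟨D, hD⟩ : ∃ D : ℤ, ∀ t ∈ T, d t ≤ D := by
    classical
    obtain ⟨D, hD⟩ := (T.image d).exists_le
    exact ⟨-D + 2 * D, fun t ht => by linarith [hD _ (Finset.mem_image_of_mem d ht)]⟩
  refine ⟨b - D, fun n hn => eq_bot_iff.2 fun f hf => ?_⟩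
  have hf' := (mem_opGrading (endGrading N)).1 hf
  refine (Submodule.mem_bot k).2 (MulOpposite.unop_injective (LinearMap.ext_on hT fun t ht => ?_))
  have h1 := hf' (d t) t (hd t ht)
  rw [hb _ (by linarith [hD t ht]), Submodule.mem_bot] at h1
  exact h1

variable (R : Type u) [CommRing R] [IsNoetherianRing R] [Algebra R B] [Module.Finite R B]

include R

/-- The homomorphisms form a noetherian `R`-module, and `R` acts on them through central
multiplications on `N`, that is, through endomorphisms of `N`. -/
lemma hom_finite (Y : GrMod 𝒜) [Module.Finite B Y] :
    Module.Finite (Module.End B N)ᵐᵒᵖ (hom N Y) := by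
  let _ : Module R N := Module.compHom N (algebraMap R B)
  have : IsScalarTower R B N := ⟨fun r b x => by
    rw [Algebra.smul_def, mul_smul]
    rfl⟩
  let _ : Module R Y := Module.compHom Y (algebraMap R B)
  have : IsScalarTower R B Y := ⟨fun r b x => by
    rw [Algebra.smul_def, mul_smul]
    rfl⟩
  have := isNoetherian_linearMap R (B := B) (X := N) (Y := Y)
  obtain ⟨T, hT⟩ := IsNoetherian.noetherian (⊤ : Submodule R (N →ₗ[B] Y))
  refine ⟨⟨(show Finset (hom N Y) from T), eq_top_iff.2 fun g _ => ?_⟩⟩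
  have key (g : N →ₗ[B] Y) (hg : g ∈ Submodule.span R (T : Set (N →ₗ[B] Y))) :
      (show hom N Y from g) ∈ Submodule.span (Module.End B N)ᵐᵒᵖ
        ((show Finset (hom N Y) from T) : Set (hom N Y)) := by
    induction hg using Submodule.span_induction with
    | mem x hx => exact Submodule.subset_span hx
    | zero => exact zero_mem _
    | add x y _ _ hx hy => exact add_mem hx hy
    | smul r x _ hx =>
      have h1 : (show hom N Y from r • x) = MulOpposite.op (r • (1 : Module.End B N)) •
          (show hom N Y from x) := by
        refine LinearMap.ext fun n => ?_
        exact (map_smul x (algebraMap R B r) n).symm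
      exact h1 ▸ Submodule.smul_mem _ _ hx
  exact key g (hT ▸ Submodule.mem_top)

lemma end_isNoetherianRing : IsNoetherianRing (Module.End B N) ∧
    IsNoetherianRing (Module.End B N)ᵐᵒᵖ := by
  let _ : Module R N := Module.compHom N (algebraMap R B)
  have : IsScalarTower R B N := ⟨fun r b x => by
    rw [Algebra.smul_def, mul_smul]
    rfl⟩
  have h1 : IsNoetherian R (Module.End B N) := isNoetherian_linearMap R
  have h2 : IsNoetherian R (Module.End B N)ᵐᵒᵖ :=
    isNoetherian_of_linearEquiv (MulOpposite.opLinearEquiv R)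
  exact ⟨isNoetherianRing_iff.2 (isNoetherian_of_tower R h1),
    isNoetherianRing_iff.2 (isNoetherian_of_tower R h2)⟩

variable {N}

/-- `Y` is a direct summand of a finite sum of shifts of `N`. -/
def IsAdd (N Y : GrMod 𝒜) : Prop :=
  ∃ (ι : Type u) (_ : Finite ι) (a : ι → ℤ), Nonempty (Retract Y (N.sumShift a))

variable {d : ℕ} (hlc : ∀ i < d, IsZero (lc i N)) (p : N →ₗ[B] B) (x₀ : N) (hp : p x₀ = 1)
  (hadd : ∀ Y : GrMod 𝒜, Module.Finite B Y → (∀ i < d, IsZero (lc i Y)) → N.IsAdd Y)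

include hlc hp hadd

/-- `e` counts the missing depth of `Y`. With none missing, `Y` is a summand of a sum of shifts of
`N` and `Hom(N, Y)` is projective. Otherwise the kernel of a cover by such a sum, chosen to stay
surjective under `Hom(N, -)`, has one less missing. -/
theorem hom_hasProjectiveDimensionLT (e : ℕ) (Y : GrMod 𝒜) [Module.Finite B Y]
    (h : ∀ i, i + e < d → IsZero (lc i Y)) : HasProjectiveDimensionLT (hom N Y) (e + 1) := by
  have hnoeth : IsNoetherianRing B :=
    isNoetherianRing_iff.2 (isNoetherian_of_tower R (isNoetherian_of_isNoetherianRing_of_finite R B))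
  induction e generalizing Y with
  | zero =>
    obtain ⟨ι, _, a, ⟨r⟩⟩ := hadd Y inferInstance h
    have : Projective (hom N Y) := (homRetract (N := N) r).projective
    rw [zero_add]
    exact projective_iff_hasProjectiveDimensionLT_one.1 this
  | succ e ih =>
    have := N.hom_finite R Y
    obtain ⟨ι, _, a, q, hq⟩ := N.exists_homCover (hom N Y)
    obtain ⟨v, rfl⟩ := exists_homMap_eq q
    -- Here `B` has to be a summand of `N`: each `y` is the value at `x₀` of the map `n ↦ p n • y`,
    -- and that map lifts through `v`.
    have hv : Function.Surjective v.lin := fun y => by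
      obtain ⟨g, hg⟩ := hq (show N →ₗ[B] Y from LinearMap.toSpanSingleton B Y y ∘ₗ p)
      refine ⟨(show N →ₗ[B] N.sumShift a from g) x₀, (LinearMap.congr_fun hg x₀).trans ?_⟩
      refine (congrArg (LinearMap.toSpanSingleton B Y y) hp).trans ?_
      exact one_smul B y
    have hS := exact_of_surjective v hv
    have hfin := sumShift_finite (N := N) (a := a)
    have hK : Module.Finite B ((N.sumShift a).sub _ (ker_homog v)) :=
      inferInstanceAs (Module.Finite B (LinearMap.ker v.lin))
    -- Since the sum of shifts of `N` has depth at least `d`, the long exact sequence moves the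
    -- vanishing for `Y` up by one degree on the kernel.
    have h1 := ih ((N.sumShift a).sub _ (ker_homog v)) fun i hi => by
      cases i with
      | zero => exact lc_zero_isZero₁ hS (sumShift_lc_isZero (hlc 0 (by omega)))
      | succ i => exact lc_isZero₁ hS i (h i (by omega)) (sumShift_lc_isZero (hlc _ (by omega)))
    obtain ⟨w, hS'⟩ := hom_shortExact (N := N) hS hq
    have hproj : Projective (hom N (N.sumShift a)) := inferInstance
    exact (hS'.hasProjectiveDimensionLT_X₃_iff e hproj).2 h1

/-- By fullness, the first two terms of a presentation of `G` come from a map `v` between sums of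
shifts of `N`, and the second syzygy is `Hom(N, ker v)` by left exactness. The kernel has depth at
least `min(2, d)`, so at most `d - 2` further steps are needed. -/
theorem hasProjectiveDimensionLT_of_finite (G : GrMod (opGrading (endGrading N)))
    [Module.Finite (Module.End B N)ᵐᵒᵖ G] : HasProjectiveDimensionLT G (max 2 d + 1) := by
  have hnoethB : IsNoetherianRing B :=
    isNoetherianRing_iff.2 (isNoetherian_of_tower R (isNoetherian_of_isNoetherianRing_of_finite R B))
  have hnoeth := (N.end_isNoetherianRing R).2
  obtain ⟨ι, _, a, q, hq⟩ := N.exists_homCover G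
  have hN0 := sumShift_finite (N := N) (a := a)
  have hN0' := N.hom_finite R (N.sumShift a)
  let K := (hom N (N.sumShift a)).sub _ (ker_homog q)
  have hK : Module.Finite (Module.End B N)ᵐᵒᵖ K :=
    inferInstanceAs (Module.Finite _ (LinearMap.ker q.lin))
  obtain ⟨ι', _, a', q', hq'⟩ := N.exists_homCover K
  have hN1 := sumShift_finite (N := N) (a := a')
  obtain ⟨v, hv⟩ := exists_homMap_eq (q' ≫ (hom N (N.sumShift a)).subι _ (ker_homog q))
  let Y := (N.sumShift a').sub _ (ker_homog v)
  have hY : Module.Finite B Y := inferInstanceAs (Module.Finite B (LinearMap.ker v.lin))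
  have hvq (g) : (homMap (N := N) v).lin g = (q'.lin g).1 := by
    rw [← hv]
    rfl
  let j : Y ⟶ N.sumShift a' := (N.sumShift a').subι _ (ker_homog v)
  have hS : ∃ w, (ShortComplex.mk (homMap (N := N) j) q' w).ShortExact := by
    refine ⟨?_, shortExact_mk _ _ _ (fun b c h => ?_) hq' fun b hb => ?_⟩
    · ext b
      refine Subtype.ext ((hvq _).symm.trans (LinearMap.ext fun x => ?_))
      exact ((show N →ₗ[B] Y from b) x).2
    · exact LinearMap.ext fun x => Subtype.ext (LinearMap.congr_fun h x)
    · have h1 : (homMap (N := N) v).lin b = 0 := (hvq b).trans (congrArg Subtype.val hb)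
      exact ⟨show N →ₗ[B] Y from LinearMap.codRestrict (LinearMap.ker v.lin)
        (show N →ₗ[B] N.sumShift a' from b) fun x => LinearMap.congr_fun h1 x, rfl⟩
  -- The subtraction is truncated, so for `d < 2` no depth is missing and the condition reads `i <
  -- d`. Degree `0` uses that `Y` is a submodule; degree `1` uses that the image of `v` is a
  -- submodule of a module of positive depth.
  have hYlc : ∀ i, i + (d - 2) < d → IsZero (lc i Y) := fun i hi => by
    have hS1 : (ShortComplex.mk j (codRestrict v _ (range_homog v) fun x => ⟨x, rfl⟩) (by
        ext x
        exact Subtype.ext x.2)).ShortExact :=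
      shortExact_mk _ _ _ Subtype.val_injective
        (by
          rintro ⟨_, x, rfl⟩
          exact ⟨x, rfl⟩)
        fun y hy => ⟨⟨y, congrArg Subtype.val hy⟩, rfl⟩
    have hS2 := exact_of_injective ((N.sumShift a).subι _ (range_homog v)) Subtype.val_injective
    match i with
    | 0 => exact lc_zero_isZero₁ hS1 (sumShift_lc_isZero (hlc 0 (by omega)))
    | 1 => exact lc_isZero₁ hS1 0 (lc_zero_isZero₁ hS2 (sumShift_lc_isZero (hlc 0 (by omega))))
            (sumShift_lc_isZero (hlc 1 (by omega)))
    | i + 2 => omega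
  have h1 := hom_hasProjectiveDimensionLT R hlc p x₀ hp hadd (d - 2) Y hYlc
  obtain ⟨w, hS⟩ := hS
  have hproj : Projective (hom N (N.sumShift a)) := inferInstance
  have hproj' : Projective (hom N (N.sumShift a')) := inferInstance
  have h2 := (hS.hasProjectiveDimensionLT_X₃_iff _ hproj').2 h1
  have h3 := ((exact_of_surjective q hq).hasProjectiveDimensionLT_X₃_iff _ hproj).2 h2
  rwa [show max 2 d + 1 = d - 2 + 1 + 2 by omega]

/-- Auslander's bound for the global dimension of the endomorphism ring of a module `N` whose
direct summands of shifts are the modules of depth at least `d`. -/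
theorem globalDim_end_le (hB : (self 𝒜).IsBddBelow) :
    globalDim (Module.End B N) ≤ (max 2 d : ℕ) := by
  have := (N.end_isNoetherianRing R).1
  exact globalDim_le_of_finite k _ fun X hX =>
    hasProjectiveDimensionLT_of_graded (opGrading_endGrading_isBddBelow N hB) _
      (fun G _ => hasProjectiveDimensionLT_of_finite R hlc p x₀ hp hadd G) X hX

end

end GrMod

end GradedCM

/-! ### Decomposition into indecomposables and the final bound. -/

namespace GradedCM

namespace GrMod

variable {k B : Type u} [Field k] [Ring B] [Algebra k B] {𝒜 : ℤ → Submodule k B}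
  [GradedAlgebra 𝒜]

/-! ### Finite-dimensionality of spaces of morphisms -/

lemma finite_grading (hB : ∀ i, FiniteDimensional k (𝒜 i)) (M : GrMod 𝒜) [Module.Finite B M]
    (n : ℤ) : FiniteDimensional k (M.grading n) := by
  obtain ⟨T, d, hd, hT⟩ := exists_homog_generators M
  let W (t : M) : Submodule k M :=
    (𝒜 (n - d t)).map ((LinearMap.toSpanSingleton B M t).restrictScalars k)
  have hfg : (⨆ t ∈ T, W t).FG := Submodule.fg_biSup _ _ fun t _ =>
    Submodule.FG.map _ ((Module.Finite.iff_fg (N := 𝒜 (n - d t))).1 (hB _))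
  have : FiniteDimensional k (⨆ t ∈ T, W t : Submodule k M) := Module.Finite.iff_fg.2 hfg
  refine Submodule.finiteDimensional_of_le (S₂ := ⨆ t ∈ T, W t) fun x hx => ?_
  have hxT : x ∈ Submodule.span B (T : Set M) := hT ▸ Submodule.mem_top
  obtain ⟨f, -, hf⟩ := Submodule.mem_span_finset.1 hxT
  rw [← M.comp_same hx, ← hf, map_sum]
  refine sum_mem fun t ht => ?_
  rw [M.comp_smul_of_mem (hd t ht)]
  exact Submodule.mem_iSup_of_mem t (Submodule.mem_iSup_of_mem ht
    ⟨_, selfComp_mem (n - d t) (f t), rfl⟩)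

/-- A degree-preserving map is determined by its values on finitely many homogeneous generators,
which lie in finite-dimensional components. -/
lemma finite_hom (hB : ∀ i, FiniteDimensional k (𝒜 i)) (M P : GrMod 𝒜) [Module.Finite B M]
    [Module.Finite B P] : Module.Finite k (M ⟶ P) := by
  obtain ⟨T, d, hd, hT⟩ := exists_homog_generators M
  have := P.finite_grading hB
  let ev : (M ⟶ P) →ₗ[k] (∀ t : T, P.grading (d t)) :=
    { toFun := fun f t => ⟨f.lin t, f.map_mem _ _ (hd t t.2)⟩
      map_add' := fun _ _ => rfl
      map_smul' := fun _ _ => rfl }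
  refine Module.Finite.of_injective ev fun f g h => Hom.ext (LinearMap.ext_on hT fun t ht => ?_)
  exact congrArg Subtype.val (congrFun h ⟨t, ht⟩)

/-! ### Summands of sums of shifts -/

section Add

variable {N Y Z : GrMod 𝒜}

lemma IsAdd.of_retract (r : Retract Y Z) (h : N.IsAdd Z) : N.IsAdd Y := by
  obtain ⟨ι, _, a, ⟨r'⟩⟩ := h
  exact ⟨ι, inferInstance, a, ⟨r.trans r'⟩⟩

lemma isAdd_shift (N : GrMod 𝒜) (j : ℤ) : N.IsAdd (N.shift j) :=
  ⟨PUnit, inferInstance, fun _ => j,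
    ⟨⟨piSingle (fun _ => N.shift j) PUnit.unit, piProj (fun _ => N.shift j) PUnit.unit,
      piSingle_proj (M := fun _ => N.shift j) PUnit.unit⟩⟩⟩

lemma IsAdd.biprod (hY : N.IsAdd Y) (hZ : N.IsAdd Z) : N.IsAdd (Y ⊞ Z) := by
  obtain ⟨ι, _, a, ⟨r⟩⟩ := hY
  obtain ⟨κ, _, b, ⟨s⟩⟩ := hZ
  let M : ι ⊕ κ → GrMod 𝒜 := fun l => N.shift (Sum.elim a b l)
  let p : pi M ⟶ N.sumShift a := piLift fun i => piProj M (Sum.inl i)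
  let q : pi M ⟶ N.sumShift b := piLift fun i => piProj M (Sum.inr i)
  let f : Y ⊞ Z ⟶ pi M := piLift fun l => match l with
    | Sum.inl i => biprod.fst ≫ r.i ≫ piProj (fun i => N.shift (a i)) i
    | Sum.inr i => biprod.snd ≫ s.i ≫ piProj (fun i => N.shift (b i)) i
  have h1 : f ≫ p = biprod.fst ≫ r.i := rfl
  have h2 : f ≫ q = biprod.snd ≫ s.i := rfl
  refine ⟨ι ⊕ κ, inferInstance, Sum.elim a b,
    ⟨⟨f, p ≫ r.r ≫ biprod.inl + q ≫ s.r ≫ biprod.inr, ?_⟩⟩⟩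
  refine (Preadditive.comp_add _ _ _ f _ _).trans ?_
  have h3 : f ≫ p ≫ r.r ≫ biprod.inl = biprod.fst ≫ (biprod.inl : Y ⟶ Y ⊞ Z) := by
    rw [← Category.assoc, h1, Category.assoc, ← Category.assoc r.i, r.retract, Category.id_comp]
  have h4 : f ≫ q ≫ s.r ≫ biprod.inr = biprod.snd ≫ (biprod.inr : Z ⟶ Y ⊞ Z) := by
    rw [← Category.assoc, h2, Category.assoc, ← Category.assoc s.i, s.retract, Category.id_comp]
  refine (congrArg₂ (· + ·) h3 h4).trans biprod.total

lemma isAdd_of_isZero (h : IsZero Y) : N.IsAdd Y :=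
  ⟨PEmpty, inferInstance, fun i => i.elim, ⟨⟨0, 0, h.eq_of_src _ _⟩⟩⟩

lemma finite_of_retract (r : Retract Y Z) [Module.Finite B Z] : Module.Finite B Y :=
  Module.Finite.of_surjective r.r.lin fun y =>
    ⟨r.i.lin y, congrArg (fun f : Y ⟶ Y => f.lin y) r.retract⟩

lemma lc_isZero_of_retract (r : Retract Y Z) {i : ℕ} (h : IsZero (lc i Z)) : IsZero (lc i Y) := by
  have := r.map (localCohomology 𝒜 i)
  rw [IsZero.iff_id_eq_zero, ← this.retract, h.eq_of_tgt this.i 0, zero_comp]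

lemma isZero_of_retract (r : Retract Y Z) (h : IsZero Z) : IsZero Y := by
  rw [IsZero.iff_id_eq_zero, ← r.retract, h.eq_of_tgt r.i 0, zero_comp]

/-- Block-diagonal endomorphisms embed in all endomorphisms. This makes the dimension of the
endomorphism space a measure that decreases under decomposition. -/
lemma finrank_add_le {P Q : GrMod 𝒜} (e : Y ≅ P ⊞ Q) [Module.Finite k (Y ⟶ Y)]
    [Module.Finite k (P ⟶ P)] [Module.Finite k (Q ⟶ Q)] :
    Module.finrank k (P ⟶ P) + Module.finrank k (Q ⟶ Q) ≤ Module.finrank k (Y ⟶ Y) := by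
  let Φ : ((P ⟶ P) × (Q ⟶ Q)) →ₗ[k] (Y ⟶ Y) :=
    { toFun := fun f => e.hom ≫ (biprod.fst ≫ f.1 ≫ biprod.inl + biprod.snd ≫ f.2 ≫ biprod.inr) ≫
        e.inv
      map_add' := fun f g => by
        simp only [Prod.fst_add, Prod.snd_add, Preadditive.add_comp, Preadditive.comp_add]
        abel
      map_smul' := fun c f => by
        simp only [Prod.smul_fst, Prod.smul_snd, Linear.smul_comp, Linear.comp_smul, RingHom.id_apply,
          Preadditive.add_comp, Preadditive.comp_add, smul_add] }
  rw [← Module.finrank_prod]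
  refine LinearMap.finrank_le_finrank_of_injective (f := Φ) fun f g h => ?_
  have h1 : biprod.fst ≫ f.1 ≫ biprod.inl + biprod.snd ≫ f.2 ≫ biprod.inr =
      biprod.fst ≫ g.1 ≫ biprod.inl + biprod.snd ≫ g.2 ≫ (biprod.inr : Q ⟶ P ⊞ Q) := by
    have h2 : e.hom ≫ _ ≫ e.inv = e.hom ≫ _ ≫ e.inv := h
    rwa [cancel_epi, cancel_mono] at h2
  refine Prod.ext ?_ ?_
  · have := congrArg (fun t => biprod.inl ≫ t ≫ biprod.fst) h1
    simpa using this
  · have := congrArg (fun t => biprod.inr ≫ t ≫ biprod.snd) h1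
    simpa using this

/-- If all indecomposable objects of depth at least `d` are summands of shifts of `N`, then all
objects of depth at least `d` are summands of sums of shifts of `N`. -/
theorem isAdd_of_indecomposable (hB : ∀ i, FiniteDimensional k (𝒜 i)) {d : ℕ}
    (h : ∀ Y : GrMod 𝒜, Module.Finite B Y → (∀ i < d, IsZero (lc i Y)) → Indecomposable Y →
      N.IsAdd Y)
    (Y : GrMod 𝒜) (hfin : Module.Finite B Y) (hY : ∀ i < d, IsZero (lc i Y)) : N.IsAdd Y := by
  -- Both summands of a nontrivial decomposition have a nonzero identity, so each has a strictly
  -- smaller endomorphism space than `Y`.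
  induction hn : Module.finrank k (Y ⟶ Y) using Nat.strong_induction_on generalizing Y with
  | h n ih =>
    by_cases h0 : IsZero Y
    · exact isAdd_of_isZero h0
    by_cases hind : Indecomposable Y
    · exact h Y hfin hY hind
    unfold Indecomposable at hind
    push Not at hind
    obtain ⟨P, Q, e, hP, hQ⟩ := hind h0
    let rP : Retract P Y :=
      ⟨biprod.inl ≫ e.inv, e.hom ≫ biprod.fst, by simp⟩
    let rQ : Retract Q Y :=
      ⟨biprod.inr ≫ e.inv, e.hom ≫ biprod.snd, by simp⟩
    have hPfin := finite_of_retract rP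
    have hQfin := finite_of_retract rQ
    have f1 := finite_hom hB Y Y
    have f2 := finite_hom hB P P
    have f3 := finite_hom hB Q Q
    have pos (X : GrMod 𝒜) (hX : ¬ IsZero X) (hf : Module.Finite k (X ⟶ X)) :
        0 < Module.finrank k (X ⟶ X) := by
      rw [Module.finrank_pos_iff]
      exact ⟨𝟙 X, 0, fun h => hX ((IsZero.iff_id_eq_zero X).2 h)⟩
    have h1 := finrank_add_le e
    have h2 := pos P hP f2
    have h3 := pos Q hQ f3
    have h4 := ih _ (by omega) P hPfin (fun i hi => lc_isZero_of_retract rP (hY i hi)) rfl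
    have h5 := ih _ (by omega) Q hQfin (fun i hi => lc_isZero_of_retract rQ (hY i hi)) rfl
    exact (h4.biprod h5).of_retract ⟨e.hom, e.inv, e.hom_inv_id⟩

end Add

lemma lc_prod_isZero {M P : GrMod 𝒜} {i : ℕ} (hM : IsZero (lc i M)) (hP : IsZero (lc i P)) :
    IsZero (lc i (M.prod P)) := by
  obtain ⟨_, _, w, hS⟩ := prod_shortExact M P
  exact lc_isZero₂ hS i hM hP

/-- A retract of a factor is a retract of the product. -/
def retractFst (M P : GrMod 𝒜) : Retract M (M.prod P) where
  i := ⟨LinearMap.inl B M P, fun n _ h => ⟨h, (P.grading n).zero_mem⟩⟩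
  r := ⟨LinearMap.fst B M P, fun _ _ h => h.1⟩
  retract := rfl

/-- A retract of a factor is a retract of the product. -/
def retractSnd (M P : GrMod 𝒜) : Retract P (M.prod P) where
  i := ⟨LinearMap.inr B M P, fun n _ h => ⟨(M.grading n).zero_mem, h⟩⟩
  r := ⟨LinearMap.snd B M P, fun _ _ h => h.2⟩
  retract := rfl

end GrMod

open GrMod

section Main

variable {k R B : Type u} [Field k] [CommRing R] [Algebra k R] [Ring B] [Algebra k B]
  [Algebra R B] [IsScalarTower k R B] (ℛ : ℤ → Submodule k R) (𝒜 : ℤ → Submodule k B)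
  [CentralGraded ℛ 𝒜] [GradedAlgebra ℛ] [GradedAlgebra 𝒜]

variable {𝒜} in
lemma IsMCM.lc_isZero {M : GrMod 𝒜} (h : IsMCM M) {d : ℕ} (hd : cd 𝒜 = d) (i : ℕ) (hi : i < d) :
    IsZero (lc i M) := by
  by_contra h0
  have h1 : depth M ≤ i := iInf₂_le i h0
  rw [h.2.1.2.2, h.2.2, hd] at h1
  exact absurd (by exact_mod_cast h1) (not_le.2 hi)

variable {𝒜} in
lemma lc_isZero_of_cd_lt {d : ℕ} (hd : cd 𝒜 = d) (i : ℕ) (hi : d < i) (M : GrMod 𝒜) :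
    IsZero (lc i M) := by
  by_contra h0
  have h1 : (i : ℕ∞) ≤ cd 𝒜 := le_iSup₂_of_le i ⟨M, h0⟩ le_rfl
  rw [hd] at h1
  exact absurd (by exact_mod_cast h1) (not_le.2 hi)

variable [IsNoetherianRing R] [Module.Finite R B]

variable {𝒜} in
include ℛ in
-- Only degree `d` is left for the local cohomology of `M`, and there it cannot vanish since a
-- nonzero finitely generated module has some local cohomology.
lemma isMCM_of_lc_isZero [Infinite k] (hB : (self 𝒜).IsBddBelow) {d : ℕ} (hd : cd 𝒜 = d)
    (M : GrMod 𝒜) [Module.Finite B M] (hM : ¬ IsZero M) (h : ∀ i < d, IsZero (lc i M)) :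
    IsMCM M := by
  obtain ⟨L, hL⟩ := exists_isTorsion_of_component ℛ 𝒜
  have hL : IsTorsionDegree ℛ 𝒜 L := hL
  have key (i : ℕ) (hi : ¬ IsZero (lc i M)) : i = d := by
    rcases lt_trichotomy i d with h1 | h1 | h1
    · exact absurd (h i h1) hi
    · exact h1
    · exact absurd (lc_isZero_of_cd_lt hd i h1 M) hi
  have hne : ¬ IsZero (lc d M) := fun h0 => hM (isZero_of_lc_isZero hL hB M fun i => by
    by_contra hi
    exact hi (key i hi ▸ h0))
  have h1 : depth M = d := le_antisymm (iInf₂_le d hne)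
    (le_iInf₂ fun i hi => by rw [key i hi])
  have h2 : moduleCd M = d := le_antisymm (iSup₂_le fun i hi => by rw [key i hi])
    (le_iSup₂_of_le d hne le_rfl)
  exact ⟨hd ▸ ENat.natCast_lt_top d, ⟨inferInstance, h2 ▸ ENat.natCast_lt_top d, h1.trans h2.symm⟩,
    h2.trans hd.symm⟩

include ℛ in
/-- The bound for the representation dimension, for algebras which are finite over a noetherian
commutative graded algebra. -/
theorem repDim_le [Infinite k] (hB : IsCommonlyGraded 𝒜) (hCM : IsMCM (self 𝒜))
    (hfin : IsFiniteCMType 𝒜) : repDim 𝒜 ≤ max 2 (cd 𝒜 : WithBot ℕ∞) := by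
  have hB' : (self 𝒜).IsBddBelow := hB.1
  obtain ⟨d, hd⟩ := ENat.ne_top_iff_exists.1 hCM.1.ne
  have hd : cd 𝒜 = d := hd.symm
  have hdepth : (depth (self 𝒜)).toNat = d := by
    rw [hCM.2.1.2.2, hCM.2.2, hd]
    rfl
  have hself := hCM.lc_isZero hd
  have hselffin : Module.Finite B (self 𝒜) := inferInstanceAs (Module.Finite B B)
  obtain ⟨hωfin, hω⟩ := omega_finite_and_lc_isZero ℛ 𝒜 hB d
    (fun i hi M => lc_isZero_of_cd_lt hd i hi M) hself
  obtain ⟨n, F, hF⟩ := hfin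
  -- The listed modules need not be MCM themselves. Each is replaced by a shift that is MCM, or by
  -- `B` if it has none and therefore represents no MCM module.
  have hG (i : Fin n) : ∃ G : GrMod 𝒜, IsMCM G ∧ ∀ j, IsMCM ((F i).shift j) →
      ∃ l, Nonempty ((F i).shift j ≅ G.shift l) := by
    by_cases h : ∃ j, IsMCM ((F i).shift j)
    · obtain ⟨j, hj⟩ := h
      refine ⟨(F i).shift j, hj, fun j' _ => ⟨j' - j, ⟨isoOfBijective (M := (F i).shift j')
        (N := ((F i).shift j).shift (j' - j)) ⟨LinearMap.id, fun l x hx => ?_⟩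
        Function.bijective_id⟩⟩⟩
      change x ∈ (F i).grading (j + (j' - j + l))
      have hx' : x ∈ (F i).grading (j' + l) := hx
      rwa [show j + (j' - j + l) = j' + l by omega]
    · push Not at h
      exact ⟨self 𝒜, hCM, fun j hj => absurd hj (h j)⟩
  choose G hG hGF using hG
  let G' : ULift.{u} (Fin n) → GrMod 𝒜 := fun i => G i.down
  have hG'fin (i) : Module.Finite B (G' i) := (hG i.down).2.1.1
  -- The factor `B` ensures that `M` is nonzero, hence MCM, even when the list of representatives is
  -- empty.
  let M := (self 𝒜).prod (pi G')
  have hpifin : Module.Finite B (pi G') := pi_finite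
  have hMfin : Module.Finite B M := inferInstanceAs (Module.Finite B (self 𝒜 × pi G'))
  have hMlc (i : ℕ) (hi : i < d) : IsZero (lc i M) :=
    lc_prod_isZero (hself i hi) (pi_lc_isZero fun j => (hG j.down).lc_isZero hd i hi)
  have hself0 : ¬ IsZero (self 𝒜) := fun h => by
    have h1 : depth (self 𝒜) = ⊤ := by
      refine iInf₂_eq_top.2 fun i hi => absurd ((localCohomology 𝒜 i).map_isZero h) hi
    rw [hCM.2.1.2.2, hCM.2.2, hd] at h1
    exact ENat.natCast_ne_top d h1
  have hMCM : IsMCM M := isMCM_of_lc_isZero ℛ hB' hd M (fun h => hself0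
    (isZero_of_retract (retractFst (self 𝒜) (pi G')) h)) hMlc
  let N := (self 𝒜).prod ((omega 𝒜 d).prod M)
  have hNfin : Module.Finite B N :=
    inferInstanceAs (Module.Finite B (self 𝒜 × (omega 𝒜 d × M)))
  have hNlc (i : ℕ) (hi : i < d) : IsZero (lc i N) :=
    lc_prod_isZero (hself i hi) (lc_prod_isZero (hω i hi) (hMlc i hi))
  have hadd := isAdd_of_indecomposable (N := N) hB.2 (d := d) fun Y hY hlc hind => by
    have h1 : IsMCM Y := isMCM_of_lc_isZero ℛ hB' hd Y hind.1 hlc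
    obtain ⟨i, j, ⟨e⟩⟩ := hF Y h1 hind
    have h2 : IsMCM ((F i).shift j) := by
      let r : Retract ((F i).shift j) Y := ⟨e.inv, e.hom, e.inv_hom_id⟩
      have := finite_of_retract r
      exact isMCM_of_lc_isZero ℛ hB' hd _ (fun h => hind.1 (e.isZero_iff.2 h))
        fun i hi => lc_isZero_of_retract r (hlc i hi)
    obtain ⟨l, ⟨e'⟩⟩ := hGF i j h2
    let r : Retract (G i) N :=
      (((⟨piSingle G' ⟨i⟩, piProj G' ⟨i⟩, piSingle_proj (M := G') ⟨i⟩⟩ : Retract (G' ⟨i⟩) (pi G')).trans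
        (retractSnd _ _)).trans (retractSnd _ _)).trans (retractSnd _ _)
    have r' : Retract Y ((G i).shift l) :=
      ⟨(e ≪≫ e').hom, (e ≪≫ e').inv, (e ≪≫ e').hom_inv_id⟩
    exact (isAdd_shift N l).of_retract (r'.trans (r.map (shiftFunctor 𝒜 l)))
  -- The first projection and the element `(1, 0)` exhibit `B` as a summand of `N`.
  have key := globalDim_end_le R hNlc (LinearMap.fst B (self 𝒜) ((omega 𝒜 d).prod M))
    ((1 : B), 0) rfl hadd hB'
  have hle : repDim 𝒜 ≤ globalDim (Module.End B N) := by
    refine iInf₂_le_of_le M hMCM ?_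
    rw [hdepth]
    exact le_rfl
  refine hle.trans (key.trans ?_)
  rw [hd]
  rcases le_total 2 d with h | h
  · rw [max_eq_right h]
    exact le_max_right _ _
  · rw [max_eq_left h]
    exact le_max_left _ _

end Main

end GradedCM

end

theorem corollary5p6 {k B : Type u} [Field k] [IsAlgClosed k] [CharZero k] [Ring B] [Algebra k B]
    (𝒜 : ℤ → Submodule k B) [GradedAlgebra 𝒜]
    [IsNoetherianRing B] [IsNoetherianRing Bᵐᵒᵖ]
    (hB : GradedCM.IsCommonlyGraded 𝒜)
    (hCM : GradedCM.IsCMAlgebra 𝒜)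
    (hfin : GradedCM.IsFiniteCMType 𝒜)
    (C : Subalgebra k B) (hcentral : C ≤ Subalgebra.center k B)
    (hgraded : ∀ c ∈ C, ∀ i : ℤ, (DirectSum.decompose 𝒜 c i : B) ∈ C)
    [IsNoetherianRing C] [Module.Finite C B] :
    GradedCM.repDim 𝒜 ≤ max 2 (GradedCM.cd 𝒜 : WithBot ℕ∞) := by
  have hcomm (c : C) (b : B) : (c : B) * b = b * c :=
    (Subalgebra.mem_center_iff.1 (hcentral c.2) b).symm
  -- The commutative structures extend the given ring and module structures on `C`, so the
  -- noetherian and finiteness hypotheses apply without transport.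
  let _ : CommRing C :=
    { (inferInstance : Ring C) with mul_comm := fun a b => Subtype.ext (hcomm a b) }
  let _ : Algebra C B :=
    { (inferInstance : Module C B) with
      algebraMap := C.val.toRingHom
      commutes' := hcomm
      smul_def' := fun _ _ => rfl }
  have : IsScalarTower k C B := ⟨fun a c b => smul_mul_assoc a (c : B) b⟩
  let 𝒞 (i : ℤ) : Submodule k C := (𝒜 i).comap C.val.toLinearMap
  have : GradedCM.CentralGraded 𝒞 𝒜 := ⟨fun h => h⟩
  -- `C` is closed under homogeneous components, so it inherits a grading from `B`.
  have hcomp (c : C) (n : ℤ) : GradedCM.GrMod.selfComp 𝒜 n (c : B) ∈ C := by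
    have h : GradedCM.GrMod.selfComp 𝒜 n (c : B) = DirectSum.decompose 𝒜 (c : B) n := by
      generalize (c : B) = b
      induction b using DirectSum.Decomposition.inductionOn 𝒜 with
      | zero => simp
      | add a b ha hb => rw [map_add, ha, hb, DirectSum.decompose_add]; rfl
      | @homogeneous i b =>
        by_cases h : i = n
        · subst h
          rw [GradedCM.GrMod.selfComp_same b.2, DirectSum.decompose_of_mem_same 𝒜 b.2]
        · rw [GradedCM.GrMod.selfComp_ne b.2 h, DirectSum.decompose_of_mem_ne 𝒜 b.2 h]
    rw [h]
    exact hgraded c c.2 n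
  have hint : DirectSum.IsInternal 𝒞 := by
    refine GradedCM.GrMod.isInternal_of_proj 𝒞
      (fun n => ((GradedCM.GrMod.selfComp 𝒜 n) ∘ₗ C.val.toLinearMap).codRestrict C.toSubmodule
        fun c => hcomp c n) ?_ ?_ ?_
    · exact fun n c hc => Subtype.ext (GradedCM.GrMod.selfComp_same hc)
    · exact fun n m c hc h => Subtype.ext (GradedCM.GrMod.selfComp_ne hc h)
    · intro c
      obtain ⟨s, hs⟩ := GradedCM.GrMod.exists_sum_selfComp 𝒜 (c : B)
      refine GradedCM.GrMod.mem_iSup_of_comp 𝒞 s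
        (fun n => ⟨GradedCM.GrMod.selfComp 𝒜 n c, hcomp c n⟩)
        (fun n => GradedCM.GrMod.selfComp_mem n (c : B)) (Subtype.ext ?_)
      exact (map_sum C.val _ s).trans hs
  let _ : GradedAlgebra 𝒞 :=
    { one_mem := SetLike.one_mem_graded 𝒜
      mul_mem := fun i j a b ha hb =>
        SetLike.mul_mem_graded (A := 𝒜) (gi := (a : B)) (gj := (b : B)) ha hb
      toDecomposition := hint.chooseDecomposition }
  exact GradedCM.repDim_le 𝒞 𝒜 hB hCM.1 hfin
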